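/- **Setting.** A Clifford circuit $C$ on $n$ qubits is a finite sequence of gates from $\{H,\ e^{i\frac{\pi}{4}X},\ e^{i\frac{\pi}{4}XX}\}$, each acting on a qubit or on a pair of distinct qubits. Let $h$ be the number of its Hadamard gates, let $x\in\{0,1\}^n$ be an output string, let $|x|$ be its Hamming weight, and let $\langle x|C|0^n\rangle$ be the corresponding output amplitude. *The graph.* Let $C_x$ be $C$ followed by two gates $e^{i\frac{\pi}{4}X}$ on each qubit $q$ with $x_q=1$ (so $C_{0^n}=C$). Build a multigraph $G$ on $n+h$ vertices, with a nonnegative integer $\upsilon_v$ (initially $0$) at each vertex $v$, by reading the gates of $C_x$ in order. There is one vertex for each qubit, its initial carrier, and one ancilla vertex for each Hadamard gate. A gate $e^{i\frac{\pi}{4}X}$ on a qubit with carrier $v$ increases $\upsilon_v$ by $1$. A gate $e^{i\frac{\pi}{4}XX}$ on qubits with carriers $u,v$ adds an edge $\{u,v\}$. A Hadamard gate on a qubit with carrier $t$ and with ancilla $a$ adds an edge $\{t,a\}$, increases each of $\upsilon_t$ and $\upsilon_a$ by $7$, and makes $a$ the carrier of the qubit. (This is the implementation of the circuit as a commuting circuit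 with Hamiltonian terms $\frac{\pi}{4}X_uX_v$, $\frac{\pi}{4}X_v$ by postselected Hadamard gadgets; the weight $-\frac{\pi}{4}$ is realised as $7\cdot\frac{\pi}{4}$.) The augmented graph $G'=(V',E')$ is obtained from $G$ by adding one new vertex for each connected component of $G$ and joining every vertex $v$ by $\upsilon_v$ parallel edges to the new vertex of its component. *The matroid.* Let $A$ be the oriented incidence matrix of $G'$ over $\mathbb{F}_2$, let $M$ be the binary matroid on $E'$ represented by the columns of $A$ (the cycle matroid of $G'$), let $r(M)$ be its rank, and let $V\subseteq\mathbb{F}_2^{E'}$ be the row space of $A$. The bicycle dimension is $d(V)=\dim(V\cap V^\perp)$, with $V^\perp$ taken for the standard bilinear form. When $|\mathrm{supp}(y)|\equiv 0\pmod 4$ for all $y\in V\cap V^\perp$, Brown's invariant $\sigma(V)$ is the smallest nonnegative integer such that $$\sum_{y\in V} i^{|\mathrm{supp}(y)|}=\sqrt2^{\,d(V)+\dim V}\,e^{\frac{i\pi}{4}\sigma(V)}.$$ **Theorem.** 1. If $|\mathrm{supp}(y)|\equiv 0\pmod 4$ for all $y\in V\cap V^\perp$, then $\sigma(V)$ exists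 and $$\langle x|C|0^n\rangle=\sqrt2^{\,h+d(V)-r(M)}\;e^{\frac{i\pi}{4}\left(h+|E'|-\sigma(V)-2|x|\right)}.$$ Otherwise, $\langle x|C|0^n\rangle=0$. 2. Output amplitudes of Clifford circuits can be computed exactly in polynomial time. There are a single program of a random access machine (unit cost; addition and truncated subtraction of natural numbers, indirect addressing, tests for zero, no multiplication) and a polynomial $p$ such that, for every $n$, every Clifford circuit $C$ on $n$ qubits with $L$ gates, and every $x\in\{0,1\}^n$, the program on input $(n,L,x,C)$ halts after at most $p(n+L)$ steps. It returns either $0$, in which case $\langle x|C|0^n\rangle=0$, or natural numbers $a$ and $c<8$ with $\langle x|C|0^n\rangle=\sqrt2^{-a}e^{\frac{i\pi}{4}c}$. -/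

import Mathlib

noncomputable section

/-! ### Quantum circuits over the gate set `{H, exp(iθX), exp(iθXX)}` -/

/-- A gate on `n` qubits: a Hadamard gate on a qubit, the rotation `exp(iθX)` on a qubit, or the
rotation `exp(iθXX)` on two different qubits. -/
inductive Gate (n : ℕ) : Type
  | had (q : Fin n) : Gate n
  | rotX (q : Fin n) : Gate n
  | rotXX (q r : Fin n) (h : q ≠ r) : Gate n

/-- A circuit is the list of its gates; the head of the list is applied first. -/
abbrev Circuit (n : ℕ) : Type := List (Gate n)

/-- Operators on `n` qubits, as matrices in the computational basis, whose elements are the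
bit strings of length `n`. -/
abbrev QubitOp (n : ℕ) : Type := Matrix (Fin n → ZMod 2) (Fin n → ZMod 2) ℂ

/-- The Hadamard gate on qubit `q`, tensored with the identity on the other qubits. -/
def hadamardOp {n : ℕ} (q : Fin n) : QubitOp n :=
  Matrix.of fun a b =>
    if ∀ j, j ≠ q → a j = b j then ((-1 : ℂ) ^ ((a q).val * (b q).val)) / (Real.sqrt 2 : ℂ) else 0

/-- The Pauli operator `X` on qubit `q`: it flips the bit at `q`. -/
def pauliX {n : ℕ} (q : Fin n) : QubitOp n :=
  Matrix.of fun a b => if a = b + Pi.single q 1 then 1 else 0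

/-- The unitary operator of a gate, at the angle `θ`. -/
def Gate.op {n : ℕ} (θ : ℝ) : Gate n → QubitOp n
  | .had q => hadamardOp q
  | .rotX q => NormedSpace.exp ((Complex.I * (θ : ℂ)) • pauliX q)
  | .rotXX q r _ => NormedSpace.exp ((Complex.I * (θ : ℂ)) • (pauliX q * pauliX r))

/-- The unitary operator of a circuit, at the angle `θ`. -/
def Circuit.op {n : ℕ} (θ : ℝ) : Circuit n → QubitOp n
  | [] => 1
  | g :: C => Circuit.op θ C * g.op θ

/-- The output amplitude `⟨x|C|0ⁿ⟩` of a Clifford circuit, that is, a circuit over the gate set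
`{H, exp(iθX), exp(iθXX)}` at `θ = π/4`. -/
def cliffordAmplitude {n : ℕ} (C : Circuit n) (x : Fin n → ZMod 2) : ℂ :=
  Circuit.op (Real.pi / 4) C x 0

/-- The number of Hadamard gates of a circuit. -/
def hadamardCount {n : ℕ} : Circuit n → ℕ
  | [] => 0
  | .had _ :: C => hadamardCount C + 1
  | .rotX _ :: C => hadamardCount C
  | .rotXX _ _ _ :: C => hadamardCount C

/-! ### Multigraphs and their binary matroids -/

/-- A multigraph with vertex set `V` and edge set `E`, with an orientation of the edges. -/
structure OrientedMultigraph (V E : Type) where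
  pos : E → V
  neg : E → V

open scoped Classical in
/-- The oriented incidence matrix over `F₂`: the column of an edge is `+1` at its positive end and
`-1` at its negative end (and zero if the edge is a loop). -/
def OrientedMultigraph.incidence {V E : Type} (G : OrientedMultigraph V E) :
    Matrix V E (ZMod 2) :=
  Matrix.of fun v e => (if v = G.pos e then 1 else 0) - (if v = G.neg e then 1 else 0)

/-- The vector matroid on `E` represented by the columns of a matrix: a set of elements is
independent if and only if the corresponding family of columns is linearly independent. -/
def vectorMatroid {F V E : Type} [Field F] [Finite E] (A : Matrix V E F) : Matroid E :=
  (IndepMatroid.ofFinite (E := Set.univ) Set.finite_univ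
    (fun I => LinearIndepOn F A.col I)
    (linearIndepOn_empty F A.col)
    (fun _ _ hJ hIJ => hJ.mono hIJ)
    (by
      intro I J hI hJ hlt
      by_contra! hcon
      have hsub : A.col '' J ⊆ Submodule.span F (A.col '' I) := by
        rintro _ ⟨e, he, rfl⟩
        by_cases heI : e ∈ I
        · exact Submodule.subset_span ⟨e, heI, rfl⟩
        · by_contra hns
          exact hcon e he heI (hI.insert hns)
      have hle : Submodule.span F (A.col '' J) ≤ Submodule.span F (A.col '' I) :=
        Submodule.span_le.2 hsub
      have hfin : ∀ K : Set E, LinearIndepOn F A.col K →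
          Module.finrank F (Submodule.span F (A.col '' K)) = K.ncard := by
        intro K hK
        have : Fintype K := Fintype.ofFinite K
        have h := finrank_span_eq_card (R := F) (b := fun k : K => A.col k) hK
        rw [Set.image_eq_range, h, ← Nat.card_eq_fintype_card, Nat.card_coe_set_eq]
      have : FiniteDimensional F (Submodule.span F (A.col '' I)) :=
        FiniteDimensional.span_of_finite F (Set.toFinite _)
      have := Submodule.finrank_mono hle
      rw [hfin I hI, hfin J hJ] at this
      omega)
    (fun _ _ => Set.subset_univ _)).matroid

/-- The binary matroid of a multigraph (its cycle matroid), represented over `F₂` by the columns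
of its oriented incidence matrix. -/
def OrientedMultigraph.matroid {V E : Type} [Finite E] (G : OrientedMultigraph V E) : Matroid E :=
  vectorMatroid G.incidence

/-- The linear subspace of `F₂^E` that corresponds to the binary matroid of a multigraph: the row
space of the representing matrix. -/
def OrientedMultigraph.space {V E : Type} (G : OrientedMultigraph V E) :
    Submodule (ZMod 2) (E → ZMod 2) :=
  Submodule.span (ZMod 2) (Set.range G.incidence.row)

/-! ### Bicycle dimension and Brown's invariant -/

/-- The orthogonal complement for the standard bilinear form on `F₂^S`. -/
def orthogonalSpace {S : Type} [Fintype S] (V : Submodule (ZMod 2) (S → ZMod 2)) :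
    Submodule (ZMod 2) (S → ZMod 2) :=
  V.orthogonalBilin (dotProductBilin (ZMod 2) (ZMod 2))

/-- The bicycle dimension `d(V) = dim (V ∩ V^⊥)`. -/
def bicycleDim {S : Type} [Fintype S] (V : Submodule (ZMod 2) (S → ZMod 2)) : ℕ :=
  Module.finrank (ZMod 2) ↥(V ⊓ orthogonalSpace V)

/-- Every vector of the bicycle space has a support of size divisible by four. -/
def BicycleCondition {S : Type} [Fintype S] (V : Submodule (ZMod 2) (S → ZMod 2)) : Prop :=
  ∀ x ∈ V ⊓ orthogonalSpace V, 4 ∣ hammingNorm x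

open scoped Classical in
/-- The nonnegative integers `s` with
`∑_{x ∈ V} i^{|supp x|} = √2^{d(V) + dim V} e^{iπs/4}`. -/
def brownSet {S : Type} [Fintype S] (V : Submodule (ZMod 2) (S → ZMod 2)) : Set ℕ :=
  {s | ∑ x : V, Complex.I ^ hammingNorm (x : S → ZMod 2) =
    (Real.sqrt 2 : ℂ) ^ (bicycleDim V + Module.finrank (ZMod 2) V) *
      Complex.exp (Complex.I * (Real.pi / 4 : ℝ) * s)}

/-- Brown's invariant `σ(V)`, the smallest element of `brownSet V`. -/
def brownInvariant {S : Type} [Fintype S] (V : Submodule (ZMod 2) (S → ZMod 2)) : ℕ :=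
  sInf (brownSet V)

/-! ### The graph of a circuit -/

/-- A graph-induced X-program at an angle `θ`: a list of two-body interactions `θ X_u X_v` and a
list of fields `θ X_v`, so that `H = -∑ θ X_u X_v - ∑ θ X_v`. A weight `kθ` with `k` a positive
integer appears as `k` entries. -/
structure XProgram (V : Type) where
  edges : List (V × V)
  fields : List V

/-- The X-program at `θ = π/4` that implements a circuit by Hadamard gadgets. Its qubits are the
`n` qubits of the circuit and one ancilla for each Hadamard gate; `w q` is the qubit that carries
the circuit qubit `q` at present.
A Hadamard gate on the carrier `t` takes a new ancilla `a`, applies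
`exp(iπ/4 (1 - X_t)(1 - X_a)) = e^{iπ/4} exp(-iπ/4 X_t) exp(-iπ/4 X_a) exp(iπ/4 X_t X_a)`,
postselects `t` on outcome `0`, and goes on with the carrier `a`. The weight `-π/4` is realised as
the positive multiple `7 · π/4`, since `exp(8 · iπ/4 X) = 1`.
The `n` inputs are `Sum.inl q`; the ancilla of a Hadamard gate is `Sum.inr k`, where `k` is the
number of Hadamard gates that come after it. -/
def implement {n m : ℕ} : (C : Circuit n) → hadamardCount C ≤ m → (Fin n → Fin n ⊕ Fin m) →
    XProgram (Fin n ⊕ Fin m)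
  | [], _, _ => ⟨[], []⟩
  | .rotX q :: C, h, w =>
      let P := implement C h w
      ⟨P.edges, w q :: P.fields⟩
  | .rotXX q r _ :: C, h, w =>
      let P := implement C h w
      ⟨(w q, w r) :: P.edges, P.fields⟩
  | .had q :: C, h, w =>
      let a : Fin n ⊕ Fin m := Sum.inr ⟨hadamardCount C, h⟩
      let P := implement C (Nat.le_of_succ_le h) (Function.update w q a)
      ⟨(w q, a) :: P.edges, List.replicate 7 (w q) ++ List.replicate 7 a ++ P.fields⟩

/-- The connected components of the graph of an X-program. -/
abbrev XProgram.Component {V : Type} (P : XProgram V) : Type :=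
  (SimpleGraph.fromRel fun u v => (u, v) ∈ P.edges).ConnectedComponent

/-- The edge set of the augmented graph. -/
abbrev XProgram.AugEdge {V : Type} (P : XProgram V) : Type :=
  Fin P.edges.length ⊕ Fin P.fields.length

/-- The augmented graph: one new vertex for each connected component, and each field `θ X_v`
becomes an edge between `v` and the new vertex of the component of `v`. -/
def XProgram.augmented {V : Type} (P : XProgram V) :
    OrientedMultigraph (V ⊕ P.Component) P.AugEdge where
  pos := Sum.elim (fun e => Sum.inl (P.edges.get e).1) (fun f => Sum.inl (P.fields.get f))
  neg := Sum.elim (fun e => Sum.inl (P.edges.get e).2)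
    (fun f => Sum.inr (SimpleGraph.connectedComponentMk _ (P.fields.get f)))

/-- Two gates `exp(iπ/4 X)` on each qubit `q` with `x q = 1`. They amount to `iX` on these qubits,
so that `⟨x|C|0ⁿ⟩ = (-i)^{|x|} ⟨0ⁿ|C'|0ⁿ⟩`, where `C'` is `C` followed by these gates. -/
def outputFlips {n : ℕ} (x : Fin n → ZMod 2) : Circuit n :=
  (List.finRange n).flatMap fun q => if x q = 1 then [.rotX q, .rotX q] else []

/-- The X-program of a circuit `C` and an output string `x`. -/
def circuitProgram {n : ℕ} (C : Circuit n) (x : Fin n → ZMod 2) :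
    XProgram (Fin n ⊕ Fin (hadamardCount (C ++ outputFlips x))) :=
  implement (C ++ outputFlips x) le_rfl Sum.inl

/-! ### Random access machines -/

/-- Programs of a random access machine with registers `R i` and a memory `M`, all cells of which
hold natural numbers. There is no multiplication, so the number of digits of every value stays
linear in the number of steps (and in the size of the input), and unit cost gives the usual
polynomial time. -/
inductive RAM : Type
  /-- `R i := c` -/
  | const (i c : ℕ) : RAM
  /-- `R i := R j + R k` -/
  | add (i j k : ℕ) : RAM
  /-- `R i := R j - R k`, truncated at zero -/
  | sub (i j k : ℕ) : RAM
  /-- `R i := M (R j)` -/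
  | load (i j : ℕ) : RAM
  /-- `M (R i) := R j` -/
  | store (i j : ℕ) : RAM
  /-- first `p`, then `q` -/
  | seq (p q : RAM) : RAM
  /-- if `R i ≠ 0` then `p` else `q` -/
  | ite (i : ℕ) (p q : RAM) : RAM
  /-- while `R i ≠ 0` do `p` -/
  | loop (i : ℕ) (p : RAM) : RAM

/-- A state of the machine: the contents of the registers and of the memory. -/
structure RAMState where
  reg : ℕ → ℕ
  mem : ℕ → ℕ

/-- `RAM.Exec p s t s'`: started in the state `s`, the program `p` halts after exactly `t` steps
in the state `s'`. Each instruction and each test is one step. -/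
inductive RAM.Exec : RAM → RAMState → ℕ → RAMState → Prop
  | const (i c : ℕ) (s : RAMState) :
      RAM.Exec (.const i c) s 1 ⟨Function.update s.reg i c, s.mem⟩
  | add (i j k : ℕ) (s : RAMState) :
      RAM.Exec (.add i j k) s 1 ⟨Function.update s.reg i (s.reg j + s.reg k), s.mem⟩
  | sub (i j k : ℕ) (s : RAMState) :
      RAM.Exec (.sub i j k) s 1 ⟨Function.update s.reg i (s.reg j - s.reg k), s.mem⟩
  | load (i j : ℕ) (s : RAMState) :
      RAM.Exec (.load i j) s 1 ⟨Function.update s.reg i (s.mem (s.reg j)), s.mem⟩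
  | store (i j : ℕ) (s : RAMState) :
      RAM.Exec (.store i j) s 1 ⟨s.reg, Function.update s.mem (s.reg i) (s.reg j)⟩
  | seq {p q : RAM} {s₁ s₂ s₃ : RAMState} {t u : ℕ} :
      RAM.Exec p s₁ t s₂ → RAM.Exec q s₂ u s₃ → RAM.Exec (.seq p q) s₁ (t + u) s₃
  | ite_pos {i : ℕ} {p q : RAM} {s₁ s₂ : RAMState} {t : ℕ} :
      s₁.reg i ≠ 0 → RAM.Exec p s₁ t s₂ → RAM.Exec (.ite i p q) s₁ (t + 1) s₂
  | ite_zero {i : ℕ} {p q : RAM} {s₁ s₂ : RAMState} {t : ℕ} :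
      s₁.reg i = 0 → RAM.Exec q s₁ t s₂ → RAM.Exec (.ite i p q) s₁ (t + 1) s₂
  | loop_pos {i : ℕ} {p : RAM} {s₁ s₂ s₃ : RAMState} {t u : ℕ} :
      s₁.reg i ≠ 0 → RAM.Exec p s₁ t s₂ → RAM.Exec (.loop i p) s₂ u s₃ →
        RAM.Exec (.loop i p) s₁ (t + u + 1) s₃
  | loop_zero {i : ℕ} {p : RAM} {s : RAMState} :
      s.reg i = 0 → RAM.Exec (.loop i p) s 1 s

/-- The start state: all registers are zero, and the memory holds the input, padded by zeros. -/
def RAMState.init (l : List ℕ) : RAMState where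
  reg := fun _ => 0
  mem := fun a => l.getD a 0

/-- A gate as three numbers: its kind and its (one or two) qubits. -/
def Gate.encode {n : ℕ} : Gate n → List ℕ
  | .had q => [0, q, 0]
  | .rotX q => [1, q, 0]
  | .rotXX q r _ => [2, q, r]

/-- The input of an amplitude computation: the number of qubits, the number of gates, the bits of
the output string, the gates. -/
def encodeInput {n : ℕ} (C : Circuit n) (x : Fin n → ZMod 2) : List ℕ :=
  n :: C.length :: (List.ofFn fun q => (x q).val) ++ C.flatMap Gate.encode

/-- A state of the machine is read as an exact complex number: zero if `R 0 = 0`, and otherwise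
`√2^{-R 1} e^{iπ (R 2)/4}`. -/
def RAMState.value (s : RAMState) : ℂ :=
  if s.reg 0 = 0 then 0 else
    (Real.sqrt 2 : ℂ) ^ (-(s.reg 1 : ℤ)) * Complex.exp (Complex.I * (Real.pi / 4 : ℝ) * s.reg 2)

end

/-! The amplitude is expanded in the X basis. There the rotations are diagonal, and a Hadamard gate
on a label bit c sums over a new bit d with the sign (-1)^{cd} and the factor 1/√2. Since |0ⁿ⟩ is
the uniform combination of the X basis, the amplitude becomes a constant times the average, over all
bit assignments z to the inputs and the Hadamard ancillas, of a product of local phases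
(`op_apply_zero_eq_avg`, `avg_xAmp_had`).

Formula. Put ω = e^{iπ/4}. A term of weight π/4 contributes ω, times -i if the parity it sees is
odd. The Hadamard sign is ω times one edge term and seven field terms at each end
(`avg_xAmp_eq_weight`). Hence the summand is ω^{|E'|} times the conjugate of i^{|supp y|}, where y
is the cut vector of z, and z ↦ y is linear onto the row space V (`XProgram.range_cut`). A linear
map has fibres of equal size, so only the Gauss sum S = ∑_{y ∈ V} i^{|supp y|} remains
(`avg_weight`). The function y ↦ i^{|supp y|} is quadratic with polarisation (-1)^{y·z}, so |S|² is
2^{dim V} times its sum over V ∩ V^⊥, where it is a character. If this character is nontrivial, S =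
0; otherwise |S|² = 2^{d(V) + dim V}. In the second case S is a Gaussian integer whose norm is a
power of two, hence a power of √2 times a power of ω, and σ(V) exists
(`exists_pow_omega8_of_sq_add_sq`).

Algorithm. The program does not construct the matroid. It keeps the amplitude as a power of √2, a
power of ω and the average of i^{zᵀMz} for a symmetric matrix M over ℤ/4 in N = n + L variables. An
elimination step at v adds to M a multiple of rrᵀ, where r is the parity vector of row v, and
changes the average by an explicit factor (`avg_phase_pivot`). Modulo two it is M ↦ M + rrᵀ, and
O(N²) such steps, in a fixed order without any search for a pivot, make all entries even
(`pivot_pivot_eq_zero`). The phase is then a character, and its average is 1 or 0 according to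
whether the diagonal vanishes. A step costs O(N³) instructions; the rest is total correctness of the
program with explicit time bounds. -/

open Matrix

/-- The nontrivial additive character of `ZMod 2`. -/
noncomputable def sgn (c : ZMod 2) : ℂ := (-1) ^ c.val

@[simp] lemma sgn_zero : sgn 0 = 1 := by simp [sgn]
@[simp] lemma sgn_one : sgn 1 = -1 := by simp [sgn, ZMod.val_one]

lemma zmod_two_cases (c : ZMod 2) : c = 0 ∨ c = 1 := by
  revert c; decide

lemma sgn_add (a b : ZMod 2) : sgn (a + b) = sgn a * sgn b := by
  have h : (1 + 1 : ZMod 2) = 0 := by decide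
  rcases zmod_two_cases a with rfl | rfl <;> rcases zmod_two_cases b with rfl | rfl <;> simp [h]

lemma sum_zmod_two {β : Type*} [AddCommMonoid β] (f : ZMod 2 → β) : ∑ c, f c = f 0 + f 1 :=
  Fin.sum_univ_two f

/-- The exponential series acts on an eigenvector term by term. This gives the rotations on the X
basis without diagonalising a matrix. -/
lemma exp_mulVec_of_eigen {ι : Type*} [Fintype ι] [DecidableEq ι] (A : Matrix ι ι ℂ) (v : ι → ℂ)
    (c : ℂ) (h : A *ᵥ v = c • v) : NormedSpace.exp A *ᵥ v = Complex.exp c • v := by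
  open scoped Matrix.Norms.Operator in
  have hp : ∀ k : ℕ, A ^ k *ᵥ v = c ^ k • v := by
    intro k
    induction k with
    | zero => simp
    | succ k ih => rw [pow_succ', ← mulVec_mulVec, ih, mulVec_smul, h, smul_smul, pow_succ]
  open scoped Matrix.Norms.Operator in
  have h1 := NormedSpace.exp_series_hasSum_exp' (𝕂 := ℂ) A
  have hc : Continuous fun B : Matrix ι ι ℂ => B *ᵥ v := by fun_prop
  have h2 := h1.map (Matrix.mulVec.addMonoidHomLeft v) hc
  have h3 := (NormedSpace.exp_series_hasSum_exp' (𝕂 := ℂ) c).smul_const v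
  rw [← Complex.exp_eq_exp_ℂ] at h3
  refine h2.unique ?_
  convert h3 using 2 with k
  simp [mulVec.addMonoidHomLeft, smul_mulVec, hp, smul_smul]

/-! ### Circuits in the X basis -/

section circuits

variable {n : ℕ}

/-- The (unnormalised) state of the `X` basis labelled by `b`. -/
noncomputable def chi (b : Fin n → ZMod 2) : (Fin n → ZMod 2) → ℂ := fun a => sgn (a ⬝ᵥ b)

lemma eq_add_single_iff (q : Fin n) (a b : Fin n → ZMod 2) :
    a = b + Pi.single q 1 ↔ b = a + Pi.single q 1 := by
  have h : (Pi.single q 1 + Pi.single q 1 : Fin n → ZMod 2) = 0 := by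
    rw [← Pi.single_add, CharTwo.add_self_eq_zero, Pi.single_zero]
  constructor <;> rintro rfl <;> rw [add_assoc, h, add_zero]

lemma pauliX_mulVec (q : Fin n) (v : (Fin n → ZMod 2) → ℂ) (a : Fin n → ZMod 2) :
    (pauliX q *ᵥ v) a = v (a + Pi.single q 1) := by
  simp only [mulVec, dotProduct, pauliX, of_apply, eq_add_single_iff q a, ite_mul, one_mul, zero_mul]
  simp

lemma pauliX_chi (q : Fin n) (b : Fin n → ZMod 2) : pauliX q *ᵥ chi b = sgn (b q) • chi b := by
  ext a
  rw [pauliX_mulVec]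
  simp [chi, add_dotProduct, sgn_add, mul_comm]

lemma sum_agree_off (q : Fin n) (a : Fin n → ZMod 2) (F : (Fin n → ZMod 2) → ℂ) :
    ∑ b, (if ∀ j, j ≠ q → a j = b j then F b else 0) = ∑ d, F (Function.update a q d) := by
  rw [← Finset.sum_filter]
  refine Finset.sum_nbij' (fun b => b q) (fun d => Function.update a q d) ?_ ?_ ?_ ?_ ?_
  · simp
  · intro d _
    simp only [Finset.mem_filter, Finset.mem_univ, true_and]
    intro j hj
    simp [hj]
  · intro b hb
    simp only [Finset.mem_filter, Finset.mem_univ, true_and] at hb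
    ext j
    by_cases hj : j = q
    · subst hj; simp
    · simp [hj, hb j hj]
  · simp
  · intro b hb
    simp only [Finset.mem_filter, Finset.mem_univ, true_and] at hb
    congr 1
    ext j
    by_cases hj : j = q
    · subst hj; simp
    · simp [hj, hb j hj]

lemma update_dotProduct' (a b : Fin n → ZMod 2) (q : Fin n) (d : ZMod 2) :
    Function.update a q d ⬝ᵥ b = a ⬝ᵥ b + (a q * b q + d * b q) := by
  have h : Function.update a q d = a + Pi.single q (a q + d) := by
    ext j
    by_cases hj : j = q
    · subst hj
      rw [Function.update_self, Pi.add_apply, Pi.single_eq_same, ← add_assoc,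
        CharTwo.add_self_eq_zero, zero_add]
    · simp [hj]
  rw [h, add_dotProduct, single_dotProduct, add_mul]

lemma dotProduct_update' (a b : Fin n → ZMod 2) (q : Fin n) (d : ZMod 2) :
    a ⬝ᵥ Function.update b q d = a ⬝ᵥ b + (a q * b q + a q * d) := by
  rw [dotProduct_comm, update_dotProduct', dotProduct_comm]; ring

/-- The matrix product sums over the bit d at `q`, with the sign (-1)^{a_q d + d b_q}. As a function
of a_q this is the character with label d, so the summation bit becomes the new label and d b_q
becomes the coefficient. -/
lemma hadamardOp_chi (q : Fin n) (b : Fin n → ZMod 2) :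
    hadamardOp q *ᵥ chi b =
      ((Real.sqrt 2 : ℂ))⁻¹ • ∑ c, sgn (b q * c) • chi (Function.update b q c) := by
  ext a
  have h0 (c d : ZMod 2) : (-1 : ℂ) ^ (c.val * d.val) = sgn (c * d) := by
    rcases zmod_two_cases c with rfl | rfl <;> rcases zmod_two_cases d with rfl | rfl <;>
      simp [ZMod.val_one]
  simp only [mulVec, dotProduct, hadamardOp, of_apply, ite_mul, zero_mul, Pi.smul_apply,
    Finset.sum_apply]
  rw [sum_agree_off q a (fun b' => (-1 : ℂ) ^ ((a q).val * (b' q).val) / (Real.sqrt 2 : ℂ) *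
    chi b b'), smul_eq_mul, Finset.mul_sum]
  refine Finset.sum_congr rfl fun d _ => ?_
  simp only [Function.update_self, h0, chi, update_dotProduct', dotProduct_update', sgn_add,
    smul_eq_mul, mul_comm d]
  ring

/-- The amplitude of the output `x` when a circuit is applied to a state of the `X` basis. -/
noncomputable def xAmp (θ : ℝ) (C : Circuit n) (b x : Fin n → ZMod 2) : ℂ :=
  (Circuit.op θ C *ᵥ chi b) x

variable {θ : ℝ} {C : Circuit n} {b x : Fin n → ZMod 2}

lemma xAmp_nil : xAmp θ [] b x = sgn (x ⬝ᵥ b) := by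
  simp [xAmp, Circuit.op, chi]

lemma xAmp_cons_of_eigen {g : Gate n} {c : ℂ} (h : g.op θ *ᵥ chi b = c • chi b) :
    xAmp θ (g :: C) b x = c * xAmp θ C b x := by
  simp only [xAmp, Circuit.op]
  rw [← mulVec_mulVec, h, mulVec_smul, Pi.smul_apply, smul_eq_mul]

lemma xAmp_rotX (q : Fin n) :
    xAmp θ (.rotX q :: C) b x = Complex.exp (Complex.I * θ * sgn (b q)) * xAmp θ C b x := by
  apply xAmp_cons_of_eigen
  apply exp_mulVec_of_eigen
  rw [smul_mulVec, pauliX_chi, smul_smul]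

lemma xAmp_rotXX (q r : Fin n) (h : q ≠ r) :
    xAmp θ (.rotXX q r h :: C) b x =
      Complex.exp (Complex.I * θ * sgn (b q + b r)) * xAmp θ C b x := by
  apply xAmp_cons_of_eigen
  apply exp_mulVec_of_eigen
  rw [smul_mulVec, ← mulVec_mulVec, pauliX_chi, mulVec_smul, pauliX_chi, smul_smul, smul_smul,
    sgn_add]
  ring_nf

lemma xAmp_had (q : Fin n) :
    xAmp θ (.had q :: C) b x = (Real.sqrt 2 : ℂ)⁻¹ *
      ∑ c, sgn (b q * c) * xAmp θ C (Function.update b q c) x := by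
  simp only [xAmp, Circuit.op, Gate.op]
  rw [← mulVec_mulVec, hadamardOp_chi, mulVec_smul, mulVec_sum]
  simp [mulVec_smul, Finset.sum_apply]

lemma sum_sgn_mul (c : ZMod 2) : ∑ d, sgn (c * d) = if c = 0 then 2 else 0 := by
  rw [sum_zmod_two]
  rcases zmod_two_cases c with rfl | rfl <;> norm_num

lemma sgn_sum {ι : Type*} (s : Finset ι) (f : ι → ZMod 2) :
    sgn (∑ i ∈ s, f i) = ∏ i ∈ s, sgn (f i) := by
  induction s using Finset.cons_induction with
  | empty => simp
  | cons a s ha ih => simp [sgn_add, ih]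

lemma sum_chi (a : Fin n → ZMod 2) : ∑ b, chi b a = if a = 0 then 2 ^ n else 0 := by
  simp only [chi, dotProduct, sgn_sum]
  rw [← Fintype.prod_sum fun (q : Fin n) (d : ZMod 2) => sgn (a q * d)]
  simp only [sum_sgn_mul]
  split_ifs with h
  · simp [h]
  · obtain ⟨q, hq⟩ := Function.ne_iff.1 h
    exact Finset.prod_eq_zero (Finset.mem_univ q) (by simpa using hq)

/-- By orthogonality of characters, the states `chi b` add up to 2ⁿ times the basis vector of the
zero string. -/
lemma op_apply_zero (C : Circuit n) (x : Fin n → ZMod 2) :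
    Circuit.op θ C x 0 = (2 ^ n)⁻¹ * ∑ b, xAmp θ C b x := by
  have h : ∑ b, xAmp θ C b x = (Circuit.op θ C *ᵥ ∑ b, chi b) x := by
    simp [xAmp, mulVec_sum]
  have h2 : (∑ b : Fin n → ZMod 2, chi b) = (2 ^ n : ℂ) • Pi.single 0 1 := by
    ext a
    rw [Finset.sum_apply, sum_chi]
    by_cases ha : a = 0 <;> simp [ha]
  rw [h, h2, mulVec_smul]
  simp

lemma pauliX_isHermitian (q : Fin n) : (pauliX q).IsHermitian := by
  ext a b
  simp only [conjTranspose_apply, pauliX, of_apply, eq_add_single_iff q b a]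
  split_ifs <;> simp

lemma pauliX_commute (q r : Fin n) : Commute (pauliX q) (pauliX r) := by
  refine Matrix.ext_of_mulVec_single fun a => ?_
  ext b
  rw [← mulVec_mulVec, ← mulVec_mulVec, pauliX_mulVec, pauliX_mulVec, pauliX_mulVec, pauliX_mulVec,
    add_right_comm]

lemma exp_isHermitian_mem_unitary {ι : Type*} [Fintype ι] [DecidableEq ι] {A : Matrix ι ι ℂ}
    (hA : A.IsHermitian) (θ : ℝ) :
    NormedSpace.exp ((Complex.I * θ) • A) ∈ unitary (Matrix ι ι ℂ) := by
  have hs : ((Complex.I * θ) • A)ᴴ = -((Complex.I * θ) • A) := by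
    rw [conjTranspose_smul, hA.eq]; simp
  have hu := Matrix.isUnit_exp ((Complex.I * θ) • A)
  rw [Matrix.isUnit_iff_isUnit_det] at hu
  rw [Unitary.mem_iff, star_eq_conjTranspose, ← Matrix.exp_conjTranspose, hs, Matrix.exp_neg]
  exact ⟨Matrix.nonsing_inv_mul _ hu, Matrix.mul_nonsing_inv _ hu⟩

lemma hadamardOp_isHermitian (q : Fin n) : (hadamardOp q).IsHermitian := by
  ext a b
  have h : (∀ j, j ≠ q → b j = a j) ↔ ∀ j, j ≠ q → a j = b j :=
    forall₂_congr fun j _ => eq_comm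
  simp only [conjTranspose_apply, hadamardOp, of_apply, h, mul_comm (b q).val]
  split_ifs <;> simp

lemma hadamardOp_mul_self (q : Fin n) : hadamardOp q * hadamardOp q = 1 := by
  ext a b
  rw [mul_apply]
  have h2 : ((Real.sqrt 2 : ℂ)) * (Real.sqrt 2 : ℂ) = 2 := by
    norm_cast; simp
  have h3 : ((Real.sqrt 2 : ℂ)) ≠ 0 := by
    intro h; rw [h] at h2; norm_num at h2
  have key : ∀ c, hadamardOp q a c * hadamardOp q c b =
      if ∀ j, j ≠ q → a j = c j then
        ((-1 : ℂ) ^ ((a q).val * (c q).val)) / (Real.sqrt 2 : ℂ) * hadamardOp q c b else 0 := by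
    intro c
    simp only [hadamardOp, of_apply]
    split_ifs <;> simp
  simp only [key]
  rw [sum_agree_off, sum_zmod_two]
  simp only [hadamardOp, of_apply, Function.update_self]
  have h4 : ∀ d, (∀ j, j ≠ q → Function.update a q d j = b j) ↔ ∀ j, j ≠ q → a j = b j := by
    intro d
    refine forall₂_congr fun j hj => ?_
    rw [Function.update_of_ne hj]
  simp only [h4, one_apply]
  by_cases hab : ∀ j, j ≠ q → a j = b j
  · have h5 : a = b ↔ a q = b q := by
      refine ⟨fun h => by rw [h], fun h => ?_⟩
      ext j
      by_cases hj : j = q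
      · rw [hj, h]
      · rw [hab j hj]
    simp only [if_pos hab, h5, ZMod.val_zero, ZMod.val_one]
    rcases zmod_two_cases (a q) with ha | ha <;> rcases zmod_two_cases (b q) with hb | hb <;>
      rw [ha, hb] <;> field_simp <;> norm_num [ZMod.val_one, pow_two, h2]
  · have : a ≠ b := by rintro rfl; exact hab fun _ _ => rfl
    simp [hab, this]

lemma gate_op_mem_unitary (g : Gate n) : g.op θ ∈ unitary (QubitOp n) := by
  cases g with
  | had q =>
    rw [Unitary.mem_iff, star_eq_conjTranspose]
    simp only [Gate.op, (hadamardOp_isHermitian q).eq, hadamardOp_mul_self, and_self]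
  | rotX q => exact exp_isHermitian_mem_unitary (pauliX_isHermitian q) θ
  | rotXX q r h =>
    refine exp_isHermitian_mem_unitary ?_ θ
    rw [IsHermitian, conjTranspose_mul, (pauliX_isHermitian q).eq, (pauliX_isHermitian r).eq,
      (pauliX_commute r q).eq]

lemma circuit_op_mem_unitary (C : Circuit n) : Circuit.op θ C ∈ unitary (QubitOp n) := by
  induction C with
  | nil => exact one_mem _
  | cons g C ih => exact mul_mem ih (gate_op_mem_unitary g)

/-- This serves only the program: it forces the final exponent of √2 to be at most zero, so that a
truncated subtraction returns its absolute value. -/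
lemma norm_circuit_op_apply_le (C : Circuit n) (x y : Fin n → ZMod 2) :
    ‖Circuit.op θ C x y‖ ≤ 1 :=
  entry_norm_bound_of_unitary (circuit_op_mem_unitary C) x y

end circuits

/-! ### The eighth root of unity -/

/-- The primitive eighth root of unity `e^{iπ/4}`. -/
noncomputable def omega8 : ℂ := Complex.exp (Complex.I * (Real.pi / 4 : ℝ))

lemma exp_nat_mul_omega8 (s : ℕ) : Complex.exp (Complex.I * (Real.pi / 4 : ℝ) * s) = omega8 ^ s := by
  rw [omega8, ← Complex.exp_nat_mul]; ring_nf

lemma exp_int_mul_omega8 (s : ℤ) : Complex.exp (Complex.I * (Real.pi / 4 : ℝ) * s) = omega8 ^ s := by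
  rw [omega8, ← Complex.exp_int_mul]; ring_nf

lemma omega8_ne_zero : omega8 ≠ 0 := Complex.exp_ne_zero _

lemma omega8_sq : omega8 ^ 2 = Complex.I := by
  rw [omega8, ← Complex.exp_nat_mul]
  convert Complex.exp_pi_div_two_mul_I using 2
  push_cast; ring

lemma omega8_pow_four : omega8 ^ 4 = -1 := by
  rw [show 4 = 2 * 2 from rfl, pow_mul, omega8_sq, Complex.I_sq]

lemma omega8_pow_eight : omega8 ^ 8 = 1 := by
  rw [show 8 = 4 * 2 from rfl, pow_mul, omega8_pow_four]; norm_num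

lemma omega8_inv : omega8⁻¹ = omega8 ^ 7 := by
  refine inv_eq_of_mul_eq_one_right ?_
  rw [← pow_succ', omega8_pow_eight]

lemma omega8_pow_mod (a : ℕ) : omega8 ^ (a % 8) = omega8 ^ a := by
  conv_rhs => rw [← Nat.div_add_mod a 8, pow_add, pow_mul, omega8_pow_eight, one_pow, one_mul]

lemma sqrt_two_mul_self : (Real.sqrt 2 : ℂ) * (Real.sqrt 2 : ℂ) = 2 := by norm_cast; simp

lemma sqrt_two_ne_zero : (Real.sqrt 2 : ℂ) ≠ 0 := by
  norm_cast; simp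

lemma sqrt_two_mul_omega8 : (Real.sqrt 2 : ℂ) * omega8 = 1 + Complex.I := by
  have h2 : (Real.sqrt 2 : ℂ) * ((Real.sqrt 2 : ℝ) / 2 : ℝ) = 1 := by
    push_cast; rw [mul_div_assoc', sqrt_two_mul_self]; norm_num
  rw [omega8, mul_comm Complex.I, Complex.exp_mul_I, ← Complex.ofReal_cos, ← Complex.ofReal_sin,
    Real.cos_pi_div_four, Real.sin_pi_div_four, mul_add, ← mul_assoc, h2, one_mul]

lemma norm_omega8 : ‖omega8‖ = 1 := by
  rw [omega8, mul_comm, Complex.norm_exp_ofReal_mul_I]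

/-- The eigenvalues e^{±iπ/4} share the factor ω and leave 1 and -i, so that products of eigenvalues
count a support modulo four. -/
lemma exp_sgn (c : ZMod 2) : Complex.exp (Complex.I * (Real.pi / 4 : ℝ) * sgn c) =
    omega8 * if c ≠ 0 then -Complex.I else 1 := by
  rcases zmod_two_cases c with rfl | rfl
  · simp [omega8]
  · simp only [sgn_one, mul_neg, mul_one, ne_eq, one_ne_zero, not_false_eq_true, if_true]
    rw [Complex.exp_neg]
    change omega8⁻¹ = _
    rw [omega8_inv, ← omega8_sq, show 7 = 4 + 3 from rfl, pow_add, omega8_pow_four]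
    ring

/-! ### Averages over finite groups -/

/-- The average of a function on a finite type. -/
noncomputable def avg {G : Type*} [Fintype G] (f : G → ℂ) : ℂ := (Fintype.card G : ℂ)⁻¹ * ∑ x, f x

lemma avg_const_mul {G : Type*} [Fintype G] (c : ℂ) (f : G → ℂ) :
    avg (fun x => c * f x) = c * avg f := by
  simp only [avg, ← Finset.mul_sum]; ring

/-- All fibres are cosets of the kernel and have the same size. Thus variables that do not occur may
be added at no cost, and averages over vertex assignments become averages over the row space. -/
lemma avg_comp_surjective {G H : Type*} [AddGroup G] [AddGroup H] [Fintype G] [Fintype H]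
    (φ : G →+ H) (hφ : Function.Surjective φ) (g : H → ℂ) : avg (fun x => g (φ x)) = avg g := by
  classical
  have key : ∀ g : H → ℂ, ∑ x, g (φ x) =
      ((Finset.univ.filter fun x => φ x = 0).card : ℂ) * ∑ y, g y := by
    intro g
    rw [← Finset.sum_fiberwise (s := Finset.univ) (g := φ), Finset.mul_sum]
    refine Finset.sum_congr rfl fun y _ => ?_
    rw [Finset.sum_congr rfl (g := fun _ => g y)
      (fun x hx => by rw [(Finset.mem_filter.1 hx).2]), Finset.sum_const, nsmul_eq_mul]
    congr 2
    exact AddMonoidHom.card_fiber_eq_of_mem_range φ (hφ y) (hφ 0)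
  have h1 := key fun _ => 1
  simp only [Finset.sum_const, Finset.card_univ, nsmul_eq_mul, mul_one] at h1
  have hG : (Fintype.card G : ℂ) ≠ 0 := by simp
  have hK : ((Finset.univ.filter fun x => φ x = 0).card : ℂ) ≠ 0 := by
    intro h; rw [h, zero_mul] at h1; exact hG h1
  rw [avg, avg, key, h1, mul_inv]
  field_simp

lemma avg_eq_of_shift {G : Type*} [AddGroup G] [Fintype G] (a : G) (f : G → ℂ) :
    avg (fun x => f (x + a)) = avg f := by
  rw [avg, avg, ← Equiv.sum_comp (Equiv.addRight a) f]
  rfl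

lemma avg_eq_zero_of_shift {G : Type*} [AddGroup G] [Fintype G] (a : G) (f : G → ℂ) (c : ℂ)
    (hc : c ≠ 1) (h : ∀ x, f (x + a) = c * f x) : avg f = 0 := by
  have h1 := avg_eq_of_shift a f
  simp only [h, avg_const_mul] at h1
  have h2 : (c - 1) * avg f = 0 := by rw [sub_mul, h1]; ring
  exact (mul_eq_zero.1 h2).resolve_left (sub_ne_zero.2 hc)

/-! ### Sums over labels as averages over bit assignments -/

section cube

variable {α : Type*} [Fintype α] [DecidableEq α]

/-- As `F` ignores the coordinate `a`, this coordinate can play the role of the summation variable.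
The factor 2 is the number of its values. -/
lemma avg_sum_fresh (a : α) (F : (α → ZMod 2) → ZMod 2 → ℂ)
    (hF : ∀ z c, F (z + Pi.single a 1) c = F z c) :
    avg (fun z => ∑ c, F z c) = 2 * avg fun z => F z (z a) := by
  have h1 : ∀ z : α → ZMod 2, ∑ c, F z c = F z (z a) + F z (z a + 1) := by
    intro z
    rw [sum_zmod_two]
    rcases zmod_two_cases (z a) with h | h <;> rw [h]
    · simp
    · rw [CharTwo.add_self_eq_zero, add_comm]
  have h2 := avg_eq_of_shift (Pi.single a 1) fun z : α → ZMod 2 => F z (z a)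
  simp only [Pi.add_apply, Pi.single_eq_same, hF] at h2
  simp only [h1]
  have h3 : (avg fun z : α → ZMod 2 => F z (z a) + F z (z a + 1)) =
      (avg fun z => F z (z a)) + avg fun z => F z (z a + 1) := by
    simp only [avg, Finset.sum_add_distrib, mul_add]
  rw [h3, h2, two_mul]

variable {n : ℕ} {θ : ℝ}

/-- The factor √2 is the 1/√2 of the gate times the 2 from `avg_sum_fresh`. -/
lemma avg_xAmp_had (C : Circuit n) (x : Fin n → ZMod 2) (q : Fin n) (w : Fin n → α) (a : α)
    (f : (α → ZMod 2) → ℂ) (hf : ∀ z, f (z + Pi.single a 1) = f z) (hw : ∀ j, w j ≠ a) :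
    avg (fun z => f z * xAmp θ (.had q :: C) (z ∘ w) x) =
      Real.sqrt 2 * avg fun z =>
        f z * sgn (z (w q) * z a) * xAmp θ C (z ∘ Function.update w q a) x := by
  have h1 : ∀ z : α → ZMod 2, f z * xAmp θ (.had q :: C) (z ∘ w) x = (Real.sqrt 2 : ℂ)⁻¹ *
      ∑ c, f z * sgn (z (w q) * c) * xAmp θ C (Function.update (z ∘ w) q c) x := by
    intro z
    rw [xAmp_had, Finset.mul_sum, Finset.mul_sum, Finset.mul_sum]
    refine Finset.sum_congr rfl fun c _ => ?_
    simp only [Function.comp_apply]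
    ring
  simp only [h1, avg_const_mul]
  rw [avg_sum_fresh a]
  · rw [← mul_assoc, ← sqrt_two_mul_self, inv_mul_cancel_left₀ sqrt_two_ne_zero]
    simp only [Function.comp_update]
  · intro z c
    have : (z + Pi.single a 1) ∘ w = z ∘ w := by
      ext j; simp [hw j]
    rw [hf, this]
    simp [hw q]

lemma op_apply_zero_eq_avg (C : Circuit n) (x : Fin n → ZMod 2) (w : Fin n → α)
    (hw : Function.Injective w) :
    Circuit.op θ C x 0 = avg fun z : α → ZMod 2 => xAmp θ C (z ∘ w) x := by
  let φ : (α → ZMod 2) →+ (Fin n → ZMod 2) :=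
    { toFun := fun z => z ∘ w, map_zero' := rfl, map_add' := fun _ _ => rfl }
  have h := avg_comp_surjective φ (hw.surjective_comp_right (γ := ZMod 2)) fun b => xAmp θ C b x
  rw [op_apply_zero]
  change _ = avg fun z => xAmp θ C (φ z) x
  rw [h, avg]
  simp [ZMod.card]

end cube

/-! ### Gauss sums of quadratic characters on binary spaces -/

section brown

variable {S : Type} [Fintype S]

/-- The quadratic character `i^{|supp y|}`. -/
noncomputable def qchar (y : S → ZMod 2) : ℂ := Complex.I ^ hammingNorm y

lemma pow_hammingNorm (c : ℂ) (y : S → ZMod 2) :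
    c ^ hammingNorm y = ∏ e, if y e ≠ 0 then c else 1 := by
  rw [hammingNorm, Finset.prod_ite]; simp

/-- The support of a sum loses each common element twice, and i^{-2} = -1. -/
lemma qchar_add (y z : S → ZMod 2) : qchar (y + z) = qchar y * qchar z * sgn (y ⬝ᵥ z) := by
  simp only [qchar, pow_hammingNorm, dotProduct, sgn_sum, ← Finset.prod_mul_distrib]
  refine Finset.prod_congr rfl fun e _ => ?_
  have h : (1 + 1 : ZMod 2) = 0 := by decide
  rcases zmod_two_cases (y e) with h1 | h1 <;> rcases zmod_two_cases (z e) with h2 | h2 <;>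
    simp [h1, h2, h]

lemma qchar_mul_conj (y : S → ZMod 2) : qchar y * (starRingEnd ℂ) (qchar y) = 1 := by
  rw [qchar, map_pow, Complex.conj_I, ← mul_pow]; simp

lemma qchar_eq_one_iff (y : S → ZMod 2) : qchar y = 1 ↔ 4 ∣ hammingNorm y := by
  rw [qchar, Complex.isPrimitiveRoot_I.pow_eq_one_iff_dvd]

lemma mem_orthogonalSpace (V : Submodule (ZMod 2) (S → ZMod 2)) (z : S → ZMod 2) :
    z ∈ orthogonalSpace V ↔ ∀ y ∈ V, y ⬝ᵥ z = 0 := by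
  simp [orthogonalSpace, Submodule.mem_orthogonalBilin_iff]

variable (V : Submodule (ZMod 2) (S → ZMod 2))

open scoped Classical in
lemma avg_sgn (z : S → ZMod 2) :
    avg (fun y : V => sgn ((y : S → ZMod 2) ⬝ᵥ z)) = if z ∈ orthogonalSpace V then 1 else 0 := by
  rw [mem_orthogonalSpace]
  split_ifs with h
  · simp [avg, h _ (Subtype.prop _)]
  · push Not at h
    obtain ⟨y0, hy0, h⟩ := h
    have h1 := (zmod_two_cases (y0 ⬝ᵥ z)).resolve_left h
    refine avg_eq_zero_of_shift (⟨y0, hy0⟩ : V) _ (-1) (by norm_num) fun y => ?_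
    simp [add_dotProduct, sgn_add, h1]

open scoped Classical in
/-- The Gauss sum of a binary space. -/
noncomputable def gaussSumOf : ℂ := ∑ y : V, qchar (y : S → ZMod 2)

open scoped Classical in
lemma card_eq_two_pow {W : Type*} [AddCommGroup W] [Module (ZMod 2) W] [Fintype W] :
    (Fintype.card W : ℂ) = 2 ^ Module.finrank (ZMod 2) W := by
  rw [Module.card_eq_pow_finrank (K := ZMod 2), ZMod.card]; simp

open scoped Classical in
-- With x = y + z in the double sum, `qchar_add` turns q(y + z) times the conjugate of q(y) into
-- q(z)(-1)^{y·z}. The sum over y ∈ V then vanishes unless z ∈ V^⊥.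
lemma gaussSumOf_mul_conj : gaussSumOf V * (starRingEnd ℂ) (gaussSumOf V) =
    2 ^ Module.finrank (ZMod 2) V *
      ∑ z : ↥(V ⊓ orthogonalSpace V), qchar (z : S → ZMod 2) := by
  have h1 : gaussSumOf V * (starRingEnd ℂ) (gaussSumOf V) =
      ∑ z : V, qchar (z : S → ZMod 2) * ∑ y : V, sgn ((y : S → ZMod 2) ⬝ᵥ z) := by
    rw [gaussSumOf, map_sum, Finset.mul_sum]
    have h2 : ∀ y : V, (∑ x : V, qchar (x : S → ZMod 2)) * (starRingEnd ℂ) (qchar (y : S → ZMod 2))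
        = ∑ z : V, qchar (z : S → ZMod 2) * sgn ((y : S → ZMod 2) ⬝ᵥ z) := by
      intro y
      rw [← Equiv.sum_comp (Equiv.addLeft y), Finset.sum_mul]
      refine Finset.sum_congr rfl fun z _ => ?_
      rw [Equiv.coe_addLeft, Submodule.coe_add, qchar_add]
      linear_combination (qchar (z : S → ZMod 2) * sgn ((y : S → ZMod 2) ⬝ᵥ z)) *
        qchar_mul_conj (y : S → ZMod 2)
    simp only [h2]
    rw [Finset.sum_comm]
    simp only [Finset.mul_sum]
  have h3 : ∀ z : V, ∑ y : V, sgn ((y : S → ZMod 2) ⬝ᵥ z) = 2 ^ Module.finrank (ZMod 2) V *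
      if (z : S → ZMod 2) ∈ orthogonalSpace V then 1 else 0 := by
    intro z
    rw [← avg_sgn, avg, card_eq_two_pow, mul_inv_cancel_left₀ (by simp)]
  rw [h1]
  simp only [h3, mul_ite, mul_one, mul_zero]
  rw [← Finset.sum_filter, Finset.mul_sum]
  symm
  refine Finset.sum_bij (fun z _ => ⟨z.1, z.2.1⟩) ?_ ?_ ?_ ?_
  · rintro ⟨z, hz⟩ _
    simpa using hz.2
  · rintro ⟨z, hz⟩ _ ⟨z', hz'⟩ _ h
    simpa using h
  · rintro ⟨z, hz⟩ h
    exact ⟨⟨z, hz, by simpa using h⟩, Finset.mem_univ _, rfl⟩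
  · intro z _
    ring

lemma gaussSumOf_mul_conj_of_bicycle (h : BicycleCondition V) :
    gaussSumOf V * (starRingEnd ℂ) (gaussSumOf V) =
      2 ^ (bicycleDim V + Module.finrank (ZMod 2) V) := by
  classical
  rw [gaussSumOf_mul_conj, pow_add, mul_comm ((2 : ℂ) ^ bicycleDim V)]
  congr 1
  rw [Finset.sum_congr rfl (g := fun _ => 1)
    fun z _ => (qchar_eq_one_iff _).2 (h z.1 z.2), Finset.sum_const, Finset.card_univ,
    nsmul_eq_mul, mul_one]
  exact card_eq_two_pow

/-- On V ∩ V^⊥ the polarisation is trivial, so translation by a vector that violates the condition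
multiplies the sum over this space by a scalar other than 1. -/
lemma gaussSumOf_eq_zero (h : ¬ BicycleCondition V) : gaussSumOf V = 0 := by
  classical
  have h1 : (∑ z : ↥(V ⊓ orthogonalSpace V), qchar (z : S → ZMod 2)) = 0 := by
    rw [BicycleCondition] at h
    push Not at h
    obtain ⟨z0, hz0, h⟩ := h
    rw [← qchar_eq_one_iff] at h
    have h2 := avg_eq_zero_of_shift (⟨z0, hz0⟩ : ↥(V ⊓ orthogonalSpace V))
      (fun z => qchar (z : S → ZMod 2)) _ h fun z => by
        rw [Submodule.coe_add, qchar_add, (mem_orthogonalSpace V z0).1 hz0.2 z z.2.1]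
        simp [mul_comm]
    rw [avg] at h2
    refine (mul_eq_zero.1 h2).resolve_left (inv_ne_zero ?_)
    exact Nat.cast_ne_zero.2 Fintype.card_ne_zero
  have h2 := gaussSumOf_mul_conj V
  rw [h1, mul_zero, Complex.mul_conj] at h2
  simpa using h2

/-- Above 2 the only Gaussian prime is 1 + i = √2 ω. A number of even norm is divisible by it, and
the descent ends at the units, which are powers of ω². -/
lemma exists_pow_omega8_of_sq_add_sq (k : ℕ) : ∀ a b : ℤ, a ^ 2 + b ^ 2 = 2 ^ k →
    ∃ s : ℕ, (a + b * Complex.I : ℂ) = (Real.sqrt 2 : ℂ) ^ k * omega8 ^ s := by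
  induction k with
  | zero =>
    intro a b h
    have ha : a ≤ 1 := by nlinarith [sq_nonneg b]
    have ha' : -1 ≤ a := by nlinarith [sq_nonneg b]
    have hb : b ≤ 1 := by nlinarith [sq_nonneg a]
    have hb' : -1 ≤ b := by nlinarith [sq_nonneg a]
    have h6 : omega8 ^ 6 = -Complex.I := by
      rw [show 6 = 4 + 2 from rfl, pow_add, omega8_pow_four, omega8_sq]; ring
    interval_cases a <;> interval_cases b <;> norm_num at h
    · exact ⟨4, by simp [omega8_pow_four]⟩
    · exact ⟨6, by simp [h6]⟩
    · exact ⟨2, by simp [omega8_sq]⟩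
    · exact ⟨0, by simp⟩
  | succ k ih =>
    intro a b h
    have h2 : (a + b) % 2 = 0 := by
      have h3 : (a ^ 2 + b ^ 2) % 2 = 0 := by rw [h, pow_succ]; simp
      rcases Int.emod_two_eq_zero_or_one a with ha | ha <;>
        rcases Int.emod_two_eq_zero_or_one b with hb | hb <;>
        simp [pow_two, Int.add_emod, Int.mul_emod, ha, hb] at h3 ⊢
    obtain ⟨c, hc⟩ : ∃ c, a + b = 2 * c := ⟨(a + b) / 2, by omega⟩
    -- The quotient (a + bi)/(1 + i) is c + (c - a)i with c = (a + b)/2.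
    obtain ⟨s, hs⟩ := ih c (c - a) (by
      have : b = 2 * c - a := by omega
      subst this
      rw [pow_succ (2 : ℤ)] at h
      linarith)
    refine ⟨s + 1, ?_⟩
    have hb : b = 2 * c - a := by omega
    rw [pow_succ, pow_succ, mul_mul_mul_comm, ← hs, sqrt_two_mul_omega8, hb]
    push_cast
    linear_combination (a - c : ℂ) * Complex.I_sq

lemma exists_int_gaussSumOf : ∃ a b : ℤ, gaussSumOf V = a + b * Complex.I := by
  classical
  have h : ∃ g : GaussianInt, gaussSumOf V = GaussianInt.toComplex g := by
    refine ⟨∑ y : V, (⟨0, 1⟩ : GaussianInt) ^ hammingNorm (y : S → ZMod 2), ?_⟩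
    have hI : GaussianInt.toComplex ⟨0, 1⟩ = Complex.I := by simp [GaussianInt.toComplex_def]
    simp only [gaussSumOf, qchar, map_sum, map_pow, hI]
  obtain ⟨g, hg⟩ := h
  exact ⟨g.re, g.im, by rw [hg, GaussianInt.toComplex_def]⟩

lemma brownSet_eq : brownSet V = {s : ℕ | gaussSumOf V =
    (Real.sqrt 2 : ℂ) ^ (bicycleDim V + Module.finrank (ZMod 2) V) * omega8 ^ s} := by
  ext s
  simp only [brownSet, gaussSumOf, qchar, exp_nat_mul_omega8]

lemma isLeast_brownInvariant (h : BicycleCondition V) :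
    IsLeast (brownSet V) (brownInvariant V) := by
  have hne : (brownSet V).Nonempty := by
    obtain ⟨a, b, hab⟩ := exists_int_gaussSumOf V
    have h1 := gaussSumOf_mul_conj_of_bicycle V h
    have h2 : a ^ 2 + b ^ 2 = 2 ^ (bicycleDim V + Module.finrank (ZMod 2) V) := by
      rw [hab, map_add, map_mul, Complex.conj_I, map_intCast, map_intCast] at h1
      have h3 : ((a ^ 2 + b ^ 2 : ℤ) : ℂ) =
          ((2 ^ (bicycleDim V + Module.finrank (ZMod 2) V) : ℤ) : ℂ) := by
        push_cast
        rw [← h1]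
        linear_combination (b : ℂ) ^ 2 * Complex.I_sq
      exact_mod_cast h3
    obtain ⟨s, hs⟩ := exists_pow_omega8_of_sq_add_sq _ a b h2
    exact ⟨s, by rw [brownSet_eq]; exact hab.trans hs⟩
  exact ⟨Nat.sInf_mem hne, fun s hs => Nat.sInf_le hs⟩

lemma gaussSumOf_eq_brown (h : BicycleCondition V) : gaussSumOf V =
    (Real.sqrt 2 : ℂ) ^ (bicycleDim V + Module.finrank (ZMod 2) V) *
      omega8 ^ brownInvariant V := by
  have := (isLeast_brownInvariant V h).1
  rwa [brownSet_eq] at this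

end brown

/-! ### The rank of the matroid and the space of the augmented graph -/

/-- A base is a maximal independent set of columns, so it spans the column space; row rank equals
column rank. -/
lemma vectorMatroid_eRank {F V E : Type} [Field F] [Finite V] [Finite E] (A : Matrix V E F) :
    (vectorMatroid A).eRank.toNat = Module.finrank F (Submodule.span F (Set.range A.row)) := by
  have := Fintype.ofFinite V
  have := Fintype.ofFinite E
  obtain ⟨B, hB⟩ := (vectorMatroid A).exists_isBase
  have hind : ∀ I : Set E, (vectorMatroid A).Indep I ↔ LinearIndepOn F A.col I := fun I => Iff.rfl
  have hBi := (hind B).1 hB.indep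
  have hspan : Submodule.span F (A.col '' B) = Submodule.span F (Set.range A.col) := by
    refine le_antisymm (Submodule.span_mono (Set.image_subset_range _ _)) (Submodule.span_le.2 ?_)
    rintro _ ⟨e, rfl⟩
    by_cases he : e ∈ B
    · exact Submodule.subset_span ⟨e, he, rfl⟩
    · by_contra hns
      have h1 := (hind _).2 (hBi.insert hns)
      exact he (hB.eq_of_subset_indep h1 (Set.subset_insert _ _) ▸ Set.mem_insert _ _)
  have hcard : Module.finrank F (Submodule.span F (A.col '' B)) = B.ncard := by
    have : Fintype B := Fintype.ofFinite B
    have h := finrank_span_eq_card (R := F) (b := fun k : B => A.col k) hBi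
    rw [Set.image_eq_range, h, ← Nat.card_eq_fintype_card, Nat.card_coe_set_eq]
  rw [← Matrix.rank_eq_finrank_span_row, Matrix.rank_eq_finrank_span_cols, ← hspan, hcard,
    ← hB.encard_eq_eRank]
  rfl

namespace XProgram

variable {V : Type} (P : XProgram V)

/-- The vector of `F₂^{E'}` given by an assignment of bits to the vertices. -/
def cut : (V → ZMod 2) →ₗ[ZMod 2] (P.AugEdge → ZMod 2) where
  toFun z := Sum.elim (fun e => z (P.edges.get e).1 + z (P.edges.get e).2)
    (fun f => z (P.fields.get f))
  map_add' z z' := by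
    ext (e | f)
    · simp only [Sum.elim_inl, Pi.add_apply]; ring
    · rfl
  map_smul' c z := by
    ext (e | f)
    · simp only [Sum.elim_inl, Pi.smul_apply, RingHom.id_apply, smul_add]
    · rfl

/-- The row of an old vertex is the cut of that vertex. The row of a new vertex is the cut of the
indicator of its component: an old edge has both ends in one component and cancels, and a field edge
is seen exactly when it belongs to the component. So the new vertices do not enlarge the span. -/
lemma range_cut [Finite V] : LinearMap.range P.cut = P.augmented.space := by
  classical
  have := Fintype.ofFinite V
  have hrow : ∀ v, P.augmented.incidence.row (Sum.inl v) = P.cut (Pi.single v 1) := by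
    intro v
    ext (e | f)
    · simp [Matrix.row, OrientedMultigraph.incidence, augmented, cut, Pi.single_apply, eq_comm,
        CharTwo.sub_eq_add]
    · simp [Matrix.row, OrientedMultigraph.incidence, augmented, cut, Pi.single_apply, eq_comm]
  have hcomp : ∀ e : Fin P.edges.length,
      (SimpleGraph.fromRel fun u v => (u, v) ∈ P.edges).connectedComponentMk (P.edges.get e).1 =
      (SimpleGraph.fromRel fun u v => (u, v) ∈ P.edges).connectedComponentMk (P.edges.get e).2 := by
    intro e
    by_cases h : (P.edges.get e).1 = (P.edges.get e).2
    · rw [h]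
    · rw [SimpleGraph.ConnectedComponent.eq]
      refine SimpleGraph.Adj.reachable ?_
      rw [SimpleGraph.fromRel_adj]
      exact ⟨h, Or.inl (List.get_mem _ _)⟩
  have hrow' : ∀ c, P.augmented.incidence.row (Sum.inr c) =
      P.cut fun v => if SimpleGraph.connectedComponentMk _ v = c then 1 else 0 := by
    intro c
    ext (e | f)
    · simp only [Matrix.row, OrientedMultigraph.incidence, augmented, cut, of_apply, Sum.elim_inl,
        LinearMap.coe_mk, AddHom.coe_mk, hcomp e, reduceCtorEq, if_false, sub_zero,
        CharTwo.add_self_eq_zero]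
    · simp [Matrix.row, OrientedMultigraph.incidence, augmented, cut, eq_comm]
  apply le_antisymm
  · rintro _ ⟨z, rfl⟩
    have hz : z = ∑ v, z v • Pi.single v (1 : ZMod 2) := by
      ext v
      simp [Finset.sum_apply, Pi.single_apply]
    rw [hz, map_sum]
    refine Submodule.sum_mem _ fun v _ => ?_
    rw [map_smul, ← hrow]
    exact Submodule.smul_mem _ _ (Submodule.subset_span ⟨_, rfl⟩)
  · rw [OrientedMultigraph.space, Submodule.span_le]
    rintro _ ⟨v | c, rfl⟩
    · exact ⟨_, (hrow v).symm⟩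
    · exact ⟨_, (hrow' c).symm⟩

/-- The eigenvalue of `exp(iπ/4 H)` on the state of the `X` basis labelled by `z`. -/
noncomputable def weight (z : V → ZMod 2) : ℂ :=
  (P.edges.map fun e => omega8 * if z e.1 + z e.2 ≠ 0 then -Complex.I else 1).prod *
    (P.fields.map fun v => omega8 * if z v ≠ 0 then -Complex.I else 1).prod

lemma weight_eq (z : V → ZMod 2) :
    P.weight z = omega8 ^ Nat.card P.AugEdge * (starRingEnd ℂ) (qchar (P.cut z)) := by
  rw [qchar, map_pow, Complex.conj_I, pow_hammingNorm, Nat.card_eq_fintype_card,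
    ← Finset.card_univ, ← Finset.prod_const, ← Finset.prod_mul_distrib, Fintype.prod_sum_type,
    weight]
  congr 1
  · rw [← Fin.prod_univ_fun_getElem]
    rfl
  · rw [← Fin.prod_univ_fun_getElem]
    rfl

end XProgram

/-! ### The amplitude as a Gauss sum over the row space -/

section graph

variable {n : ℕ}

/-- The function `f` collects the phases of the gates already read. An ancilla is numbered by the
Hadamard gates after its own, so the indices below `hadamardCount C` are those not yet in use;
neither `f` nor the carriers may involve them, which is the freshness that `avg_xAmp_had` needs.
Each Hadamard gate leaves √2 from the sum over labels and ω from the gadget. -/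
lemma avg_xAmp_eq_weight {m : ℕ} (C : Circuit n) : ∀ (h : hadamardCount C ≤ m)
    (w : Fin n → Fin n ⊕ Fin m) (f : (Fin n ⊕ Fin m → ZMod 2) → ℂ),
    (∀ j : Fin m, j < hadamardCount C → ∀ z, f (z + Pi.single (Sum.inr j) 1) = f z) →
    (∀ j : Fin m, j < hadamardCount C → ∀ q, w q ≠ Sum.inr j) →
    avg (fun z => f z * xAmp (Real.pi / 4) C (z ∘ w) 0) =
      (Real.sqrt 2 * omega8) ^ hadamardCount C *
        avg fun z => f z * (implement C h w).weight z := by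
  induction C with
  | nil =>
    intro h w f _ _
    simp [xAmp_nil, hadamardCount, implement, XProgram.weight]
  | cons g C ih =>
    intro h w f hf hw
    cases g with
    | had q =>
      have hlt : hadamardCount C < m := h
      rw [avg_xAmp_had C 0 q w (Sum.inr ⟨hadamardCount C, h⟩) f
        (hf _ (Nat.lt_succ_self _)) (hw _ (Nat.lt_succ_self _))]
      have hf' : ∀ j : Fin m, (j : ℕ) < hadamardCount C → ∀ z : Fin n ⊕ Fin m → ZMod 2,
          f (z + Pi.single (Sum.inr j) 1) = f z := fun j hj => hf j (Nat.lt_succ_of_lt hj)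
      have hw' : ∀ j : Fin m, (j : ℕ) < hadamardCount C → ∀ r, w r ≠ Sum.inr j :=
        fun j hj => hw j (Nat.lt_succ_of_lt hj)
      have hne : ∀ j : Fin m, (j : ℕ) < hadamardCount C →
          (Sum.inr ⟨hadamardCount C, h⟩ : Fin n ⊕ Fin m) ≠ Sum.inr j := by
        intro j hj heq
        have := Sum.inr_injective heq
        rw [← this] at hj
        simp at hj
      rw [ih hlt.le (Function.update w q (Sum.inr ⟨hadamardCount C, h⟩))
        (fun z => f z * sgn (z (w q) * z (Sum.inr ⟨hadamardCount C, h⟩)))]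
      · rw [hadamardCount, pow_succ, ← mul_assoc, mul_comm (Real.sqrt 2 : ℂ), mul_assoc, mul_assoc,
          mul_assoc, ← avg_const_mul omega8]
        congr 3
        ext z
        have hwt : (implement (.had q :: C) h w).weight z =
            (omega8 * if z (w q) + z (Sum.inr ⟨hadamardCount C, h⟩) ≠ 0 then -Complex.I else 1) *
            (omega8 * if z (w q) ≠ 0 then -Complex.I else 1) ^ 7 *
            (omega8 * if z (Sum.inr ⟨hadamardCount C, h⟩) ≠ 0 then -Complex.I else 1) ^ 7 *
            (implement C hlt.le
              (Function.update w q (Sum.inr ⟨hadamardCount C, h⟩))).weight z := by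
          simp only [implement, XProgram.weight, List.map_cons, List.prod_cons, List.map_append,
            List.prod_append, List.map_replicate, List.prod_replicate]
          ring
        -- The powers of ω add up to 1 + 1 + 7 + 7 = 16. The exponent of -i is 0 for c = d = 0, 8 if
        -- exactly one bit is set, and 14 if both are, which gives the sign -1.
        have key : ∀ c d : ZMod 2, sgn (c * d) = omega8 *
            ((omega8 * if c + d ≠ 0 then -Complex.I else 1) *
            (omega8 * if c ≠ 0 then -Complex.I else 1) ^ 7 *
            (omega8 * if d ≠ 0 then -Complex.I else 1) ^ 7) := by
          have h16 : omega8 ^ 16 = 1 := by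
            rw [show 16 = 8 * 2 from rfl, pow_mul, omega8_pow_eight, one_pow]
          have hI4 : Complex.I ^ 4 = 1 := Complex.I_pow_four
          have h11 : (1 + 1 : ZMod 2) = 0 := by decide
          intro c d
          rcases zmod_two_cases c with rfl | rfl <;> rcases zmod_two_cases d with rfl | rfl <;>
            simp only [h11, mul_zero, mul_one, sgn_zero, sgn_one, add_zero, zero_add,
              ne_eq, not_true_eq_false, if_false, one_ne_zero, not_false_eq_true, if_true] <;>
            ring_nf <;>
            simp only [h16, show 8 = 4 * 2 from rfl, show 14 = 4 * 3 + 2 from rfl, pow_add,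
              pow_mul, hI4, Complex.I_sq] <;> norm_num
        rw [hwt, key]
        ring
      · intro j hj z
        have h1 := hne j hj
        have h2 := hw' j hj q
        rw [hf' j hj]
        simp [h1, h2]
      · intro j hj r
        by_cases hr : r = q
        · subst hr
          simpa using hne j hj
        · simpa [hr] using hw' j hj r
    | rotX q =>
      simp only [xAmp_rotX, hadamardCount]
      have := ih h w (fun z => f z * (omega8 * if z (w q) ≠ 0 then -Complex.I else 1))
        (fun j hj z => by
          have h2 := hw j hj q
          rw [hf j hj]; simp [h2]) hw
      simp only [Function.comp_apply, exp_sgn, ← mul_assoc] at this ⊢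
      rw [this]
      congr 3
      ext z
      simp only [implement, XProgram.weight, List.map_cons, List.prod_cons]
      ring
    | rotXX q r hqr =>
      simp only [xAmp_rotXX, hadamardCount]
      have := ih h w (fun z => f z * (omega8 * if z (w q) + z (w r) ≠ 0 then -Complex.I else 1))
        (fun j hj z => by
          have h2 := hw j hj q
          have h3 := hw j hj r
          rw [hf j hj]; simp [h2, h3]) hw
      simp only [Function.comp_apply, exp_sgn, ← mul_assoc] at this ⊢
      rw [this]
      congr 3
      ext z
      simp only [implement, XProgram.weight, List.map_cons, List.prod_cons]
      ring

/-- Every gate of `C` only changes labels and multiplies by scalars, so knowing `D` on each label is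
enough: the relation at the end of `C` is carried back through its gates. -/
lemma xAmp_append {θ : ℝ} (D : Circuit n) (x : Fin n → ZMod 2) (c : ℂ)
    (hD : ∀ b, xAmp θ D b 0 = c * sgn (x ⬝ᵥ b)) (C : Circuit n) :
    ∀ b, xAmp θ (C ++ D) b 0 = c * xAmp θ C b x := by
  induction C with
  | nil => intro b; rw [List.nil_append, hD, xAmp_nil]
  | cons g C ih =>
    intro b
    rw [List.cons_append]
    cases g with
    | had q =>
      simp only [xAmp_had, ih, Finset.mul_sum]
      refine Finset.sum_congr rfl fun d _ => ?_
      ring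
    | rotX q => rw [xAmp_rotX, xAmp_rotX, ih]; ring
    | rotXX q r h => rw [xAmp_rotXX, xAmp_rotXX, ih]; ring

/-- Two rotations on a label bit b give (ω(-i)^b)² = i(-1)^b. -/
lemma xAmp_flatMap (b x : Fin n → ZMod 2) (l : List (Fin n)) :
    xAmp (Real.pi / 4) (l.flatMap fun q => if x q = 1 then [.rotX q, .rotX q] else []) b 0 =
      (l.map fun q => (if x q ≠ 0 then Complex.I else 1) * sgn (x q * b q)).prod := by
  induction l with
  | nil => simp [xAmp_nil]
  | cons q l ih =>
    rw [List.flatMap_cons, List.map_cons, List.prod_cons]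
    rcases zmod_two_cases (x q) with h | h
    · simp [h, ih]
    · rw [h]
      simp only [if_true, List.cons_append, List.nil_append, xAmp_rotX, exp_sgn, ih, ne_eq,
        one_ne_zero, not_false_eq_true, one_mul]
      rw [← mul_assoc]
      congr 1
      rw [← pow_two, mul_pow, omega8_sq]
      rcases zmod_two_cases (b q) with h' | h' <;> rw [h'] <;> simp

lemma xAmp_outputFlips (b x : Fin n → ZMod 2) :
    xAmp (Real.pi / 4) (outputFlips x) b 0 = Complex.I ^ hammingNorm x * sgn (x ⬝ᵥ b) := by
  rw [outputFlips, xAmp_flatMap, ← List.ofFn_eq_map, List.prod_ofFn, Finset.prod_mul_distrib,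
    pow_hammingNorm, dotProduct, sgn_sum]

lemma hadamardCount_append (C D : Circuit n) :
    hadamardCount (C ++ D) = hadamardCount C + hadamardCount D := by
  induction C with
  | nil => simp [hadamardCount]
  | cons g C ih => cases g <;> simp [hadamardCount, ih]; ring

lemma hadamardCount_outputFlips (x : Fin n → ZMod 2) : hadamardCount (outputFlips x) = 0 := by
  rw [outputFlips]
  induction List.finRange n with
  | nil => rfl
  | cons q l ih =>
    rw [List.flatMap_cons]
    split_ifs <;> simp [hadamardCount, ih]

lemma cliffordAmplitude_eq_avg (C : Circuit n) (x : Fin n → ZMod 2) :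
    cliffordAmplitude C x = (-Complex.I) ^ hammingNorm x * (Real.sqrt 2 * omega8) ^ hadamardCount C *
      avg (circuitProgram C x).weight := by
  have h1 : avg (fun z => (1 : ℂ) * xAmp (Real.pi / 4) (C ++ outputFlips x) (z ∘ Sum.inl) 0) =
      (Real.sqrt 2 * omega8) ^ hadamardCount (C ++ outputFlips x) *
        avg fun z => 1 * (circuitProgram C x).weight z :=
    avg_xAmp_eq_weight (C ++ outputFlips x) le_rfl Sum.inl (fun _ => 1) (fun _ _ _ => rfl)
      (fun _ _ _ => Sum.inl_ne_inr)
  simp only [one_mul, xAmp_append _ x _ (fun b => xAmp_outputFlips b x), avg_const_mul] at h1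
  have h2 : (Real.sqrt 2 * omega8) ^ hadamardCount (C ++ outputFlips x) =
      (Real.sqrt 2 * omega8) ^ hadamardCount C := by
    rw [hadamardCount_append, hadamardCount_outputFlips, add_zero]
  rw [← op_apply_zero_eq_avg C x Sum.inl Sum.inl_injective, h2] at h1
  rw [mul_assoc, ← h1, cliffordAmplitude, ← mul_assoc, ← mul_pow]
  simp

/-- The average over assignments is pushed forward along the surjection onto the row space, whose
cardinality is 2 to the rank of the matroid. -/
lemma avg_weight {V : Type} [Fintype V] [DecidableEq V] (P : XProgram V) :
    avg P.weight = omega8 ^ Nat.card P.AugEdge *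
      ((2 ^ P.augmented.matroid.eRank.toNat)⁻¹ *
        (starRingEnd ℂ) (gaussSumOf P.augmented.space)) := by
  classical
  have h := avg_comp_surjective P.cut.rangeRestrict.toAddMonoidHom
    P.cut.surjective_rangeRestrict fun y => (starRingEnd ℂ) (qchar (y : P.AugEdge → ZMod 2))
  have h2 : avg P.weight = omega8 ^ Nat.card P.AugEdge *
      avg fun y : LinearMap.range P.cut => (starRingEnd ℂ) (qchar (y : P.AugEdge → ZMod 2)) := by
    rw [← h, ← avg_const_mul]
    congr 1
    ext z
    exact P.weight_eq z
  have hfin : Finite P.Component := Quot.finite _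
  rw [h2, OrientedMultigraph.matroid, vectorMatroid_eRank, avg, card_eq_two_pow, ← map_sum]
  change _ = _ * ((2 ^ Module.finrank (ZMod 2) P.augmented.space)⁻¹ * _)
  have hr := P.range_cut
  -- The type over which the sum runs depends on the space, so the equality is substituted for a
  -- variable instead of being rewritten.
  generalize P.augmented.space = W at hr
  subst hr
  rw [gaussSumOf]
  congr!

theorem amplitude_eq_zero (C : Circuit n) (x : Fin n → ZMod 2)
    (h : ¬ BicycleCondition (circuitProgram C x).augmented.space) : cliffordAmplitude C x = 0 := by
  rw [cliffordAmplitude_eq_avg, avg_weight, gaussSumOf_eq_zero _ h]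
  simp

theorem amplitude_eq_brown (C : Circuit n) (x : Fin n → ZMod 2)
    (h : BicycleCondition (circuitProgram C x).augmented.space) :
    cliffordAmplitude C x =
      (Real.sqrt 2 : ℂ) ^ ((hadamardCount C : ℤ) +
          (bicycleDim (circuitProgram C x).augmented.space : ℤ) -
          ((circuitProgram C x).augmented.matroid.eRank.toNat : ℤ)) *
        Complex.exp (Complex.I * (Real.pi / 4 : ℝ) *
          (((hadamardCount C : ℤ) + (Nat.card (circuitProgram C x).AugEdge : ℤ) -
            (brownInvariant (circuitProgram C x).augmented.space : ℤ)
            - 2 * (hammingNorm x : ℤ) : ℤ) : ℂ)) := by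
  have hfin : Finite (circuitProgram C x).Component := Quot.finite _
  rw [cliffordAmplitude_eq_avg, avg_weight, gaussSumOf_eq_brown _ h, exp_int_mul_omega8]
  have hr : (circuitProgram C x).augmented.matroid.eRank.toNat =
      Module.finrank (ZMod 2) (circuitProgram C x).augmented.space := vectorMatroid_eRank _
  rw [← hr]
  generalize (circuitProgram C x).augmented.matroid.eRank.toNat = r
  generalize bicycleDim (circuitProgram C x).augmented.space = d
  generalize Nat.card (circuitProgram C x).AugEdge = E
  generalize brownInvariant (circuitProgram C x).augmented.space = s
  have hc : (starRingEnd ℂ) omega8 = omega8⁻¹ := by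
    rw [eq_comm, inv_eq_iff_eq_inv, Complex.inv_def]
    simp [Complex.normSq_eq_norm_sq, norm_omega8]
  have hI : -Complex.I = omega8 ^ (-2 : ℤ) := by
    rw [_root_.zpow_neg, zpow_ofNat, omega8_sq, Complex.inv_I]
  -- The rank enters twice: √2^{d + r} from the Gauss sum over 2^r from the average leaves √2^{d -
  -- r}.
  have h2 : (2 : ℂ) ^ r = (Real.sqrt 2 : ℂ) ^ r * (Real.sqrt 2 : ℂ) ^ r := by
    rw [← mul_pow, sqrt_two_mul_self]
  have hs := sqrt_two_ne_zero
  rw [h2, map_mul, map_pow, map_pow, hc, Complex.conj_ofReal, hI, _root_.zpow_sub₀ hs,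
    _root_.zpow_add₀ hs, _root_.zpow_sub₀ omega8_ne_zero, _root_.zpow_sub₀ omega8_ne_zero,
    _root_.zpow_add₀ omega8_ne_zero, _root_.zpow_mul, pow_add, mul_pow]
  simp only [zpow_natCast, _root_.zpow_neg, zpow_ofNat, inv_pow]
  have ho := omega8_ne_zero
  field_simp

end graph

/-! ### Gauss sums of quadratic forms over `ℤ/4` in binary variables -/

section quadratic

variable {N : ℕ}

/-- The value at a bit string of the quadratic form with the matrix `M`. -/
def quad (M : Fin N → Fin N → ℕ) (z : Fin N → ZMod 2) : ℕ :=
  ∑ i, ∑ j, M i j * ((z i).val * (z j).val)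

/-- The quadratic character of the form with the matrix `M`. -/
noncomputable def phase (M : Fin N → Fin N → ℕ) (z : Fin N → ZMod 2) : ℂ := Complex.I ^ quad M z

/-- Symmetric matrices with entries in `{0, 1, 2, 3}`. -/
structure Reduced (M : Fin N → Fin N → ℕ) : Prop where
  symm : ∀ i j, M i j = M j i
  lt : ∀ i j, M i j < 4

/-- The matrix `M` with `k` added modulo `4` to the entry at `(i, j)`. -/
def incr (M : Fin N → Fin N → ℕ) (i j : Fin N) (k : ℕ) : Fin N → Fin N → ℕ :=
  fun a b => if a = i ∧ b = j then (M a b + k) % 4 else M a b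

/-- One elimination step at the variable `v`. -/
def pivot (M : Fin N → Fin N → ℕ) (v : Fin N) : Fin N → Fin N → ℕ :=
  fun i j => (M i j + (3 - 2 * (M v v / 2)) * (M v i % 2 * (M v j % 2))) % 4

lemma I_pow_congr {a b : ℕ} (h : a ≡ b [MOD 4]) : Complex.I ^ a = Complex.I ^ b := by
  rw [Complex.I_pow_eq_pow_mod a, Complex.I_pow_eq_pow_mod b, h]

lemma incr_lt {M : Fin N → Fin N → ℕ} (hM : ∀ i j, M i j < 4) (i j : Fin N) (k : ℕ) (a b : Fin N) :
    incr M i j k a b < 4 := by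
  rw [incr]
  split_ifs
  · exact Nat.mod_lt _ (by norm_num)
  · exact hM a b

lemma Reduced.incr_diag {M : Fin N → Fin N → ℕ} (hM : Reduced M) (i : Fin N) (k : ℕ) :
    Reduced (incr M i i k) where
  symm a b := by simp only [incr, and_comm (a := a = i), hM.symm a b]
  lt := incr_lt hM.lt i i k

lemma Reduced.incr_pair {M : Fin N → Fin N → ℕ} (hM : Reduced M) {i j : Fin N} (hij : i ≠ j)
    (k : ℕ) : Reduced (incr (incr M i j k) j i k) where
  symm a b := by
    simp only [incr, hM.symm a b]
    by_cases h1 : a = i ∧ b = j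
    · obtain ⟨rfl, rfl⟩ := h1
      simp [hij, hij.symm]
    · by_cases h2 : a = j ∧ b = i
      · obtain ⟨rfl, rfl⟩ := h2
        simp [hij, hij.symm]
      · have h3 : ¬ (b = j ∧ a = i) := fun h => h1 ⟨h.2, h.1⟩
        have h4 : ¬ (b = i ∧ a = j) := fun h => h2 ⟨h.2, h.1⟩
        simp [h1, h2, h3, h4]
  lt := incr_lt (incr_lt hM.lt _ _ _) _ _ _

lemma Reduced.pivot {M : Fin N → Fin N → ℕ} (hM : Reduced M) (v : Fin N) :
    Reduced (pivot M v) where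
  symm a b := by simp only [_root_.pivot, hM.symm a b, mul_comm (M v a % 2)]
  lt a b := Nat.mod_lt _ (by norm_num)

lemma phase_zero (z : Fin N → ZMod 2) : phase (fun _ _ => 0) z = 1 := by
  simp [phase, quad]

lemma phase_incr (M : Fin N → Fin N → ℕ) (i j : Fin N) (k : ℕ) (z : Fin N → ZMod 2) :
    phase (incr M i j k) z = phase M z * Complex.I ^ (k * ((z i).val * (z j).val)) := by
  rw [phase, phase, ← pow_add]
  apply I_pow_congr
  have h : quad M z + k * ((z i).val * (z j).val) =
      ∑ a, ∑ b, (M a b + if a = i ∧ b = j then k else 0) * ((z a).val * (z b).val) := by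
    simp only [add_mul, Finset.sum_add_distrib, ite_and, ite_mul, zero_mul]
    simp [quad]
  rw [h, quad, ← ZMod.natCast_eq_natCast_iff]
  push_cast
  refine Finset.sum_congr rfl fun a _ => Finset.sum_congr rfl fun b _ => ?_
  congr 1
  rw [incr]
  split_ifs <;> simp [ZMod.natCast_mod (_ : ℕ) 4, ← Nat.cast_add]

/-- The matrix added is a multiple of rrᵀ with 0/1 entries in r, so its form is that multiple of the
square of the integer ∑ r_j z_j. -/
lemma phase_pivot (M : Fin N → Fin N → ℕ) (v : Fin N) (z : Fin N → ZMod 2) :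
    phase (pivot M v) z = phase M z *
      Complex.I ^ ((3 - 2 * (M v v / 2)) * (∑ j, M v j % 2 * (z j).val) ^ 2) := by
  rw [phase, phase, ← pow_add]
  apply I_pow_congr
  have h : (3 - 2 * (M v v / 2)) * (∑ j, M v j % 2 * (z j).val) ^ 2 = ∑ a, ∑ b,
      (3 - 2 * (M v v / 2)) * (M v a % 2 * (M v b % 2)) * ((z a).val * (z b).val) := by
    rw [pow_two, Finset.sum_mul_sum, Finset.mul_sum]
    refine Finset.sum_congr rfl fun a _ => ?_
    rw [Finset.mul_sum]
    refine Finset.sum_congr rfl fun b _ => ?_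
    ring
  rw [h, quad, quad, ← Finset.sum_add_distrib, ← ZMod.natCast_eq_natCast_iff]
  simp only [← Finset.sum_add_distrib, ← add_mul]
  rw [Nat.cast_sum, Nat.cast_sum]
  refine Finset.sum_congr rfl fun a _ => ?_
  rw [Nat.cast_sum, Nat.cast_sum]
  refine Finset.sum_congr rfl fun b _ => ?_
  simp only [Nat.cast_mul, pivot, ZMod.natCast_mod]

lemma val_add_single {z : Fin N → ZMod 2} {v : Fin N} (hz : z v = 0) (i : Fin N) :
    ((z + Pi.single v 1 : Fin N → ZMod 2) i).val = (z i).val + if i = v then 1 else 0 := by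
  by_cases h : i = v
  · subst h; simp [hz, ZMod.val_one]
  · simp [h]

/-- By symmetry each off-diagonal entry is counted twice. Hence modulo four the variable `v` meets
the others only through the parities of its row. -/
lemma quad_add_single {M : Fin N → Fin N → ℕ} (hM : ∀ i j, M i j = M j i) {z : Fin N → ZMod 2}
    {v : Fin N} (hz : z v = 0) :
    quad M (z + Pi.single v 1) = quad M z + (M v v + 2 * ∑ j, M v j * (z j).val) := by
  simp only [quad, val_add_single hz, add_mul, mul_add, Finset.sum_add_distrib, ite_mul, mul_ite,
    one_mul, mul_one, zero_mul, mul_zero, Finset.sum_ite_eq', Finset.mem_univ, if_true]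
  have h1 : ∑ x, ∑ y, (if x = v then M x y * (z y).val else 0) = ∑ y, M v y * (z y).val := by
    rw [Finset.sum_comm]
    exact Finset.sum_congr rfl fun y _ => by simp
  have h2 : ∑ x, M x v * (z x).val = ∑ y, M v y * (z y).val :=
    Finset.sum_congr rfl fun y _ => by rw [hM]
  simp only [h1, h2]
  ring

lemma phase_add_single {M : Fin N → Fin N → ℕ} (hM : ∀ i j, M i j = M j i) {z : Fin N → ZMod 2}
    {v : Fin N} (hz : z v = 0) : phase M (z + Pi.single v 1) =
      phase M z * Complex.I ^ (M v v + 2 * ∑ j, M v j * (z j).val) := by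
  rw [phase, quad_add_single hM hz, pow_add, phase]

lemma single_add_single (v : Fin N) : (Pi.single v 1 + Pi.single v 1 : Fin N → ZMod 2) = 0 := by
  rw [← Pi.single_add, CharTwo.add_self_eq_zero, Pi.single_zero]

/-- To compare two averages, it is enough to compare the sums over the values of one variable. -/
lemma avg_eq_of_pairs (v : Fin N) (f g : (Fin N → ZMod 2) → ℂ)
    (h : ∀ z, z v = 0 → f z + f (z + Pi.single v 1) = g z + g (z + Pi.single v 1)) :
    avg f = avg g := by
  have h1 : ∀ z, f z + f (z + Pi.single v 1) = g z + g (z + Pi.single v 1) := by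
    intro z
    rcases zmod_two_cases (z v) with hz | hz
    · exact h z hz
    · have h2 := h (z + Pi.single v 1) (by simp [hz, CharTwo.add_self_eq_zero])
      rw [add_assoc, single_add_single, add_zero] at h2
      rw [add_comm, h2, add_comm]
  have h2 : ∀ f : (Fin N → ZMod 2) → ℂ,
      (avg fun z => f z + f (z + Pi.single v 1)) = 2 * avg f := by
    intro f
    have h3 := avg_eq_of_shift (Pi.single v 1) f
    rw [two_mul]
    nth_rewrite 2 [← h3]
    simp only [avg, Finset.sum_add_distrib, mul_add]
  have h3 : 2 * avg f = 2 * avg g := by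
    rw [← h2, ← h2]
    simp only [h1]
  exact mul_left_cancel₀ two_ne_zero h3

/-- Here a is the diagonal entry and l the value of the row on the other variables, so the two
values of z_v contribute 1 and i^{a + 2l}. For odd a their sum is √2 times an eighth root of unity
that depends on l as i^{kl}, with k = 3 for a = 1 and k = 1 for a = 3; the two new terms are both
equal to i^{kl}. For even a the sum vanishes unless l ≡ a/2 modulo two, so where it matters the
added square costs a constant phase: none for a = 0, and i for a = 2, which ω⁶ = -i compensates. -/
lemma pivot_factor (a l : ℕ) (ha : a < 4) :
    1 + Complex.I ^ (a + 2 * (l % 2)) =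
      ((Real.sqrt 2 : ℂ)⁻¹ ^ (a % 2) * omega8 ^ (a + 4 * (a / 2))) *
        (Complex.I ^ ((3 - 2 * (a / 2)) * (l % 2)) +
          Complex.I ^ (a + 2 * (l % 2)) *
            Complex.I ^ ((3 - 2 * (a / 2)) * ((a % 2 + l % 2) % 2))) := by
  have h1 : (Real.sqrt 2 : ℂ)⁻¹ * omega8 = (1 + Complex.I) / 2 := by
    rw [← sqrt_two_mul_omega8, ← sqrt_two_mul_self]
    have := sqrt_two_ne_zero
    field_simp
  have h7 : (Real.sqrt 2 : ℂ)⁻¹ * omega8 ^ 7 = (1 - Complex.I) / 2 := by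
    rw [show 7 = 1 + (4 + 2) from rfl, pow_add, pow_add, omega8_pow_four, omega8_sq, pow_one,
      ← mul_assoc, h1]
    linear_combination (-1 / 2 : ℂ) * Complex.I_sq
  have h6 : omega8 ^ 6 = -Complex.I := by
    rw [show 6 = 4 + 2 from rfl, pow_add, omega8_pow_four, omega8_sq]; ring
  have hI3 : Complex.I ^ 3 = -Complex.I := Complex.I_pow_three
  have hI4 : Complex.I ^ 4 = 1 := Complex.I_pow_four
  have hI5 : Complex.I ^ 5 = Complex.I := by rw [pow_succ, hI4, one_mul]
  have hI2 := Complex.I_sq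
  rcases Nat.mod_two_eq_zero_or_one l with hl | hl <;> rw [hl] <;> interval_cases a <;>
    norm_num [h1, h7, h6, hI3, hI4, hI5] <;>
    first
    | linear_combination (-1 / 2 : ℂ) * hI2
    | ring1
    | linear_combination hI2
    | linear_combination 2 * hI2

/-- The variable is not removed, so the matrix keeps its size and any variable may be used again
later. -/
lemma avg_phase_pivot {M : Fin N → Fin N → ℕ} (hM : Reduced M) (v : Fin N) :
    avg (phase M) = ((Real.sqrt 2 : ℂ)⁻¹ ^ (M v v % 2) * omega8 ^ (M v v + 4 * (M v v / 2))) *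
      avg (phase (pivot M v)) := by
  rw [← avg_const_mul]
  refine avg_eq_of_pairs v _ _ fun z hz => ?_
  rw [phase_pivot, phase_pivot, phase_add_single hM.symm hz]
  set l := ∑ j, M v j * (z j).val with hl
  set b := ∑ j, M v j % 2 * (z j).val with hb
  have hb' : ∑ j, M v j % 2 * ((z + Pi.single v 1 : Fin N → ZMod 2) j).val = M v v % 2 + b := by
    simp only [val_add_single hz, mul_add, Finset.sum_add_distrib, mul_ite, mul_one, mul_zero,
      Finset.sum_ite_eq', Finset.mem_univ, if_true]
    rw [← hb, add_comm]
  have hbl : b % 2 = l % 2 := by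
    rw [hb, hl, Finset.sum_nat_mod, Finset.sum_nat_mod (f := fun j => M v j * (z j).val)]
    simp
  rw [hb']
  have h1 : Complex.I ^ (M v v + 2 * l) = Complex.I ^ (M v v + 2 * (l % 2)) := by
    apply I_pow_congr
    unfold Nat.ModEq
    omega
  -- A square is congruent modulo four to the parity of its root.
  have hsq : ∀ k y : ℕ, Complex.I ^ (k * y ^ 2) = Complex.I ^ (k * (y % 2)) := by
    intro k y
    apply I_pow_congr
    apply Nat.ModEq.mul_left
    rcases Nat.even_or_odd' y with ⟨c, rfl | rfl⟩
    · have : (2 * c) ^ 2 = 4 * c ^ 2 := by ring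
      unfold Nat.ModEq; omega
    · have : (2 * c + 1) ^ 2 = 4 * (c ^ 2 + c) + 1 := by ring
      unfold Nat.ModEq; omega
  have h2 : (M v v % 2 + b) % 2 = (M v v % 2 + l % 2) % 2 := by omega
  rw [h1, hsq, hsq, h2, hbl]
  linear_combination phase M z * pivot_factor (M v v) l (hM.lt v v)

/-- The diagonal entry must be 2, and twice an even row vanishes modulo four, so flipping z_v
changes the sign of the phase. -/
lemma avg_phase_eq_zero {M : Fin N → Fin N → ℕ} (hM : Reduced M) (v : Fin N)
    (hv : ∀ j, M v j % 2 = 0) (hvv : M v v ≠ 0) : avg (phase M) = 0 := by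
  have h1 : ∀ z : Fin N → ZMod 2, z v = 0 → phase M (z + Pi.single v 1) = -1 * phase M z := by
    intro z hz
    rw [phase_add_single hM.symm hz]
    have h2 : (∑ j, M v j * (z j).val) % 2 = 0 := by
      rw [Finset.sum_nat_mod]
      simp [Nat.mul_mod, hv]
    have h3 := hM.lt v v
    have h4 := hv v
    rw [I_pow_congr (b := 2) (by unfold Nat.ModEq; omega), Complex.I_sq, mul_comm]
  refine avg_eq_zero_of_shift (Pi.single v 1) _ (-1) (by norm_num) fun z => ?_
  rcases zmod_two_cases (z v) with hz | hz
  · exact h1 z hz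
  · have h2 := h1 (z + Pi.single v 1) (by simp [hz, CharTwo.add_self_eq_zero])
    rw [add_assoc, single_add_single, add_zero] at h2
    rw [h2]; ring

/-- The entries at (i, j) and (j, i) are equal and even, so they add up to zero modulo four; the
fixed points of the swap lie on the diagonal, which vanishes. -/
lemma avg_phase_eq_one {M : Fin N → Fin N → ℕ} (hM : Reduced M)
    (hev : ∀ i j, M i j % 2 = 0) (hd : ∀ i, M i i = 0) : avg (phase M) = 1 := by
  have h : ∀ z, phase M z = 1 := by
    intro z
    have h0 : ((quad M z : ℕ) : ZMod 4) = 0 := by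
      have h2 : ∀ i j, (M i j : ZMod 4) + M j i = 0 := by
        intro i j
        rw [← hM.symm i j, ← Nat.cast_add, ZMod.natCast_eq_zero_iff]
        have := hev i j
        omega
      simp only [quad, Nat.cast_sum, Nat.cast_mul]
      rw [← Finset.sum_product']
      refine Finset.sum_involution (fun p _ => p.swap) ?_ ?_ ?_ ?_
      · rintro ⟨i, j⟩ _
        simp only [Prod.swap]
        linear_combination (((z i).val : ZMod 4) * ((z j).val : ZMod 4)) * h2 i j
      · rintro ⟨i, j⟩ _ hne heq
        simp only [Prod.swap, Prod.mk.injEq] at heq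
        apply hne
        simp [heq.1, hd]
      · simp
      · simp
    rw [phase, ← pow_zero Complex.I]
    apply I_pow_congr
    rw [← ZMod.natCast_eq_natCast_iff, h0, Nat.cast_zero]
  simp [avg, h]

/-- The coefficient of the added square is 1 or 3, and so is odd. -/
lemma pivot_mod_two {M : Fin N → Fin N → ℕ} (hM : Reduced M) (v i j : Fin N) :
    (pivot M v i j : ZMod 2) = M i j + M v i * M v j := by
  have h0 : ∀ x : ℕ, ((x % 4 : ℕ) : ZMod 2) = x := by
    intro x
    rw [ZMod.natCast_eq_natCast_iff]
    unfold Nat.ModEq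
    omega
  have h1 : ((3 - 2 * (M v v / 2) : ℕ) : ZMod 2) = 1 := by
    have h2 : M v v / 2 = 0 ∨ M v v / 2 = 1 := by have := hM.lt v v; omega
    rcases h2 with h | h <;> rw [h] <;> decide
  rw [pivot, h0, Nat.cast_add, Nat.cast_mul, h1, one_mul, Nat.cast_mul, ZMod.natCast_mod,
    ZMod.natCast_mod]

lemma pivot_row_eq_zero {M : Fin N → Fin N → ℕ} (hM : Reduced M) (v : Fin N) {w : Fin N}
    (hw : ∀ j, (M w j : ZMod 2) = 0) (j : Fin N) : (pivot M v w j : ZMod 2) = 0 := by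
  rw [pivot_mod_two hM, hw, hM.symm v w, hw]; ring

lemma pivot_diag_eq_zero {M : Fin N → Fin N → ℕ} (hM : Reduced M) (v : Fin N) :
    (pivot M v v v : ZMod 2) = 0 := by
  rw [pivot_mod_two hM]
  generalize (M v v : ZMod 2) = a
  revert a; decide

/-- If `M v u` is odd, the step at `u` makes the diagonal entry at `v` odd, and the step at `v` then
clears the whole row modulo two. If `M v u` is even, both steps leave the row unchanged modulo two,
and its entry at `j` is even by hypothesis or because j = u. No test is needed to distinguish the
cases. -/
lemma pivot_pivot_eq_zero {M : Fin N → Fin N → ℕ} (hM : Reduced M) {v : Fin N}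
    (hv : (M v v : ZMod 2) = 0) (u : Fin N) {j : Fin N} (hj : (M v j : ZMod 2) = 0 ∨ j = u) :
    (pivot (pivot M u) v v j : ZMod 2) = 0 := by
  rw [pivot_mod_two (hM.pivot u), pivot_mod_two hM, pivot_mod_two hM, hv, hM.symm u v]
  have key : ∀ a b c : ZMod 2, (a = 0 ∧ b = 0) ∨ a = 1 →
      b + a * c + (0 + a * a) * (b + a * c) = 0 := by decide
  rcases zmod_two_cases (M v u : ZMod 2) with h | h
  · rcases hj with hj | rfl
    · exact key _ _ _ (Or.inl ⟨h, hj⟩)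
    · exact key _ _ _ (Or.inl ⟨h, h⟩)
  · exact key _ _ _ (Or.inr h)

lemma mod_two_eq_zero_iff (a : ℕ) : a % 2 = 0 ↔ (a : ZMod 2) = 0 := by
  rw [ZMod.natCast_eq_zero_iff]; omega

lemma phase_add_single_of_row_eq_zero {M : Fin N → Fin N → ℕ} (hM : Reduced M) {a : Fin N}
    (ha : ∀ j, M a j = 0) (z : Fin N → ZMod 2) : phase M (z + Pi.single a 1) = phase M z := by
  rcases zmod_two_cases (z a) with hz | hz
  · rw [phase_add_single hM.symm hz]; simp [ha]
  · have h2 := phase_add_single hM.symm (z := z + Pi.single a 1) (v := a)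
      (by simp [hz, CharTwo.add_self_eq_zero])
    rw [add_assoc, single_add_single, add_zero] at h2
    rw [h2]; simp [ha]

end quadratic

/-! ### The quadratic form of a circuit -/

section gates

variable {n N : ℕ} {C : Circuit n} {x : Fin n → ZMod 2} {w : Fin n → Fin N}
  {M : Fin N → Fin N → ℕ}

lemma I_pow_three_mul_val (c : ZMod 2) :
    (if c ≠ 0 then -Complex.I else 1) = Complex.I ^ (3 * (c.val * c.val)) := by
  rcases zmod_two_cases c with rfl | rfl <;> simp [ZMod.val_one, Complex.I_pow_three]

lemma avg_phase_rotX (q : Fin n) :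
    avg (fun z => phase M z * xAmp (Real.pi / 4) (.rotX q :: C) (z ∘ w) x) =
      omega8 * avg fun z =>
        phase (incr M (w q) (w q) 3) z * xAmp (Real.pi / 4) C (z ∘ w) x := by
  rw [← avg_const_mul]
  congr 1
  ext z
  rw [xAmp_rotX, exp_sgn, phase_incr, Function.comp_apply, I_pow_three_mul_val]
  ring

/-- The parity of c + d is the integer square (c + d)² modulo four, and -i = i³; expanding the
square gives the four increments. -/
lemma avg_phase_rotXX (q r : Fin n) (h : q ≠ r) :
    avg (fun z => phase M z * xAmp (Real.pi / 4) (.rotXX q r h :: C) (z ∘ w) x) =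
      omega8 * avg fun z =>
        phase (incr (incr (incr (incr M (w q) (w q) 3) (w q) (w r) 3) (w r) (w q) 3)
          (w r) (w r) 3) z * xAmp (Real.pi / 4) C (z ∘ w) x := by
  rw [← avg_const_mul]
  congr 1
  ext z
  have key : ∀ c d : ZMod 2, (if c + d ≠ 0 then -Complex.I else 1) =
      Complex.I ^ (3 * (c.val * c.val)) * Complex.I ^ (3 * (c.val * d.val)) *
        Complex.I ^ (3 * (d.val * c.val)) * Complex.I ^ (3 * (d.val * d.val)) := by
    have hI : Complex.I ^ 3 = -Complex.I := Complex.I_pow_three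
    have h11 : (1 + 1 : ZMod 2) = 0 := by decide
    intro c d
    rcases zmod_two_cases c with rfl | rfl <;> rcases zmod_two_cases d with rfl | rfl <;>
      simp [ZMod.val_one, hI, h11]
  simp only [xAmp_rotXX, exp_sgn, phase_incr, Function.comp_apply, key]
  ring

lemma avg_phase_had (hM : Reduced M) (q : Fin n) {a : Fin N} (ha : ∀ j, M a j = 0)
    (hw : ∀ j, w j ≠ a) :
    avg (fun z => phase M z * xAmp (Real.pi / 4) (.had q :: C) (z ∘ w) x) =
      Real.sqrt 2 * avg fun z =>
        phase (incr (incr M (w q) a 1) a (w q) 1) z *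
          xAmp (Real.pi / 4) C (z ∘ Function.update w q a) x := by
  rw [avg_xAmp_had C x q w a _ (phase_add_single_of_row_eq_zero hM ha) hw]
  congr 2
  ext z
  have key : ∀ c d : ZMod 2, sgn (c * d) =
      Complex.I ^ (1 * (c.val * d.val)) * Complex.I ^ (1 * (d.val * c.val)) := by
    intro c d
    rcases zmod_two_cases c with rfl | rfl <;> rcases zmod_two_cases d with rfl | rfl <;>
      simp [ZMod.val_one]
  simp only [phase_incr, key]
  ring

/-- The sign (-1)^{x·z} left by the output string is absorbed into the diagonal bit by bit, from the
last qubit down, the direction in which the loops of the machine run. -/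
lemma avg_phase_flip (k : ℕ) (hk : k < n) :
    avg (fun z => phase M z *
        ∏ q ∈ Finset.univ.filter (fun q : Fin n => q.val < k + 1), sgn (x q * z (w q))) =
      avg fun z => phase (incr M (w ⟨k, hk⟩) (w ⟨k, hk⟩) (2 * (x ⟨k, hk⟩).val)) z *
        ∏ q ∈ Finset.univ.filter (fun q : Fin n => q.val < k), sgn (x q * z (w q)) := by
  congr 1
  ext z
  have h1 : Finset.univ.filter (fun q : Fin n => q.val < k + 1) =
      insert ⟨k, hk⟩ (Finset.univ.filter fun q : Fin n => q.val < k) := by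
    ext q
    simp only [Finset.mem_filter, Finset.mem_univ, true_and, Finset.mem_insert, Fin.ext_iff]
    omega
  have key : ∀ c d : ZMod 2, sgn (c * d) = Complex.I ^ (2 * c.val * (d.val * d.val)) := by
    intro c d
    rcases zmod_two_cases c with rfl | rfl <;> rcases zmod_two_cases d with rfl | rfl <;>
      simp [ZMod.val_one]
  rw [h1, Finset.prod_insert (by simp), phase_incr, key]
  ring

end gates

/-! ### Total correctness of programs of the random access machine -/

section programs

open RAM

/-- Started with the registers `f` and the memory `m`, the program `p` halts after at most `T`
steps, and its final registers and memory satisfy `Q`. -/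
def Wp (T : ℕ) (p : RAM) (f m : ℕ → ℕ) (Q : (ℕ → ℕ) → (ℕ → ℕ) → Prop) : Prop :=
  ∃ t s, RAM.Exec p ⟨f, m⟩ t s ∧ t ≤ T ∧ Q s.reg s.mem

/-- The programs of a list one after the other. -/
def block : List RAM → RAM
  | [] => .const 39 0
  | p :: l => .seq p (block l)

/-- The loop with the body `l` in which the register `r` runs downwards to zero. -/
def forDown (r : ℕ) (l : List RAM) : RAM := .loop r (block (.sub r r 3 :: l))

variable {T T₁ T₂ : ℕ} {p q : RAM} {l : List RAM} {f m : ℕ → ℕ}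
  {Q R : (ℕ → ℕ) → (ℕ → ℕ) → Prop} {i j k c : ℕ}

lemma Wp.mono (h : Wp T₁ p f m R) (hT : T₁ ≤ T) (hQ : ∀ f m, R f m → Q f m) : Wp T p f m Q := by
  obtain ⟨t, s, he, ht, hR⟩ := h
  exact ⟨t, s, he, ht.trans hT, hQ _ _ hR⟩

/-- The empty block still has to be an instruction; register 39 is written for this purpose only and
never read. -/
lemma Wp.nil (h : Q (Function.update f 39 0) m) : Wp (T + 1) (block []) f m Q :=
  ⟨1, _, Exec.const 39 0 _, by omega, h⟩

lemma Wp.cons (h : Wp T₁ p f m R) (h' : ∀ f m, R f m → Wp T₂ (block l) f m Q) (hT : T₁ + T₂ ≤ T) :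
    Wp T (block (p :: l)) f m Q := by
  obtain ⟨t, s, he, ht, hR⟩ := h
  obtain ⟨t', s', he', ht', hQ⟩ := h' _ _ hR
  exact ⟨t + t', s', Exec.seq he he', by omega, hQ⟩

/-- This rule and the next ones peel one instruction off a block at the price of one step, so that
applying them in turn executes a program symbolically. -/
lemma Wp.const (h : Wp T (block l) (Function.update f i c) m Q) :
    Wp (T + 1) (block (.const i c :: l)) f m Q :=
  Wp.cons (T₁ := 1) (R := fun f' m' => f' = Function.update f i c ∧ m' = m)
    ⟨1, _, Exec.const i c _, le_rfl, rfl, rfl⟩ (fun _ _ hR => by rw [hR.1, hR.2]; exact h)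
    (by omega)

lemma Wp.add (h : Wp T (block l) (Function.update f i (f j + f k)) m Q) :
    Wp (T + 1) (block (.add i j k :: l)) f m Q :=
  Wp.cons (T₁ := 1) (R := fun f' m' => f' = Function.update f i (f j + f k) ∧ m' = m)
    ⟨1, _, Exec.add i j k _, le_rfl, rfl, rfl⟩ (fun _ _ hR => by rw [hR.1, hR.2]; exact h)
    (by omega)

lemma Wp.sub (h : Wp T (block l) (Function.update f i (f j - f k)) m Q) :
    Wp (T + 1) (block (.sub i j k :: l)) f m Q :=
  Wp.cons (T₁ := 1) (R := fun f' m' => f' = Function.update f i (f j - f k) ∧ m' = m)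
    ⟨1, _, Exec.sub i j k _, le_rfl, rfl, rfl⟩ (fun _ _ hR => by rw [hR.1, hR.2]; exact h)
    (by omega)

lemma Wp.load (h : Wp T (block l) (Function.update f i (m (f j))) m Q) :
    Wp (T + 1) (block (.load i j :: l)) f m Q :=
  Wp.cons (T₁ := 1) (R := fun f' m' => f' = Function.update f i (m (f j)) ∧ m' = m)
    ⟨1, _, Exec.load i j _, le_rfl, rfl, rfl⟩ (fun _ _ hR => by rw [hR.1, hR.2]; exact h)
    (by omega)

lemma Wp.store (h : Wp T (block l) f (Function.update m (f i) (f j)) Q) :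
    Wp (T + 1) (block (.store i j :: l)) f m Q :=
  Wp.cons (T₁ := 1) (R := fun f' m' => f' = f ∧ m' = Function.update m (f i) (f j))
    ⟨1, _, Exec.store i j _, le_rfl, rfl, rfl⟩ (fun _ _ hR => by rw [hR.1, hR.2]; exact h)
    (by omega)

lemma Wp.ite (h₁ : f i ≠ 0 → Wp T p f m Q) (h₂ : f i = 0 → Wp T q f m Q) :
    Wp (T + 1) (.ite i p q) f m Q := by
  by_cases h : f i = 0
  · obtain ⟨t, s, he, ht, hQ⟩ := h₂ h
    exact ⟨t + 1, s, Exec.ite_zero h he, by omega, hQ⟩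
  · obtain ⟨t, s, he, ht, hQ⟩ := h₁ h
    exact ⟨t + 1, s, Exec.ite_pos h he, by omega, hQ⟩

lemma Wp.ite_pos (h : f i ≠ 0) (hp : Wp T p f m Q) : Wp (T + 1) (.ite i p q) f m Q :=
  Wp.ite (fun _ => hp) fun h' => absurd h' h

lemma Wp.ite_zero (h : f i = 0) (hq : Wp T q f m Q) : Wp (T + 1) (.ite i p q) f m Q :=
  Wp.ite (fun h' => absurd h h') fun _ => hq

/-- The invariant is indexed by the number of passes left. The counter is lowered before the body,
which can thus use it as a zero-based index. The test and the decrement account for the 2 in each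
pass, the last test for the final 1. -/
lemma Wp.forDown {r : ℕ} (Inv : ℕ → (ℕ → ℕ) → (ℕ → ℕ) → Prop)
    (hr : ∀ k f m, Inv k f m → f r = k ∧ f 3 = 1)
    (hstep : ∀ k f m, Inv (k + 1) f m → Wp T (block l) (Function.update f r k) m (Inv k)) :
    ∀ k f m, Inv k f m → Wp (k * (T + 2) + 1) (forDown r l) f m (Inv 0) := by
  intro k
  induction k with
  | zero =>
    intro f m h
    exact ⟨1, _, Exec.loop_zero (hr _ _ _ h).1, by omega, h⟩
  | succ k ih =>
    intro f m h
    obtain ⟨h1, h2⟩ := hr _ _ _ h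
    have h3 : Wp (T + 1) (block (.sub r r 3 :: l)) f m (Inv k) := by
      apply Wp.sub
      rw [h1, h2]
      exact hstep k f m h
    obtain ⟨t, s, he, ht, hI⟩ := h3
    obtain ⟨t', s', he', ht', hI'⟩ := ih _ _ hI
    refine ⟨t + t' + 1, s', Exec.loop_pos (by simp [h1]) he he', ?_, hI'⟩
    rw [add_mul]
    omega

/-- The registers below `K` are the same. -/
def Frame (K : ℕ) (f f' : ℕ → ℕ) : Prop := ∀ r < K, f' r = f r

lemma Frame.refl {K : ℕ} (f : ℕ → ℕ) : Frame K f f := fun _ _ => rfl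

lemma Frame.update {K : ℕ} {f f' : ℕ → ℕ} {v : ℕ} (h : Frame K f f') (hi : K ≤ i) :
    Frame K f (Function.update f' i v) := fun r hr => by
  rw [Function.update_of_ne (by omega), h r hr]

lemma Frame.trans {K : ℕ} {f f' f'' : ℕ → ℕ} (h : Frame K f f') (h' : Frame K f' f'') :
    Frame K f f'' := fun r hr => (h' r hr).trans (h r hr)

lemma Frame.mono {K K' : ℕ} {f f' : ℕ → ℕ} (h : Frame K f f') (hK : K' ≤ K) : Frame K' f f' :=
  fun r hr => h r (hr.trans_le hK)

/-- The registers that hold the parameters of the memory layout. -/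
structure Env (n N D : ℕ) (f : ℕ → ℕ) : Prop where
  one : f 3 = 1
  qubits : f 4 = n
  size : f 5 = N
  carriers : f 6 = D
  buffer : f 7 = D + N
  matrix : f 8 = D + 2 * N
  zero : f 9 = 0

lemma Env.congr {n N D : ℕ} {f f' : ℕ → ℕ} (h : Env n N D f)
    (hf : ∀ r, 3 ≤ r → r ≤ 9 → f' r = f r) : Env n N D f' where
  one := by rw [hf _ (by omega) (by omega), h.one]
  qubits := by rw [hf _ (by omega) (by omega), h.qubits]
  size := by rw [hf _ (by omega) (by omega), h.size]
  carriers := by rw [hf _ (by omega) (by omega), h.carriers]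
  buffer := by rw [hf _ (by omega) (by omega), h.buffer]
  matrix := by rw [hf _ (by omega) (by omega), h.matrix]
  zero := by rw [hf _ (by omega) (by omega), h.zero]

lemma Env.of_frame {n N D K : ℕ} {f f' : ℕ → ℕ} (h : Env n N D f) (hf : Frame K f f')
    (hK : 10 ≤ K := by norm_num) : Env n N D f' :=
  h.congr fun r _ hr => hf r (by omega)

lemma Env.update {n N D : ℕ} {f : ℕ → ℕ} {v : ℕ} (h : Env n N D f)
    (hi : ¬ (3 ≤ i ∧ i ≤ 9) := by norm_num) : Env n N D (Function.update f i v) :=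
  h.congr fun r _ hr => Function.update_of_ne (by omega) _ _

/-- The memory consists of the input (in the first `D` cells), the carriers of the qubits, a buffer
and a square matrix. -/
structure MemRep (inp : ℕ → ℕ) {n N : ℕ} (D : ℕ) (w : Fin n → Fin N) (b : Fin N → ℕ)
    (M : Fin N → Fin N → ℕ) (m : ℕ → ℕ) : Prop where
  input : ∀ a < D, m a = inp a
  carrier : ∀ q : Fin n, m (D + q) = w q
  buffer : ∀ j : Fin N, m (D + N + j) = b j
  matrix : ∀ i j : Fin N, m (D + 2 * N + j + i * N) = M i j

/-! ### Effect of single writes on the memory layout -/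

section rep

variable {inp : ℕ → ℕ} {n N D : ℕ} {w : Fin n → Fin N} {b : Fin N → ℕ} {M : Fin N → Fin N → ℕ}

lemma MemRep.incr (h : MemRep inp D w b M m) (hn : n ≤ N) (i j : Fin N) (k : ℕ) :
    MemRep inp D w b (incr M i j k)
      (Function.update m (D + 2 * N + j + i * N) ((M i j + k) % 4)) where
  input a ha := by rw [Function.update_of_ne (by omega), h.input a ha]
  carrier q := by rw [Function.update_of_ne (by omega), h.carrier q]
  buffer q := by rw [Function.update_of_ne (by omega), h.buffer q]
  matrix a c := by
    rw [_root_.incr]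
    split_ifs with hac
    · obtain ⟨rfl, rfl⟩ := hac
      rw [Function.update_self]
    · rw [Function.update_of_ne, h.matrix]
      intro heq
      -- Equal addresses would give equal quotients and remainders on division by `N`, hence equal
      -- index pairs.
      have h1 : (c : ℕ) + N * a = j + N * i := by rw [mul_comm N, mul_comm N]; omega
      have hN : 0 < N := c.pos
      have h2 : (a : ℕ) = i := by
        have := congrArg (· / N) h1
        simpa [Nat.add_mul_div_left _ _ hN, Nat.div_eq_of_lt c.isLt, Nat.div_eq_of_lt j.isLt]
          using this
      rw [h2] at h1
      exact hac ⟨Fin.ext h2, Fin.ext (by omega)⟩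

lemma MemRep.set_buffer (h : MemRep inp D w b M m) (hn : n ≤ N) (j : Fin N) (v : ℕ) :
    MemRep inp D w (Function.update b j v) M (Function.update m (D + N + j) v) where
  input a ha := by rw [Function.update_of_ne (by omega), h.input a ha]
  carrier q := by rw [Function.update_of_ne (by omega), h.carrier q]
  buffer q := by
    by_cases hq : q = j
    · subst hq; simp
    · have : (q : ℕ) ≠ j := fun h => hq (Fin.ext h)
      rw [Function.update_of_ne (by omega), Function.update_of_ne hq, h.buffer q]
  matrix a c := by rw [Function.update_of_ne (by omega), h.matrix]

lemma MemRep.set_carrier (h : MemRep inp D w b M m) (hn : n ≤ N) (q : Fin n) (a : Fin N) :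
    MemRep inp D (Function.update w q a) b M (Function.update m (D + q) a) where
  input a ha := by rw [Function.update_of_ne (by omega), h.input a ha]
  carrier r := by
    by_cases hq : r = q
    · subst hq; simp
    · have : (r : ℕ) ≠ q := fun h => hq (Fin.ext h)
      rw [Function.update_of_ne (by omega), Function.update_of_ne hq, h.carrier r]
  buffer q := by rw [Function.update_of_ne (by omega), h.buffer q]
  matrix a c := by rw [Function.update_of_ne (by omega), h.matrix]

end rep

/-- Register 33 becomes the address of the matrix entry whose indices are in registers 30, 31. -/
def addrProg : RAM := block [.add 33 8 31, .add 34 30 9, forDown 34 [.add 33 33 5]]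

/-- Adds register 32 modulo four to the matrix entry whose indices are in registers 30, 31. -/
def incrProg : RAM := block [addrProg, .load 35 33, .add 35 35 32, .const 36 4, .sub 36 36 35,
  .sub 36 3 36, .add 36 36 36, .add 36 36 36, .sub 35 35 36, .store 33 35]

/-- Reduces register 2, which is less than 16, modulo eight. -/
def modEightProg : RAM := block [.const 34 8, .sub 34 34 2, .sub 34 3 34, .add 34 34 34,
  .add 34 34 34, .add 34 34 34, .sub 2 2 34]

/-! ### Addressing and modular arithmetic on the machine -/

section lowlevel

variable {inp : ℕ → ℕ} {n N D : ℕ} {w : Fin n → Fin N} {b : Fin N → ℕ} {M : Fin N → Fin N → ℕ}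

/-- The product i · N is formed by adding `N` repeatedly; register 33 plus `N` times the counter
stays constant. -/
lemma wp_addrProg (hf : Env n N D f) (i j : Fin N) (hi : f 30 = i) (hj : f 31 = j) :
    Wp (4 * N + 4) addrProg f m fun f' m' =>
      m' = m ∧ f' 33 = D + 2 * N + j + i * N ∧ Frame 33 f f' := by
  apply Wp.add
  apply Wp.add
  have key := Wp.forDown (T := 2) (r := 34) (l := [.add 33 33 5])
    (fun k f' m' => m' = m ∧ f' 34 = k ∧ f' 33 + k * N = D + 2 * N + j + i * N ∧ Frame 33 f f')
    (by
      rintro k f' m' ⟨_, h34, _, h⟩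
      exact ⟨h34, by rw [h _ (by norm_num), hf.one]⟩)
    (by
      rintro k f' m' ⟨hm, h34, h33, h⟩
      apply Wp.add
      apply Wp.nil
      refine ⟨hm, by simp, ?_, ?_⟩
      · have h5 : f' 5 = N := by rw [h _ (by norm_num), hf.size]
        simp [h5]
        linarith
      · exact ((h.update (by norm_num)).update (by norm_num)).update (by norm_num))
  refine Wp.cons (key i _ _ ?_) (T₂ := 1) ?_ ?_
  · refine ⟨rfl, ?_, ?_, ?_⟩
    · simp [hi, hf.zero]
    · simp [hj, hf.matrix]
    · exact ((Frame.refl f).update (by norm_num)).update (by norm_num)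
  · rintro f' m' ⟨hm, -, h33, h⟩
    apply Wp.nil
    exact ⟨hm, by simpa using h33, h.update (by norm_num)⟩
  · have := i.isLt
    omega

/-- The sum s is below 8, as the entry is below 4 and k ≤ 4. With truncated subtraction, 1 - (4 - s)
is 1 exactly if s ≥ 4; two doublings give the multiple of four to be subtracted. -/
lemma wp_incrProg (hf : Env n N D f) (hm : MemRep inp D w b M m) (hn : n ≤ N) (hM : ∀ i j, M i j < 4)
    (i j : Fin N) (k : ℕ) (hi : f 30 = i) (hj : f 31 = j) (hk : f 32 = k) (hk4 : k ≤ 4) :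
    Wp (4 * N + 14) incrProg f m fun f' m' =>
      MemRep inp D w b (incr M i j k) m' ∧ Frame 33 f f' := by
  refine Wp.cons (wp_addrProg hf i j hi hj) (T₂ := 10) ?_ (by omega)
  rintro f' m' ⟨rfl, h33, h⟩
  apply Wp.load
  apply Wp.add
  apply Wp.const
  apply Wp.sub
  apply Wp.sub
  apply Wp.add
  apply Wp.add
  apply Wp.sub
  apply Wp.store
  apply Wp.nil
  have h3 : f' 3 = 1 := by rw [h _ (by norm_num), hf.one]
  have h32 : f' 32 = k := by rw [h _ (by norm_num), hk]
  constructor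
  · have hr := hm.incr hn i j k
    simp only [Function.update_apply, h33, hm.matrix, h3, h32]
    norm_num
    convert hr using 2
    have := hM i j
    omega
  · repeat' first | exact h | refine Frame.update ?_ (by norm_num)

lemma wp_modEightProg (h3 : f 3 = 1) (h2 : f 2 < 16) :
    Wp 8 modEightProg f m fun f' m' => m' = m ∧ f' 2 = f 2 % 8 ∧ ∀ r < 33, r ≠ 2 → f' r = f r := by
  apply Wp.const
  apply Wp.sub
  apply Wp.sub
  apply Wp.add
  apply Wp.add
  apply Wp.add
  apply Wp.sub
  apply Wp.nil
  refine ⟨rfl, ?_, ?_⟩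
  · simp [h3]
    omega
  · intro r hr hr2
    simp [hr2, show r ≠ 39 by omega, show r ≠ 34 by omega]

end lowlevel

end programs

/-! ### The program of an elimination step -/

section pivotProgram

open RAM

/-- The scalar part of the elimination step at the variable in register 20: the phase in register 2
and the exponent in register 10 are updated, and register 23 becomes the coefficient. -/
def scalarProg : RAM := block [.add 30 20 9, .add 31 20 9, addrProg, .load 21 33, .const 22 2,
  .sub 22 22 21, .sub 22 3 22, .const 23 3, .sub 23 23 22, .sub 23 23 22, .sub 24 21 22,
  .sub 24 24 22, .add 10 10 24, .add 2 2 21, .add 22 22 22, .add 22 22 22, .add 2 2 22,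
  modEightProg]

/-- Copies the parities of the row in register 20 to the buffer. -/
def copyProg : RAM := block [.add 24 5 9, forDown 24 [.add 30 20 9, .add 31 24 9, addrProg,
  .load 25 33, .const 26 2, .sub 26 26 25, .sub 26 3 26, .sub 25 25 26, .sub 25 25 26,
  .add 26 7 24, .store 26 25]]

/-- The body of the inner loop of `rankOneProg`. -/
def rankOneBody : List RAM := [.add 26 7 25, .load 28 26, .ite 28
  (block [.add 30 24 9, .add 31 25 9, .add 32 23 9, incrProg]) (block [])]

/-- The body of the outer loop of `rankOneProg`. -/
def rankOneRow : List RAM := [.add 26 7 24, .load 27 26, .ite 27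
  (block [.add 25 5 9, forDown 25 rankOneBody]) (block [])]

/-- Adds to the matrix the product of register 23, the buffer as a column and the buffer as a
row. -/
def rankOneProg : RAM := block [.add 24 5 9, forDown 24 rankOneRow]

/-- The elimination step at the variable in register 20. -/
def pivotProg : RAM := block [scalarProg, copyProg, rankOneProg]

variable {f m : ℕ → ℕ} {inp : ℕ → ℕ} {n N D : ℕ} {w : Fin n → Fin N} {b : Fin N → ℕ}
  {M : Fin N → Fin N → ℕ}

/-- For a diagonal entry a < 4, the truncated expression 1 - (2 - a) is a/2, and 3 - 2(a/2), a mod 2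
and 4(a/2) follow from it by additions and subtractions. The phase stays below 16 before its
reduction. -/
lemma wp_scalarProg (hf : Env n N D f) (hm : MemRep inp D w b M m) (hM : ∀ i j, M i j < 4)
    (v : Fin N) (hv : f 20 = v) (hc : f 2 < 8) :
    Wp (4 * N + 29) scalarProg f m fun f' m' => m' = m ∧ f' 23 = 3 - 2 * (M v v / 2) ∧
      f' 2 = (f 2 + (M v v + 4 * (M v v / 2))) % 8 ∧ f' 10 = f 10 + M v v % 2 ∧
      ∀ r < 21, r ≠ 2 → r ≠ 10 → f' r = f r := by
  apply Wp.add
  apply Wp.add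
  refine Wp.cons (wp_addrProg ((hf.update).update) v v ?_ ?_) (T₂ := 23) ?_ (by omega)
  · simp [hf.zero, hv]
  · simp [hf.zero, hv]
  rintro f' m' ⟨rfl, h33, h⟩
  replace h : ∀ r < 21, f' r = f r := fun r hr => by
    rw [h r (by omega)]
    simp [show r ≠ 30 by omega, show r ≠ 31 by omega]
  have h3 : f' 3 = 1 := by rw [h _ (by norm_num), hf.one]
  have h2 := h 2 (by norm_num)
  have h10 := h 10 (by norm_num)
  have ha := hM v v
  apply Wp.load
  apply Wp.const
  apply Wp.sub
  apply Wp.sub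
  apply Wp.const
  apply Wp.sub
  apply Wp.sub
  apply Wp.sub
  apply Wp.sub
  apply Wp.add
  apply Wp.add
  apply Wp.add
  apply Wp.add
  apply Wp.add
  refine Wp.cons (wp_modEightProg ?_ ?_) (T₂ := 1) ?_ (by omega)
  · simp [h3]
  · simp [h33, hm.matrix, h3, h2]
    omega
  rintro g m'' ⟨rfl, hg2, hg⟩
  apply Wp.nil
  simp only [Function.update_apply, h33, hm.matrix, h3, h2] at hg2
  norm_num at hg2
  refine ⟨rfl, ?_, ?_, ?_, ?_⟩
  · rw [Function.update_of_ne (by norm_num), hg _ (by norm_num) (by norm_num)]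
    simp [h33, hm.matrix, h3]
    omega
  · rw [Function.update_of_ne (by norm_num), hg2]
    congr 1
    omega
  · rw [Function.update_of_ne (by norm_num), hg _ (by norm_num) (by norm_num)]
    simp [h33, hm.matrix, h3, h10]
    omega
  · intro r hr hr2 hr10
    rw [Function.update_of_ne (by omega), hg _ (by omega) hr2]
    simp [hr2, hr10, show r ≠ 21 by omega, show r ≠ 22 by omega, show r ≠ 23 by omega,
      show r ≠ 24 by omega, h r hr]

/-- The row of the pivot may itself change while the matrix is updated in place, so its parities are
saved first. -/
lemma wp_copyProg (hf : Env n N D f) (hm : MemRep inp D w b M m) (hn : n ≤ N)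
    (hM : ∀ i j, M i j < 4) (v : Fin N) (hv : f 20 = v) :
    Wp (N * (4 * N + 17) + 3) copyProg f m fun f' m' =>
      MemRep inp D w (fun j => M v j % 2) M m' ∧ Frame 24 f f' := by
  apply Wp.add
  refine Wp.cons (Wp.forDown (T := 4 * N + 15) (fun k f' m' => k ≤ N ∧ f' 24 = k ∧ Frame 24 f f' ∧
    MemRep inp D w (fun j : Fin N => if k ≤ j then M v j % 2 else b j) M m') ?_ ?_ N _ _ ?_)
    (T₂ := 1) ?_ (by apply le_of_eq; ring)
  · rintro k f' m' ⟨_, h24, h, _⟩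
    exact ⟨h24, by rw [h _ (by norm_num), hf.one]⟩
  · rintro k f' m' ⟨hk, h24, h, hm'⟩
    have hf' : Env n N D f' := hf.of_frame h
    apply Wp.add
    apply Wp.add
    refine Wp.cons (wp_addrProg (((hf'.update).update).update) v ⟨k, hk⟩ ?_ ?_) (T₂ := 9) ?_
      (by omega)
    · simp [hf'.zero, h 20 (by norm_num), hv]
    · simp [hf'.zero]
    rintro g m'' ⟨rfl, h33, hg⟩
    apply Wp.load
    apply Wp.const
    apply Wp.sub
    apply Wp.sub
    apply Wp.sub
    apply Wp.sub
    apply Wp.add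
    apply Wp.store
    apply Wp.nil
    have h3 : g 3 = 1 := by rw [hg _ (by norm_num)]; simp [hf'.one]
    have h7 : g 7 = D + N := by rw [hg _ (by norm_num)]; simp [hf'.buffer]
    have hg24 : g 24 = k := by rw [hg _ (by norm_num)]; simp
    refine ⟨by omega, by simp [hg24], ?_, ?_⟩
    · have h1 : Frame 24 f g := h.trans fun r hr => by
        rw [hg _ (by omega)]
        simp [show r ≠ 30 by omega, show r ≠ 31 by omega, show r ≠ 24 by omega]
      repeat' first | exact h1 | refine Frame.update ?_ (by norm_num)
    · have hr := hm'.set_buffer hn ⟨k, hk⟩ (M v ⟨k, hk⟩ % 2)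
      have hmk : m'' (D + 2 * N + k + v * N) = M v ⟨k, hk⟩ := hm'.matrix v ⟨k, hk⟩
      simp only [Function.update_apply, h33, hmk, h3, h7, hg24]
      norm_num
      have hb : (fun j : Fin N => if k ≤ j then M v j % 2 else b j) =
          Function.update (fun j : Fin N => if k + 1 ≤ j then M v j % 2 else b j) ⟨k, hk⟩
            (M v ⟨k, hk⟩ % 2) := by
        ext j
        by_cases hj : j = ⟨k, hk⟩
        · subst hj; simp
        · have hj' : (j : ℕ) ≠ k := fun h => hj (Fin.ext h)
          rw [Function.update_of_ne hj]
          have : k ≤ (j : ℕ) ↔ k + 1 ≤ (j : ℕ) := by omega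
          simp only [this]
      rw [hb]
      convert hr using 2
      have := hM v ⟨k, hk⟩
      omega
  · refine ⟨le_rfl, by simp [hf.zero, hf.size], (Frame.refl f).update (by norm_num), ?_⟩
    convert hm using 2 with j
    simp
  · rintro f' m' ⟨-, -, h, hm'⟩
    apply Wp.nil
    exact ⟨by simpa using hm', h.update (by norm_num)⟩

/-- The matrix during the computation of a rank one update: the first `i` rows are not changed yet,
and neither are the first `j` entries of the next row. -/
def partialUpdate (M P : Fin N → Fin N → ℕ) (i j : ℕ) : Fin N → Fin N → ℕ :=
  fun a c => if i < a ∨ ((a : ℕ) = i ∧ j ≤ c) then P a c else M a c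

lemma partialUpdate_row (M P : Fin N → Fin N → ℕ) (i : ℕ) :
    partialUpdate M P (i + 1) 0 = partialUpdate M P i N := by
  ext a c
  have h1 : (i + 1 < (a : ℕ) ∨ (a : ℕ) = i + 1 ∧ 0 ≤ (c : ℕ)) ↔
      (i < (a : ℕ) ∨ (a : ℕ) = i ∧ N ≤ (c : ℕ)) := by
    have := c.isLt
    omega
  simp only [partialUpdate, h1]

lemma partialUpdate_of_eq {M P : Fin N → Fin N → ℕ} (i j : Fin N) (h : P i j = M i j) :
    partialUpdate M P i j = partialUpdate M P i (j + 1) := by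
  ext a c
  by_cases hac : a = i ∧ c = j
  · obtain ⟨rfl, rfl⟩ := hac
    simp [partialUpdate, h]
  · rw [Fin.ext_iff, Fin.ext_iff] at hac
    have h1 : ((i : ℕ) < (a : ℕ) ∨ (a : ℕ) = i ∧ (j : ℕ) ≤ (c : ℕ)) ↔
        ((i : ℕ) < (a : ℕ) ∨ (a : ℕ) = i ∧ (j : ℕ) + 1 ≤ (c : ℕ)) := by
      omega
    simp only [partialUpdate, h1]

lemma partialUpdate_incr {M P : Fin N → Fin N → ℕ} (i j : Fin N) (k : ℕ)
    (h : P i j = (M i j + k) % 4) :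
    partialUpdate M P i j = incr (partialUpdate M P i (j + 1)) i j k := by
  ext a c
  by_cases hac : a = i ∧ c = j
  · obtain ⟨rfl, rfl⟩ := hac
    simp [partialUpdate, h, incr]
  · rw [incr, if_neg hac]
    rw [Fin.ext_iff, Fin.ext_iff] at hac
    have h1 : ((i : ℕ) < (a : ℕ) ∨ (a : ℕ) = i ∧ (j : ℕ) ≤ (c : ℕ)) ↔
        ((i : ℕ) < (a : ℕ) ∨ (a : ℕ) = i ∧ (j : ℕ) + 1 ≤ (c : ℕ)) := by
      omega
    simp only [partialUpdate, h1]

lemma partialUpdate_lt {M P : Fin N → Fin N → ℕ} (hM : ∀ i j, M i j < 4) (hP : ∀ i j, P i j < 4)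
    (i j : ℕ) (a c : Fin N) : partialUpdate M P i j a c < 4 := by
  rw [partialUpdate]
  split_ifs
  exacts [hP a c, hM a c]

/-- The buffer holds bits, so the product of two of them is a condition: the coefficient is added
where both are 1, and rows and columns with bit 0 are skipped. -/
lemma wp_rankOneRow {P : Fin N → Fin N → ℕ} {k : ℕ} (hk : k ≤ 4) (hn : n ≤ N)
    (hM : ∀ i j, M i j < 4) (hb : ∀ j, b j < 2)
    (hP : ∀ i j, P i j = (M i j + k * (b i * b j)) % 4)
    (i : Fin N) (hf : Env n N D f) (h23 : f 23 = k) (h24 : f 24 = i)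
    (hm : MemRep inp D w b (partialUpdate M P (i + 1) 0) m) :
    Wp (N * (4 * N + 24) + 7) (block rankOneRow) f m fun f' m' =>
      MemRep inp D w b (partialUpdate M P i 0) m' ∧ Frame 25 f f' := by
  have hPlt : ∀ i j, P i j < 4 := fun i j => by rw [hP]; exact Nat.mod_lt _ (by norm_num)
  apply Wp.add
  apply Wp.load
  have h27 : m (f 7 + f 24) = b i := by rw [hf.buffer, h24, hm.buffer]
  rw [partialUpdate_row] at hm
  refine Wp.cons (T₁ := N * (4 * N + 24) + 4) (Wp.ite ?_ ?_) (T₂ := 1)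
    (R := fun f' m' => MemRep inp D w b (partialUpdate M P i 0) m' ∧ Frame 25 f f') ?_ (by omega)
  · intro hbi
    replace hbi : b i = 1 := by
      simp [h27] at hbi
      have := hb i
      omega
    apply Wp.add
    refine Wp.cons (Wp.forDown (T := 4 * N + 22) (fun j f' m' => j ≤ N ∧ f' 25 = j ∧
      Frame 25 f f' ∧ MemRep inp D w b (partialUpdate M P i j) m') ?_ ?_ N _ _ ?_)
      (T₂ := 1) ?_ (by apply le_of_eq; ring)
    · rintro j f' m' ⟨_, h25, h, _⟩
      exact ⟨h25, by rw [h _ (by norm_num), hf.one]⟩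
    · rintro j f' m' ⟨hj, h25, h, hm'⟩
      have hf' : Env n N D f' := hf.of_frame h
      apply Wp.add
      apply Wp.load
      have h28 : m' (f' 7 + j) = b ⟨j, hj⟩ := by
        rw [hf'.buffer, ← hm'.buffer ⟨j, hj⟩]
      have hj' : j ≤ N := by omega
      have hfr : Frame 25 f (Function.update (Function.update (Function.update f' 25 j) 26
          (f' 7 + j)) 28 (m' (f' 7 + j))) := by
        repeat' first | exact h | refine Frame.update ?_ (by norm_num)
      refine Wp.cons (T₁ := 4 * N + 19) (Wp.ite ?_ ?_) (T₂ := 1) (R := fun g m' => g 25 = j ∧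
        Frame 25 f g ∧ MemRep inp D w b (partialUpdate M P i j) m') ?_ (by omega)
      · intro hbj
        replace hbj : b ⟨j, hj⟩ = 1 := by
          simp [h28] at hbj
          have := hb ⟨j, hj⟩
          omega
        apply Wp.add
        apply Wp.add
        apply Wp.add
        refine Wp.cons (wp_incrProg (i := i) (j := ⟨j, hj⟩) (k := k) ?_ hm' hn
          (partialUpdate_lt hM hPlt _ _) ?_ ?_ ?_ hk) (T₂ := 1) ?_ (by omega)
        · exact (((((hf'.update).update).update).update).update).update
        · simp [hf'.zero, h 24 (by norm_num), h24]
        · simp [hf'.zero]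
        · simp [hf'.zero, h 23 (by norm_num), h23]
        · rintro g m'' ⟨hm'', hg⟩
          apply Wp.nil
          refine ⟨?_, ?_, ?_⟩
          · rw [Function.update_of_ne (by norm_num), hg _ (by norm_num)]
            simp
          · refine Frame.update ?_ (by norm_num)
            refine Frame.trans ?_ (hg.mono (by norm_num))
            repeat' first | exact h | refine Frame.update ?_ (by norm_num)
          · rwa [← partialUpdate_incr i ⟨j, hj⟩ k (by rw [hP, hbi, hbj]; ring_nf)] at hm''
      · intro hbj
        replace hbj : b ⟨j, hj⟩ = 0 := by simpa [h28] using hbj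
        apply Wp.nil
        refine ⟨by simp, ?_, ?_⟩
        · repeat' first | exact h | refine Frame.update ?_ (by norm_num)
        · rwa [← partialUpdate_of_eq i ⟨j, hj⟩ (by
            rw [hP, hbj, mul_zero, mul_zero, add_zero, Nat.mod_eq_of_lt (hM _ _)])] at hm'
      · rintro g m'' ⟨h1, h2, h3⟩
        apply Wp.nil
        exact ⟨hj', by simp [h1], h2.update (by norm_num), h3⟩
    · refine ⟨le_rfl, by simp [hf.zero, hf.size], ?_, hm⟩
      repeat' first | exact Frame.refl f | refine Frame.update ?_ (by norm_num)
    · rintro f' m' ⟨-, -, h, hm'⟩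
      apply Wp.nil
      exact ⟨hm', h.update (by norm_num)⟩
  · intro hbi
    replace hbi : b i = 0 := by simpa [h27] using hbi
    refine Wp.mono (Wp.nil (T := 0) (Q := fun f' m' =>
      MemRep inp D w b (partialUpdate M P i 0) m' ∧ Frame 25 f f') ⟨?_, ?_⟩) (by omega)
      fun _ _ h => h
    · convert hm using 1
      ext a c
      have := c.isLt
      by_cases ha : a = i
      · subst ha
        simp [partialUpdate, hP, hbi, Nat.mod_eq_of_lt (hM _ _)]
      · have ha' : (a : ℕ) ≠ i := fun h => ha (Fin.ext h)
        simp [partialUpdate, ha']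
    · repeat' first | exact Frame.refl f | refine Frame.update ?_ (by norm_num)
  · rintro f' m' ⟨hm', h⟩
    apply Wp.nil
    exact ⟨hm', h.update (by norm_num)⟩

lemma wp_rankOneProg {P : Fin N → Fin N → ℕ} {k : ℕ} (hk : k ≤ 4) (hn : n ≤ N)
    (hM : ∀ i j, M i j < 4) (hb : ∀ j, b j < 2)
    (hP : ∀ i j, P i j = (M i j + k * (b i * b j)) % 4)
    (hf : Env n N D f) (h23 : f 23 = k) (hm : MemRep inp D w b M m) :
    Wp (N * (N * (4 * N + 24) + 9) + 3) rankOneProg f m fun f' m' =>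
      MemRep inp D w b P m' ∧ Frame 24 f f' := by
  apply Wp.add
  refine Wp.cons (Wp.forDown (T := N * (4 * N + 24) + 7) (fun i f' m' => i ≤ N ∧ f' 24 = i ∧
      Frame 24 f f' ∧ MemRep inp D w b (partialUpdate M P i 0) m') ?_ ?_ N _ _ ?_)
      (T₂ := 1) ?_ (by apply le_of_eq; ring)
  · rintro i f' m' ⟨_, h24, h, _⟩
    exact ⟨h24, by rw [h _ (by norm_num), hf.one]⟩
  · rintro i f' m' ⟨hi, h24, h, hm'⟩
    have hf' : Env n N D f' := hf.of_frame h
    refine Wp.mono (wp_rankOneRow hk hn hM hb hP ⟨i, hi⟩ hf'.update ?_ ?_ hm') le_rfl ?_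
    · simp [h 23 (by norm_num), h23]
    · simp
    · rintro g m'' ⟨hm'', hg⟩
      refine ⟨by omega, by rw [hg _ (by norm_num)]; simp, ?_, hm''⟩
      exact (h.update (by norm_num)).trans (hg.mono (by norm_num))
  · refine ⟨le_rfl, by simp [hf.zero, hf.size], (Frame.refl f).update (by norm_num), ?_⟩
    convert hm using 1
    ext a c
    have := a.isLt
    rw [partialUpdate, if_neg (by omega)]
  · rintro f' m' ⟨-, -, h, hm'⟩
    apply Wp.nil
    refine ⟨?_, h.update (by norm_num)⟩
    convert hm' using 1
    ext a c
    rw [partialUpdate, if_pos (by omega)]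

lemma wp_pivotProg (hf : Env n N D f) (hm : MemRep inp D w b M m) (hn : n ≤ N)
    (hM : ∀ i j, M i j < 4) (v : Fin N) (hv : f 20 = v) (hc : f 2 < 8) :
    Wp (4 * N ^ 3 + 28 * N ^ 2 + 30 * N + 36) pivotProg f m fun f' m' =>
      MemRep inp D w (fun j => M v j % 2) (pivot M v) m' ∧
      f' 2 = (f 2 + (M v v + 4 * (M v v / 2))) % 8 ∧ f' 10 = f 10 + M v v % 2 ∧
      ∀ r < 21, r ≠ 2 → r ≠ 10 → f' r = f r := by
  refine Wp.cons (wp_scalarProg hf hm hM v hv hc)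
    (T₂ := (N * (4 * N + 17) + 3) + ((N * (N * (4 * N + 24) + 9) + 3) + 1)) ?_ (by ring_nf; rfl)
  rintro f₁ m' ⟨rfl, h23, h2, h10, h⟩
  have hf₁ : Env n N D f₁ := hf.congr fun r _ _ => h r (by omega) (by omega) (by omega)
  refine Wp.cons (wp_copyProg hf₁ hm hn hM v ?_) ?_ le_rfl
  · rw [h _ (by norm_num) (by norm_num) (by norm_num), hv]
  rintro f₂ m₂ ⟨hm₂, h'⟩
  -- With the row parities in the buffer, the formula required of `P` is the definition of `pivot`.
  refine Wp.cons (wp_rankOneProg (P := pivot M v) (k := 3 - 2 * (M v v / 2)) (by omega) hn hM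
    (fun j => Nat.mod_lt _ (by norm_num)) (fun i j => rfl) (hf₁.of_frame h') ?_ hm₂) ?_ le_rfl
  · rw [h' _ (by norm_num), h23]
  rintro f₃ m₃ ⟨hm₃, h''⟩
  apply Wp.nil
  have h12 := (h'.trans h'').update (i := 39) (v := 0) (by norm_num)
  refine ⟨hm₃, ?_, ?_, fun r hr hr2 hr10 => ?_⟩
  · rw [h12 _ (by norm_num), h2]
  · rw [h12 _ (by norm_num), h10]
  · rw [h12 _ (by omega), h r hr hr2 hr10]

end pivotProgram

/-! ### The elimination of all variables -/

section elimination

open RAM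

/-- The inner loop of `elimRow`. -/
def elimInner : List RAM := [.add 20 18 9, pivotProg, .add 20 17 9, pivotProg]

/-- Makes the row of the matrix whose index is in register 17 even. -/
def elimRow : List RAM := [.add 20 17 9, pivotProg, .add 18 5 9, forDown 18 elimInner]

/-- Makes all entries of the matrix even. -/
def elimProg : RAM := block [.add 17 5 9, forDown 17 elimRow]

/-- The body of the loop of `finishProg`. -/
def finishBody : List RAM := [.add 30 17 9, .add 31 17 9, addrProg, .load 25 33,
  .ite 25 (block [.const 0 0]) (block [])]

/-- Writes the result, when all entries of the matrix are even. -/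
def finishProg : RAM := block [.const 0 1, .add 17 5 9, forDown 17 finishBody, .sub 1 10 1]

/-- The running time of `pivotProg`. -/
def pivotTime (N : ℕ) : ℕ := 4 * N ^ 3 + 28 * N ^ 2 + 30 * N + 36

variable {f m : ℕ → ℕ} {inp : ℕ → ℕ} {n N D : ℕ} {w : Fin n → Fin N}
  {M : Fin N → Fin N → ℕ} {A : ℂ}

/-- The machine represents the number `A` as a multiple of a Gauss sum. -/
structure ElimState (A : ℂ) (inp : ℕ → ℕ) {n N : ℕ} (D : ℕ) (w : Fin n → Fin N)
    (M : Fin N → Fin N → ℕ) (f m : ℕ → ℕ) : Prop where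
  env : Env n N D f
  phase_lt : f 2 < 8
  reduced : Reduced M
  mem : ∃ b, MemRep inp D w b M m
  value : A = (Real.sqrt 2 : ℂ) ^ f 1 * (Real.sqrt 2 : ℂ)⁻¹ ^ f 10 * omega8 ^ f 2 * avg (phase M)

lemma ElimState.congr {f' : ℕ → ℕ} (h : ElimState A inp D w M f m) (hf : Frame 11 f f') :
    ElimState A inp D w M f' m where
  env := h.env.of_frame hf
  phase_lt := by rw [hf _ (by norm_num)]; exact h.phase_lt
  reduced := h.reduced
  mem := h.mem
  value := by
    rw [hf 1 (by norm_num), hf 10 (by norm_num), hf 2 (by norm_num)]; exact h.value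

lemma wp_pivotProg_elim (h : ElimState A inp D w M f m) (hn : n ≤ N) (v : Fin N) (hv : f 20 = v) :
    Wp (pivotTime N) pivotProg f m fun f' m' => ElimState A inp D w (pivot M v) f' m' ∧
      ∀ r < 20, 10 < r → f' r = f r := by
  obtain ⟨b, hb⟩ := h.mem
  refine Wp.mono (wp_pivotProg h.env hb hn h.reduced.lt v hv h.phase_lt) le_rfl ?_
  rintro f' m' ⟨hm', h2, h10, hf'⟩
  refine ⟨⟨?_, ?_, h.reduced.pivot v, ⟨_, hm'⟩, ?_⟩, fun r hr hr' => hf' r (by omega) (by omega)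
    (by omega)⟩
  · exact h.env.congr fun r _ _ => hf' r (by omega) (by omega) (by omega)
  · rw [h2]
    exact Nat.mod_lt _ (by norm_num)
  · rw [h.value, avg_phase_pivot h.reduced v, h2, h10, omega8_pow_mod,
      hf' 1 (by norm_num) (by norm_num) (by norm_num), pow_add, pow_add]
    ring

/-- The first step makes the diagonal entry even, as `pivot_pivot_eq_zero` requires, and each pair
of steps preserves this and settles one more column. Rows that are already even have parity 0 in
every pivot row, so they stay even. -/
lemma wp_elimRow (h : ElimState A inp D w M f m) (hn : n ≤ N) (v : Fin N) (hv : f 17 = v)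
    (hz : ∀ u, v < u → ∀ j, (M u j : ZMod 2) = 0) :
    Wp (pivotTime N + N * (2 * pivotTime N + 5) + 4) (block elimRow) f m fun f' m' =>
      f' 17 = v ∧ ∃ M', ElimState A inp D w M' f' m' ∧
        ∀ u, v ≤ u → ∀ j, (M' u j : ZMod 2) = 0 := by
  apply Wp.add
  refine Wp.cons (wp_pivotProg_elim (h.congr ((Frame.refl f).update (by norm_num))) hn v ?_)
    (T₂ := N * (2 * pivotTime N + 5) + 3) ?_ (by omega)
  · simp [h.env.zero, hv]
  rintro f₁ m₁ ⟨h₁, hf₁⟩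
  have hv₁ : f₁ 17 = v := by rw [hf₁ _ (by norm_num) (by norm_num)]; simp [hv]
  apply Wp.add
  refine Wp.cons (Wp.forDown (T := 2 * pivotTime N + 3) (fun k f' m' => k ≤ N ∧ f' 18 = k ∧
    f' 17 = v ∧ ∃ M', ElimState A inp D w M' f' m' ∧ (∀ u, v < u → ∀ j, (M' u j : ZMod 2) = 0) ∧
      (M' v v : ZMod 2) = 0 ∧ ∀ j : Fin N, k ≤ j → (M' v j : ZMod 2) = 0) ?_ ?_ N _ _ ?_)
    (T₂ := 1) ?_ le_rfl
  · rintro k f' m' ⟨_, h18, _, M', hM', _⟩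
    exact ⟨h18, hM'.env.one⟩
  · rintro k f' m' ⟨hk, h18, h17, M', hM', hz', hvv, hj⟩
    have hk' : k < N := hk
    apply Wp.add
    refine Wp.cons (wp_pivotProg_elim (hM'.congr ?_) hn ⟨k, hk'⟩ ?_)
      (T₂ := pivotTime N + 2) ?_ (by omega)
    · exact ((Frame.refl f').update (by norm_num)).update (by norm_num)
    · simp [hM'.env.zero]
    rintro f₂ m₂ ⟨h₂, hf₂⟩
    have h17₂ : f₂ 17 = v := by rw [hf₂ _ (by norm_num) (by norm_num)]; simp [h17]
    have h18₂ : f₂ 18 = k := by rw [hf₂ _ (by norm_num) (by norm_num)]; simp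
    apply Wp.add
    refine Wp.cons (wp_pivotProg_elim (h₂.congr ((Frame.refl f₂).update (by norm_num))) hn v ?_)
      (T₂ := 1) ?_ (by omega)
    · simp [h₂.env.zero, h17₂]
    rintro f₃ m₃ ⟨h₃, hf₃⟩
    apply Wp.nil
    refine ⟨hk'.le, ?_, ?_, _, h₃.congr ((Frame.refl f₃).update (by norm_num)), ?_, ?_, ?_⟩
    · rw [Function.update_of_ne (by norm_num), hf₃ _ (by norm_num) (by norm_num)]; simp [h18₂]
    · rw [Function.update_of_ne (by norm_num), hf₃ _ (by norm_num) (by norm_num)]; simp [h17₂]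
    · intro u hu
      exact pivot_row_eq_zero h₂.reduced _ (pivot_row_eq_zero hM'.reduced _ (hz' u hu))
    · exact pivot_diag_eq_zero h₂.reduced _
    · intro j hkj
      refine pivot_pivot_eq_zero hM'.reduced hvv _ ?_
      by_cases hjk : (j : ℕ) = k
      · exact Or.inr (Fin.ext hjk)
      · exact Or.inl (hj j (by omega))
  · refine ⟨le_rfl, by simp [h₁.env.zero, h₁.env.size], by simp [hv₁], _,
      h₁.congr ((Frame.refl f₁).update (by norm_num)), ?_, ?_, ?_⟩
    · intro u hu
      exact pivot_row_eq_zero h.reduced _ (hz u hu)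
    · exact pivot_diag_eq_zero h.reduced _
    · intro j hj
      exact absurd hj (by have := j.isLt; omega)
  · rintro f' m' ⟨-, -, h17, M', hM', hz', -, hj⟩
    apply Wp.nil
    refine ⟨by simpa using h17, M', hM'.congr ((Frame.refl f').update (by norm_num)), ?_⟩
    intro u hu j
    rcases hu.lt_or_eq with hu | rfl
    · exact hz' u hu j
    · exact hj j (Nat.zero_le _)

lemma wp_elimProg (h : ElimState A inp D w M f m) (hn : n ≤ N) :
    Wp (N * (pivotTime N + N * (2 * pivotTime N + 5) + 6) + 3) elimProg f m fun f' m' =>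
      ∃ M', ElimState A inp D w M' f' m' ∧ ∀ u j, (M' u j : ZMod 2) = 0 := by
  apply Wp.add
  refine Wp.cons (Wp.forDown (T := pivotTime N + N * (2 * pivotTime N + 5) + 4)
    (fun k f' m' => k ≤ N ∧ f' 17 = k ∧ ∃ M', ElimState A inp D w M' f' m' ∧
      ∀ u : Fin N, k ≤ u → ∀ j, (M' u j : ZMod 2) = 0) ?_ ?_ N _ _ ?_) (T₂ := 1) ?_ le_rfl
  · rintro k f' m' ⟨_, h17, M', hM', _⟩
    exact ⟨h17, hM'.env.one⟩
  · rintro k f' m' ⟨hk, h17, M', hM', hz⟩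
    refine Wp.mono (wp_elimRow (v := ⟨k, hk⟩) (hM'.congr ((Frame.refl f').update (by norm_num))) hn
      (by simp) fun u hu j => hz u hu j) le_rfl ?_
    rintro f₁ m₁ ⟨h17₁, M₁, hM₁, hz₁⟩
    exact ⟨by omega, h17₁, M₁, hM₁, fun u hu j => hz₁ u hu j⟩
  · refine ⟨le_rfl, by simp [h.env.zero, h.env.size], M,
      h.congr ((Frame.refl f).update (by norm_num)), fun u hu => ?_⟩
    exact absurd hu (by have := u.isLt; omega)
  · rintro f' m' ⟨-, -, M', hM', hz⟩
    apply Wp.nil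
    exact ⟨M', hM'.congr ((Frame.refl f').update (by norm_num)), fun u j => hz u (Nat.zero_le _) j⟩

/-- With all entries even, a nonzero diagonal entry decides for the value zero; otherwise the
average is 1 and only the powers of √2 and ω remain. -/
lemma wp_finishProg (h : ElimState A inp D w M f m) (hz : ∀ u j, (M u j : ZMod 2) = 0)
    (hA : ‖A‖ ≤ 1) :
    Wp (N * (4 * N + 13) + 5) finishProg f m fun f' _ =>
      RAMState.value ⟨f', m⟩ = A ∧ f' 2 < 8 := by
  obtain ⟨b, hb⟩ := h.mem
  have hev : ∀ i j, M i j % 2 = 0 := fun i j => (mod_two_eq_zero_iff _).2 (hz i j)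
  apply Wp.const
  apply Wp.add
  refine Wp.cons (Wp.forDown (T := 4 * N + 11) (fun k f' m' => k ≤ N ∧ m' = m ∧ f' 17 = k ∧
    (∀ r < 17, 0 < r → f' r = f r) ∧ ((f' 0 = 0 ∧ ∃ v, M v v ≠ 0) ∨
      (f' 0 ≠ 0 ∧ ∀ v : Fin N, k ≤ v → M v v = 0))) ?_ ?_ N _ _ ?_) (T₂ := 2) ?_ ?_
  · rintro k f' m' ⟨_, _, h17, hf', _⟩
    exact ⟨h17, by rw [hf' _ (by norm_num) (by norm_num), h.env.one]⟩
  · rintro k f' m' ⟨hk, rfl, h17, hf', h0⟩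
    have he : Env n N D f' := h.env.congr fun r _ _ => hf' r (by omega) (by omega)
    have hk' : k < N := hk
    apply Wp.add
    apply Wp.add
    refine Wp.cons (wp_addrProg (((he.update).update).update) ⟨k, hk'⟩ ⟨k, hk'⟩ ?_ ?_)
      (T₂ := 5) ?_ (by omega)
    · simp [he.zero]
    · simp [he.zero]
    rintro g m'' ⟨rfl, h33, hg⟩
    have hmk : m'' (D + 2 * N + k + k * N) = M ⟨k, hk'⟩ ⟨k, hk'⟩ := hb.matrix ⟨k, hk'⟩ ⟨k, hk'⟩
    have hg17 : g 17 = k := by rw [hg _ (by norm_num)]; simp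
    have hg' : ∀ r < 17, g r = f' r := fun r hr => by
      rw [hg _ (by omega)]
      simp [show r ≠ 30 by omega, show r ≠ 31 by omega, show r ≠ 17 by omega]
    apply Wp.load
    rw [h33, hmk]
    refine Wp.cons (T₁ := 3) (Wp.ite ?_ ?_) (T₂ := 1) (R := fun f₂ m₂ => m₂ = m'' ∧ f₂ 17 = k ∧
      (∀ r < 17, 0 < r → f₂ r = f' r) ∧ ((f₂ 0 = 0 ∧ M ⟨k, hk'⟩ ⟨k, hk'⟩ ≠ 0) ∨
        (f₂ 0 = f' 0 ∧ M ⟨k, hk'⟩ ⟨k, hk'⟩ = 0))) ?_ le_rfl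
    · intro hne
      apply Wp.const
      apply Wp.nil
      refine ⟨rfl, by simp [hg17], fun r hr hr' => ?_, Or.inl ⟨by simp, by simpa using hne⟩⟩
      simp [show r ≠ 39 by omega, show r ≠ 0 by omega, show r ≠ 25 by omega, hg' r hr]
    · intro heq
      apply Wp.nil
      refine ⟨rfl, by simp [hg17], fun r hr hr' => ?_,
        Or.inr ⟨by simp [hg' 0 (by norm_num)], by simpa using heq⟩⟩
      simp [show r ≠ 39 by omega, show r ≠ 25 by omega, hg' r hr]
    · rintro f₂ m₂ ⟨hm₂, h17₂, hf₂, h0₂⟩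
      apply Wp.nil
      refine ⟨by omega, hm₂, by simp [h17₂], fun r hr hr' => ?_, ?_⟩
      · rw [Function.update_of_ne (by omega), hf₂ r hr hr', hf' r hr hr']
      · rw [Function.update_of_ne (by norm_num)]
        rcases h0₂ with ⟨h1, h2⟩ | ⟨h1, h2⟩
        · exact Or.inl ⟨h1, _, h2⟩
        · rw [h1]
          rcases h0 with h0 | ⟨h0, h0'⟩
          · exact Or.inl h0
          · refine Or.inr ⟨h0, fun v hv => ?_⟩
            by_cases hvk : (v : ℕ) = k
            · rwa [show v = ⟨k, hk'⟩ from Fin.ext hvk]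
            · exact h0' v (by omega)
  · refine ⟨le_rfl, rfl, by simp [h.env.zero, h.env.size], fun r hr hr' => ?_, Or.inr ⟨by simp,
      fun v hv => absurd hv (by have := v.isLt; omega)⟩⟩
    simp [show r ≠ 0 by omega, show r ≠ 17 by omega]
  · rintro f' m' ⟨-, rfl, -, hf', h0⟩
    apply Wp.sub
    apply Wp.nil
    have h2 : f' 2 = f 2 := hf' 2 (by norm_num) (by norm_num)
    have hval := h.value
    refine ⟨?_, by simpa [h2] using h.phase_lt⟩
    have e0 (v : ℕ) : Function.update (Function.update f' 1 v) 39 0 0 = f' 0 := by simp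
    have e1 (v : ℕ) : Function.update (Function.update f' 1 v) 39 0 1 = v := by simp
    have e2 (v : ℕ) : Function.update (Function.update f' 1 v) 39 0 2 = f' 2 := by simp
    simp only [RAMState.value, e0, e1, e2]
    rw [h2, hf' 10 (by norm_num) (by norm_num), hf' 1 (by norm_num) (by norm_num),
      exp_nat_mul_omega8]
    rcases h0 with ⟨h1, v, hv⟩ | ⟨h1, h3⟩
    · rw [if_pos h1, hval, avg_phase_eq_zero h.reduced v (hev v) hv, mul_zero]
    · rw [avg_phase_eq_one h.reduced hev fun v => h3 v (Nat.zero_le _), mul_one] at hval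
      rw [if_neg h1]
      have hs2 : (1 : ℝ) < Real.sqrt 2 := by
        rw [Real.lt_sqrt (by norm_num)]; norm_num
      -- Here |A| = √2^{f 1 - f 10} and |A| ≤ 1, so the subtraction of the exponents is not
      -- truncated.
      have hle : f 1 ≤ f 10 := by
        rw [hval, norm_mul, norm_mul, norm_pow, norm_pow, norm_pow, norm_omega8, one_pow, mul_one,
          norm_inv, Complex.norm_of_nonneg (Real.sqrt_nonneg 2), inv_pow, ← div_eq_mul_inv,
          div_le_one (by positivity)] at hA
        exact (pow_le_pow_iff_right₀ hs2).1 hA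
      rw [hval]
      congr 1
      rw [Nat.cast_sub hle, neg_sub, _root_.zpow_sub₀ sqrt_two_ne_zero, zpow_natCast, zpow_natCast,
        inv_pow, div_eq_mul_inv]
  · apply le_of_eq; ring

end elimination

/-! ### The program that builds the quadratic form of a circuit -/

section gatePrograms

open RAM

/-- A Hadamard gate: the address of the carrier is in register 18, the carrier in register 19 and
the new variable in register 16. -/
def hadProg : RAM := block [.add 1 1 3, .add 30 19 9, .add 31 16 9, .add 32 3 9, incrProg,
  .add 30 16 9, .add 31 19 9, incrProg, .store 18 16]

/-- A gate `rotX` on the carrier in register 19. -/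
def rotXProg : RAM := block [.const 32 3, .add 30 19 9, .add 31 19 9, incrProg, .add 2 2 3,
  modEightProg]

/-- A gate `rotXX` on the carrier in register 19 and the carrier of the qubit in register 15. -/
def rotXXProg : RAM := block [.add 18 6 15, .load 15 18, .const 32 3, .add 30 19 9, .add 31 19 9,
  incrProg, .add 31 15 9, incrProg, .add 30 15 9, .add 31 19 9, incrProg, .add 31 15 9, incrProg,
  .add 2 2 3, modEightProg]

/-- Reads the next gate and adds it to the quadratic form. -/
def gateBody : List RAM := [.load 13 12, .add 14 12 3, .add 15 14 3, .load 14 14, .load 15 15,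
  .add 12 12 3, .add 12 12 3, .add 12 12 3, .add 16 4 11, .add 18 6 14, .load 19 18,
  .ite 13 (block [.sub 13 13 3, .ite 13 rotXXProg rotXProg]) hadProg]

/-- Adds an output bit to the quadratic form. -/
def flipBody : List RAM := [.const 13 2, .add 13 13 17, .load 13 13, .add 32 13 13, .add 18 6 17,
  .load 30 18, .add 31 30 9, incrProg]

variable {f m : ℕ → ℕ} {inp : ℕ → ℕ} {n N D : ℕ} {w : Fin n → Fin N} {b : Fin N → ℕ}
  {M : Fin N → Fin N → ℕ} {A : ℂ} {x : Fin n → ZMod 2}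

lemma wp_hadProg (hf : Env n N D f) (hm : MemRep inp D w b M m) (hn : n ≤ N)
    (hM : ∀ i j, M i j < 4) (q : Fin n) (t a : Fin N) (h18 : f 18 = D + q) (h19 : f 19 = t)
    (h16 : f 16 = a) :
    Wp (8 * N + 36) hadProg f m fun f' m' =>
      MemRep inp D (Function.update w q a) b (incr (incr M t a 1) a t 1) m' ∧ f' 1 = f 1 + 1 ∧
        ∀ r < 30, r ≠ 1 → f' r = f r := by
  apply Wp.add
  apply Wp.add
  apply Wp.add
  apply Wp.add
  refine Wp.cons (wp_incrProg ((((hf.update).update).update).update) hm hn hM t a 1 ?_ ?_ ?_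
    (by norm_num)) (T₂ := 4 * N + 18) ?_ (by omega)
  · simp [hf.zero, h19]
  · simp [hf.zero, h16]
  · simp [hf.zero, hf.one]
  rintro f₁ m₁ ⟨hm₁, hf₁⟩
  have hf₁' : ∀ r < 30, r ≠ 1 → f₁ r = f r := fun r hr hr' => by
    rw [hf₁ r (by omega)]
    simp [hr', show r ≠ 30 by omega, show r ≠ 31 by omega, show r ≠ 32 by omega]
  have h1₁ : f₁ 1 = f 1 + 1 := by
    rw [hf₁ _ (by norm_num)]; simp [hf.one]
  have h32₁ : f₁ 32 = 1 := by
    rw [hf₁ _ (by norm_num)]; simp [hf.one, hf.zero]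
  have he₁ : Env n N D f₁ := ((((hf.update).update).update).update).of_frame hf₁
  apply Wp.add
  apply Wp.add
  refine Wp.cons (wp_incrProg ((he₁.update).update) hm₁ hn (incr_lt hM _ _ _) a t 1 ?_ ?_ ?_
    (by norm_num)) (T₂ := 2) ?_ (by omega)
  · simp [he₁.zero, hf₁' 16, h16]
  · simp [he₁.zero, hf₁' 19, h19]
  · simp [h32₁]
  rintro f₂ m₂ ⟨hm₂, hf₂⟩
  have hf₂' : ∀ r < 30, f₂ r = f₁ r := fun r hr => by
    rw [hf₂ r (by omega)]
    simp [show r ≠ 30 by omega, show r ≠ 31 by omega]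
  apply Wp.store
  apply Wp.nil
  refine ⟨?_, ?_, fun r hr hr' => ?_⟩
  · rw [hf₂' 18 (by norm_num), hf₁' 18 (by norm_num) (by norm_num), hf₂' 16 (by norm_num),
      hf₁' 16 (by norm_num) (by norm_num), h18, h16]
    exact hm₂.set_carrier hn q a
  · rw [Function.update_of_ne (by norm_num), hf₂' 1 (by norm_num), h1₁]
  · rw [Function.update_of_ne (by omega), hf₂' r hr, hf₁' r hr hr']

lemma wp_add_one_phase (h3 : f 3 = 1) (h2 : f 2 < 8) :
    Wp 10 (block [.add 2 2 3, modEightProg]) f m fun f' m' =>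
      m' = m ∧ f' 2 = (f 2 + 1) % 8 ∧ ∀ r < 30, r ≠ 2 → f' r = f r := by
  apply Wp.add
  refine Wp.cons (wp_modEightProg ?_ ?_) (T₂ := 1) ?_ (by omega)
  · simp [h3]
  · simp [h3]
    omega
  rintro f' m' ⟨rfl, h2', hf'⟩
  apply Wp.nil
  refine ⟨rfl, ?_, fun r hr hr' => ?_⟩
  · simpa [h3] using h2'
  · rw [Function.update_of_ne (by omega), hf' r (by omega) hr', Function.update_of_ne hr']

lemma wp_rotXProg (hf : Env n N D f) (hm : MemRep inp D w b M m) (hn : n ≤ N)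
    (hM : ∀ i j, M i j < 4) (t : Fin N) (h19 : f 19 = t) (h2 : f 2 < 8) :
    Wp (4 * N + 27) rotXProg f m fun f' m' =>
      MemRep inp D w b (incr M t t 3) m' ∧ f' 2 = (f 2 + 1) % 8 ∧
        ∀ r < 13, r ≠ 2 → f' r = f r := by
  apply Wp.const
  apply Wp.add
  apply Wp.add
  refine Wp.cons (wp_incrProg (((hf.update).update).update) hm hn hM t t 3 ?_ ?_ ?_
    (by norm_num)) (T₂ := 10) ?_ (by omega)
  · simp [hf.zero, h19]
  · simp [hf.zero, h19]
  · simp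
  rintro f₁ m₁ ⟨hm₁, hf₁⟩
  have hf₁' : ∀ r < 30, f₁ r = f r := fun r hr => by
    rw [hf₁ r (by omega)]
    simp [show r ≠ 30 by omega, show r ≠ 31 by omega, show r ≠ 32 by omega]
  refine Wp.mono (wp_add_one_phase (by rw [hf₁' _ (by norm_num), hf.one])
    (by rwa [hf₁' _ (by norm_num)])) le_rfl ?_
  rintro f₂ m₂ ⟨rfl, h2₂, hf₂⟩
  refine ⟨hm₁, by rw [h2₂, hf₁' 2 (by norm_num)], fun r hr hr' => ?_⟩
  rw [hf₂ r (by omega) hr', hf₁' r (by omega)]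

lemma wp_rotXXProg (hf : Env n N D f) (hm : MemRep inp D w b M m) (hn : n ≤ N)
    (hM : ∀ i j, M i j < 4) (t : Fin N) (r : Fin n) (h19 : f 19 = t) (h15 : f 15 = r)
    (h2 : f 2 < 8) :
    Wp (16 * N + 75) rotXXProg f m fun f' m' =>
      MemRep inp D w b (incr (incr (incr (incr M t t 3) t (w r) 3) (w r) t 3) (w r) (w r) 3) m' ∧
        f' 2 = (f 2 + 1) % 8 ∧ ∀ r < 13, r ≠ 2 → f' r = f r := by
  apply Wp.add
  apply Wp.load
  apply Wp.const
  apply Wp.add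
  apply Wp.add
  have hu : m (f 6 + f 15) = w r := by rw [hf.carriers, h15, hm.carrier]
  refine Wp.cons (wp_incrProg (((((hf.update).update).update).update).update) hm hn hM t t 3 ?_ ?_
    ?_ (by norm_num)) (T₂ := 12 * N + 56) ?_ (by omega)
  · simp [hf.zero, h19]
  · simp [hf.zero, h19]
  · simp
  rintro f₁ m₁ ⟨hm₁, hf₁⟩
  have hf₁' : ∀ r < 13, f₁ r = f r := fun r hr => by
    rw [hf₁ r (by omega)]
    simp [show r ≠ 30 by omega, show r ≠ 31 by omega, show r ≠ 32 by omega, show r ≠ 15 by omega,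
      show r ≠ 18 by omega]
  have h15₁ : f₁ 15 = w r := by rw [hf₁ _ (by norm_num)]; simp [hu]
  have h19₁ : f₁ 19 = t := by rw [hf₁ _ (by norm_num)]; simp [h19]
  have h30₁ : f₁ 30 = t := by rw [hf₁ _ (by norm_num)]; simp [hf.zero, h19]
  have h32₁ : f₁ 32 = 3 := by rw [hf₁ _ (by norm_num)]; simp
  have he₁ : Env n N D f₁ := hf.of_frame (K := 13) hf₁'
  apply Wp.add
  refine Wp.cons (wp_incrProg he₁.update hm₁ hn (incr_lt hM _ _ _) t (w r) 3 ?_ ?_ ?_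
    (by norm_num)) (T₂ := 8 * N + 41) ?_ (by omega)
  · simp [h30₁]
  · simp [he₁.zero, h15₁]
  · simp [h32₁]
  rintro f₂ m₂ ⟨hm₂, hf₂⟩
  have hf₂' : ∀ r < 30, f₂ r = f₁ r := fun r hr => by
    rw [hf₂ r (by omega)]
    simp [show r ≠ 31 by omega]
  have h32₂ : f₂ 32 = 3 := by rw [hf₂ _ (by norm_num)]; simp [h32₁]
  have he₂ : Env n N D f₂ := he₁.of_frame (K := 30) hf₂'
  apply Wp.add
  apply Wp.add
  refine Wp.cons (wp_incrProg ((he₂.update).update) hm₂ hn (incr_lt (incr_lt hM _ _ _) _ _ _)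
    (w r) t 3 ?_ ?_ ?_ (by norm_num)) (T₂ := 4 * N + 25) ?_ (by omega)
  · simp [he₂.zero, hf₂' 15, h15₁]
  · simp [he₂.zero, hf₂' 19, h19₁]
  · simp [h32₂]
  rintro f₃ m₃ ⟨hm₃, hf₃⟩
  have hf₃' : ∀ r < 30, f₃ r = f₁ r := fun r hr => by
    rw [hf₃ r (by omega)]
    simp [show r ≠ 30 by omega, show r ≠ 31 by omega, hf₂' r hr]
  have h32₃ : f₃ 32 = 3 := by rw [hf₃ _ (by norm_num)]; simp [h32₂]
  have h30₃ : f₃ 30 = w r := by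
    rw [hf₃ _ (by norm_num)]; simp [he₂.zero, hf₂' 15, h15₁]
  have he₃ : Env n N D f₃ := he₁.of_frame (K := 30) hf₃'
  apply Wp.add
  refine Wp.cons (wp_incrProg he₃.update hm₃ hn (incr_lt (incr_lt (incr_lt hM _ _ _) _ _ _) _ _ _)
    (w r) (w r) 3 ?_ ?_ ?_ (by norm_num)) (T₂ := 10) ?_ (by omega)
  · simp [h30₃]
  · simp [he₃.zero, hf₃' 15, h15₁]
  · simp [h32₃]
  rintro f₄ m₄ ⟨hm₄, hf₄⟩
  have hf₄' : ∀ r < 13, f₄ r = f r := fun r hr => by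
    rw [hf₄ r (by omega), Function.update_of_ne (by omega), hf₃' r (by omega), hf₁' r hr]
  refine Wp.mono (wp_add_one_phase (by rw [hf₄' _ (by norm_num), hf.one])
    (by rwa [hf₄' _ (by norm_num)])) le_rfl ?_
  rintro f₅ m₅ ⟨rfl, h2₅, hf₅⟩
  refine ⟨hm₄, by rw [h2₅, hf₄' 2 (by norm_num)], fun r hr hr' => ?_⟩
  rw [hf₅ r (by omega) hr', hf₄' r hr]

/-- The state of the machine when the circuit `C` is still to be read. -/
structure GateState (A : ℂ) (x : Fin n → ZMod 2) (inp : ℕ → ℕ) (N D : ℕ) (C : Circuit n)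
    (f m : ℕ → ℕ) (w : Fin n → Fin N) (M : Fin N → Fin N → ℕ) : Prop where
  env : Env n N D f
  phase_lt : f 2 < 8
  exponent : f 10 = 0
  counter : f 11 = C.length
  pointer : f 12 + 3 * C.length = D
  input : ∀ j, inp (f 12 + j) = (C.flatMap Gate.encode).getD j 0
  reduced : Reduced M
  mem : MemRep inp D w (fun _ => 0) M m
  injective : Function.Injective w
  carrier_fresh : ∀ q, (w q : ℕ) < n ∨ n + C.length ≤ w q
  row_fresh : ∀ i : Fin N, n ≤ i → (i : ℕ) < n + C.length → ∀ j, M i j = 0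
  size : n + C.length ≤ N
  value : A = (Real.sqrt 2 : ℂ) ^ f 1 * omega8 ^ f 2 *
    avg fun z => phase M z * xAmp (Real.pi / 4) C (z ∘ w) x

lemma incr_of_ne_left {i j a c : Fin N} (k : ℕ) (h : a ≠ i) : incr M i j k a c = M a c := by
  rw [incr, if_neg fun h' => h h'.1]

lemma getD_cons_flatMap (g : Gate n) (C : Circuit n) :
    ∀ j, ((g :: C).flatMap Gate.encode).getD (j + 3) 0 = (C.flatMap Gate.encode).getD j 0 := by
  intro j
  cases g <;> rfl

/-- Every gate reserves a variable, whether it is a Hadamard gate or not: the one of index n plus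
the number of gates after it. Carriers are inputs or variables of gates already read, which have
larger indices, so a reserved variable has a zero row and carries no qubit. Those of rotations are
never used, which a normalised average does not notice. -/
lemma wp_gateBody {g : Gate n} {C : Circuit n} (h : GateState A x inp N D (g :: C) f m w M) :
    Wp (16 * N + 91) (block gateBody) (Function.update f 11 C.length) m fun f' m' =>
      ∃ w' M', GateState A x inp N D C f' m' w' M' := by
  have he := h.env
  have hlen : (g :: C).length = C.length + 1 := rfl
  have hptr := h.pointer
  have hsize := h.size
  rw [hlen] at hptr hsize
  have hn : n ≤ N := by omega
  have hin : ∀ j < 3, m (f 12 + j) = ((g :: C).flatMap Gate.encode).getD j 0 := by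
    intro j hj
    rw [h.mem.input _ (by omega), h.input]
  have hin0 : m (f 12) = ((g :: C).flatMap Gate.encode).getD 0 0 := hin 0 (by norm_num)
  have hin1 := hin 1 (by norm_num)
  have hin2 : m (f 12 + 1 + 1) = ((g :: C).flatMap Gate.encode).getD 2 0 := hin 2 (by norm_num)
  have hinput : ∀ j, inp (f 12 + 3 + j) = (C.flatMap Gate.encode).getD j 0 := by
    intro j
    rw [← getD_cons_flatMap g C j, ← h.input]
    congr 1
    ring
  apply Wp.load
  apply Wp.add
  apply Wp.add
  apply Wp.load
  apply Wp.load
  apply Wp.add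
  apply Wp.add
  apply Wp.add
  apply Wp.add
  apply Wp.add
  apply Wp.load
  generalize hF : Function.update _ 19 _ = F
  have hFr : ∀ r < 11, F r = f r := by
    intro r hr
    rw [← hF]
    simp [show r ≠ 19 by omega, show r ≠ 18 by omega, show r ≠ 16 by omega, show r ≠ 12 by omega,
      show r ≠ 15 by omega, show r ≠ 14 by omega, show r ≠ 13 by omega, show r ≠ 11 by omega]
  have heF : Env n N D F := he.of_frame (K := 11) hFr
  have hF11 : F 11 = C.length := by rw [← hF]; simp
  have hF12 : F 12 = f 12 + 3 := by rw [← hF]; simp [he.one, add_assoc]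
  have hF13 : F 13 = m (f 12) := by rw [← hF]; simp
  have hF15 : F 15 = m (f 12 + 1 + 1) := by rw [← hF]; simp [he.one]
  have hF16 : F 16 = n + C.length := by rw [← hF]; simp [he.qubits]
  have hF18 : F 18 = D + m (f 12 + 1) := by rw [← hF]; simp [he.one, he.carriers]
  have hF19 : F 19 = m (D + m (f 12 + 1)) := by rw [← hF]; simp [he.one, he.carriers]
  have hF2 : F 2 = f 2 := hFr 2 (by norm_num)
  have hF1 : F 1 = f 1 := hFr 1 (by norm_num)
  clear hF
  refine Wp.cons (T₁ := 16 * N + 79) (T₂ := 1)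
    (R := fun f' m' => ∃ w' M', GateState A x inp N D C f' m' w' M') (Wp.ite ?_ ?_) ?_ (by omega)
  · intro h13
    cases g with
    | had q =>
      rw [hF13, hin0] at h13
      exact absurd rfl h13
    | rotX q =>
      have hk : m (f 12) = 1 := hin0
      have hq : m (f 12 + 1) = q := hin1
      rw [hk] at hF13
      rw [hq, h.mem.carrier] at hF19
      apply Wp.sub
      refine Wp.cons (T₂ := 1) (Wp.ite_zero (by simp [hF13, heF.one]) (wp_rotXProg heF.update h.mem
        hn h.reduced.lt (w q) (by simpa using hF19) (by simpa [hF2] using h.phase_lt))) ?_ (by omega)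
      rintro f₁ m₁ ⟨hm₁, h2₁, hf₁⟩
      apply Wp.nil
      have hf₁' : ∀ r < 13, r ≠ 2 → Function.update f₁ 39 0 r = F r := fun r hr hr2 => by
        rw [Function.update_of_ne (by omega), hf₁ r hr hr2, Function.update_of_ne (by omega)]
      have h2₁' : Function.update f₁ 39 0 2 = (f 2 + 1) % 8 := by
        simpa [hF2] using h2₁
      have hfr : ∀ r < 11, r ≠ 2 → Function.update f₁ 39 0 r = f r := fun r hr hr2 => by
        rw [hf₁' r (by omega) hr2, hFr r hr]
      refine ⟨w, _, ⟨?_, ?_, ?_, ?_, ?_, ?_, h.reduced.incr_diag (w q) 3, hm₁, h.injective, ?_, ?_,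
        by omega, ?_⟩⟩
      · exact he.congr fun r _ _ => hfr r (by omega) (by omega)
      · rw [h2₁']
        exact Nat.mod_lt _ (by norm_num)
      · rw [hfr _ (by norm_num) (by norm_num), h.exponent]
      · rw [hf₁' _ (by norm_num) (by norm_num), hF11]
      · rw [hf₁' _ (by norm_num) (by norm_num), hF12]
        omega
      · rw [hf₁' _ (by norm_num) (by norm_num), hF12]
        exact hinput
      · intro r
        have := h.carrier_fresh r
        rw [hlen] at this
        omega
      · intro i hi hi' j
        have := h.carrier_fresh q
        rw [hlen] at this
        rw [incr_of_ne_left _ (by rintro rfl; omega), h.row_fresh i hi (by rw [hlen]; omega)]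
      · rw [h.value, avg_phase_rotX, h2₁', omega8_pow_mod, hfr 1 (by norm_num) (by norm_num),
          pow_succ]
        ring
    | rotXX q r hqr =>
      have hk : m (f 12) = 2 := hin0
      have hq : m (f 12 + 1) = q := hin1
      have hr : m (f 12 + 1 + 1) = r := hin2
      rw [hk] at hF13
      rw [hr] at hF15
      rw [hq, h.mem.carrier] at hF19
      apply Wp.sub
      refine Wp.cons (T₂ := 1) (Wp.ite_pos (by simp [hF13, heF.one]) (wp_rotXXProg heF.update h.mem
        hn h.reduced.lt (w q) r (by simpa using hF19) (by simpa using hF15)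
        (by simpa [hF2] using h.phase_lt))) ?_ (by omega)
      rintro f₁ m₁ ⟨hm₁, h2₁, hf₁⟩
      apply Wp.nil
      have hf₁' : ∀ r < 13, r ≠ 2 → Function.update f₁ 39 0 r = F r := fun r hr hr2 => by
        rw [Function.update_of_ne (by omega), hf₁ r hr hr2, Function.update_of_ne (by omega)]
      have h2₁' : Function.update f₁ 39 0 2 = (f 2 + 1) % 8 := by
        simpa [hF2] using h2₁
      have hfr : ∀ r < 11, r ≠ 2 → Function.update f₁ 39 0 r = f r := fun r hr hr2 => by
        rw [hf₁' r (by omega) hr2, hFr r hr]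
      -- Distinct carriers make the two off-diagonal increments hit mirror entries, which keeps the
      -- matrix symmetric.
      have hne : w q ≠ w r := fun h' => hqr (h.injective h')
      refine ⟨w, _, ⟨?_, ?_, ?_, ?_, ?_, ?_,
        ((h.reduced.incr_diag (w q) 3).incr_pair hne 3).incr_diag (w r) 3, hm₁, h.injective, ?_, ?_,
        by omega, ?_⟩⟩
      · exact he.congr fun r _ _ => hfr r (by omega) (by omega)
      · rw [h2₁']
        exact Nat.mod_lt _ (by norm_num)
      · rw [hfr _ (by norm_num) (by norm_num), h.exponent]
      · rw [hf₁' _ (by norm_num) (by norm_num), hF11]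
      · rw [hf₁' _ (by norm_num) (by norm_num), hF12]
        omega
      · rw [hf₁' _ (by norm_num) (by norm_num), hF12]
        exact hinput
      · intro r
        have := h.carrier_fresh r
        rw [hlen] at this
        omega
      · intro i hi hi' j
        have h1 := h.carrier_fresh q
        have h2 := h.carrier_fresh r
        rw [hlen] at h1 h2
        have h3 : i ≠ w q := by rintro rfl; omega
        have h4 : i ≠ w r := by rintro rfl; omega
        rw [incr_of_ne_left _ h4, incr_of_ne_left _ h4, incr_of_ne_left _ h3, incr_of_ne_left _ h3,
          h.row_fresh i hi (by rw [hlen]; omega)]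
      · rw [h.value, avg_phase_rotXX, h2₁', omega8_pow_mod, hfr 1 (by norm_num) (by norm_num),
          pow_succ]
        ring
  · intro h13
    cases g with
    | rotX q =>
      rw [hF13, hin0] at h13
      exact absurd h13 one_ne_zero
    | rotXX q r hqr =>
      rw [hF13, hin0] at h13
      exact absurd h13 two_ne_zero
    | had q =>
      have hq : m (f 12 + 1) = q := hin1
      rw [hq, h.mem.carrier] at hF19
      rw [hq] at hF18
      have haN : n + C.length < N := by omega
      refine Wp.mono (wp_hadProg heF h.mem hn h.reduced.lt q (w q) ⟨n + C.length, haN⟩ hF18 hF19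
        hF16) (by omega) ?_
      rintro f₁ m₁ ⟨hm₁, h1₁, hf₁⟩
      have hfr : ∀ r < 11, r ≠ 1 → f₁ r = f r := fun r hr hr1 => by
        rw [hf₁ r (by omega) hr1, hFr r hr]
      -- Before this gate, carriers have index below n or at least n + |C| + 1, so this index lies
      -- in the gap.
      have hw : ∀ r, w r ≠ ⟨n + C.length, haN⟩ := by
        intro r h'
        have h1 := h.carrier_fresh r
        rw [hlen, h'] at h1
        simp at h1
      refine ⟨_, _, ⟨?_, ?_, ?_, ?_, ?_, ?_, h.reduced.incr_pair (hw q) 1, hm₁, ?_, ?_, ?_,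
        by omega, ?_⟩⟩
      · exact he.congr fun r _ _ => hfr r (by omega) (by omega)
      · rw [hfr _ (by norm_num) (by norm_num)]
        exact h.phase_lt
      · rw [hfr _ (by norm_num) (by norm_num), h.exponent]
      · rw [hf₁ _ (by norm_num) (by norm_num), hF11]
      · rw [hf₁ _ (by norm_num) (by norm_num), hF12]
        omega
      · rw [hf₁ _ (by norm_num) (by norm_num), hF12]
        exact hinput
      · intro r s hrs
        by_cases hr : r = q <;> by_cases hs : s = q
        · rw [hr, hs]
        · subst hr
          rw [Function.update_self, Function.update_of_ne hs] at hrs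
          exact absurd hrs.symm (hw s)
        · subst hs
          rw [Function.update_self, Function.update_of_ne hr] at hrs
          exact absurd hrs (hw r)
        · rw [Function.update_of_ne hr, Function.update_of_ne hs] at hrs
          exact h.injective hrs
      · intro r
        by_cases hr : r = q
        · subst hr
          simp
        · rw [Function.update_of_ne hr]
          have := h.carrier_fresh r
          rw [hlen] at this
          omega
      · intro i hi hi' j
        have h1 := h.carrier_fresh q
        rw [hlen] at h1
        have h3 : i ≠ w q := by rintro rfl; omega
        have h4 : i ≠ ⟨n + C.length, haN⟩ := by rintro rfl; simp at hi'
        rw [incr_of_ne_left _ h4, incr_of_ne_left _ h3, h.row_fresh i hi (by rw [hlen]; omega)]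
      · rw [h.value, avg_phase_had h.reduced q (a := ⟨n + C.length, haN⟩)
          (h.row_fresh _ (by simp) (by simp)) hw, h1₁, hF1, hfr 2 (by norm_num) (by norm_num),
          pow_succ]
        ring
  · rintro f₁ m₁ ⟨w₁, M₁, h₁⟩
    apply Wp.nil
    have hfr : ∀ r < 39, Function.update f₁ 39 0 r = f₁ r := fun r hr =>
      Function.update_of_ne (by omega) _ _
    exact ⟨w₁, M₁, ⟨h₁.env.update, by rw [hfr _ (by norm_num)]; exact h₁.phase_lt,
      by rw [hfr _ (by norm_num)]; exact h₁.exponent, by rw [hfr _ (by norm_num)]; exact h₁.counter,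
      by rw [hfr _ (by norm_num)]; exact h₁.pointer, by rw [hfr _ (by norm_num)]; exact h₁.input,
      h₁.reduced, h₁.mem, h₁.injective, h₁.carrier_fresh, h₁.row_fresh, h₁.size,
      by rw [hfr 1 (by norm_num), hfr 2 (by norm_num)]; exact h₁.value⟩⟩

end gatePrograms

/-! ### The complete program -/

section mainProgram

open RAM

/-- Sets up the memory layout and the carriers of the qubits. -/
def initProg : RAM := block [.const 3 1, .const 9 0, .load 4 9, .load 10 3, .add 5 4 10,
  .const 6 2, .add 6 6 4, .add 12 6 9, .add 6 6 10, .add 6 6 10, .add 6 6 10, .add 7 6 5,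
  .add 8 7 5, .add 11 10 9, .const 10 0, .add 17 4 9, forDown 17 [.add 13 6 17, .store 13 17]]

/-- Computes the output amplitude of a Clifford circuit. -/
def amplitudeProg : RAM := block [initProg, forDown 11 gateBody, .add 17 4 9, forDown 17 flipBody,
  elimProg, finishProg]

variable {f m : ℕ → ℕ} {inp : ℕ → ℕ} {n N D : ℕ} {w : Fin n → Fin N} {b : Fin N → ℕ}
  {M : Fin N → Fin N → ℕ} {A : ℂ} {x : Fin n → ZMod 2}

lemma wp_gates (C : Circuit n) : ∀ f m, (∃ w M, GateState A x inp N D C f m w M) →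
    Wp (C.length * (16 * N + 93) + 1) (forDown 11 gateBody) f m fun f' m' =>
      ∃ w' M', GateState A x inp N D [] f' m' w' M' := by
  intro f m h
  refine Wp.mono (Wp.forDown (T := 16 * N + 91) (fun k f' m' => ∃ C' : Circuit n, C'.length = k ∧
    ∃ w' M', GateState A x inp N D C' f' m' w' M') ?_ ?_ C.length f m ⟨C, rfl, h⟩) le_rfl ?_
  · rintro k f' m' ⟨C', rfl, w', M', h'⟩
    exact ⟨h'.counter, h'.env.one⟩
  · rintro k f' m' ⟨C', hC', w', M', h'⟩
    obtain ⟨g, C'', rfl⟩ := List.exists_cons_of_length_eq_add_one hC'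
    obtain rfl : C''.length = k := by simpa using hC'
    exact Wp.mono (wp_gateBody h') le_rfl fun f m h => ⟨C'', rfl, h⟩
  · rintro f' m' ⟨C', hC', h'⟩
    rw [List.length_eq_zero_iff] at hC'
    subst hC'
    exact h'

/-- The state of the machine when the first `k` output bits are still to be read. -/
structure FlipState (A : ℂ) (x : Fin n → ZMod 2) (inp : ℕ → ℕ) (N D k : ℕ) (f m : ℕ → ℕ)
    (w : Fin n → Fin N) (M : Fin N → Fin N → ℕ) : Prop where
  env : Env n N D f
  phase_lt : f 2 < 8
  exponent : f 10 = 0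
  counter : f 17 = k
  le : k ≤ n
  reduced : Reduced M
  mem : MemRep inp D w (fun _ => 0) M m
  value : A = (Real.sqrt 2 : ℂ) ^ f 1 * omega8 ^ f 2 * avg fun z => phase M z *
    ∏ q ∈ Finset.univ.filter (fun q : Fin n => q.val < k), sgn (x q * z (w q))

lemma wp_flipBody {k : ℕ} (hn : n ≤ N) (hD : n + 2 ≤ D)
    (hinp : ∀ q : Fin n, inp (2 + q) = (x q).val) (h : FlipState A x inp N D (k + 1) f m w M) :
    Wp (4 * N + 22) (block flipBody) (Function.update f 17 k) m fun f' m' =>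
      ∃ M', FlipState A x inp N D k f' m' w M' := by
  have he := h.env
  have hk : k < n := h.le
  have hx : m (2 + k) = (x ⟨k, hk⟩).val := by
    rw [h.mem.input _ (by omega)]
    exact hinp ⟨k, hk⟩
  have hw : m (D + k) = w ⟨k, hk⟩ := h.mem.carrier ⟨k, hk⟩
  apply Wp.const
  apply Wp.add
  apply Wp.load
  apply Wp.add
  apply Wp.add
  apply Wp.load
  apply Wp.add
  generalize hF : Function.update _ 31 _ = F
  have hFr : ∀ r < 13, F r = f r := by
    intro r hr
    rw [← hF]
    simp [show r ≠ 31 by omega, show r ≠ 30 by omega, show r ≠ 18 by omega, show r ≠ 32 by omega,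
      show r ≠ 13 by omega, show r ≠ 17 by omega]
  have heF : Env n N D F := he.of_frame (K := 13) hFr
  have hF17 : F 17 = k := by rw [← hF]; simp
  have hF30 : F 30 = w ⟨k, hk⟩ := by rw [← hF]; simp [he.carriers, hw]
  have hF31 : F 31 = w ⟨k, hk⟩ := by rw [← hF]; simp [he.carriers, hw, he.zero]
  have hF32 : F 32 = 2 * (x ⟨k, hk⟩).val := by rw [← hF]; simp [hx, two_mul]
  clear hF
  refine Wp.cons (wp_incrProg heF h.mem hn h.reduced.lt _ _ _ hF30 hF31 hF32 ?_) (T₂ := 1) ?_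
    (by omega)
  · have := ZMod.val_lt (x ⟨k, hk⟩)
    omega
  rintro f₁ m₁ ⟨hm₁, hf₁⟩
  apply Wp.nil
  have hfr : ∀ r < 13, Function.update f₁ 39 0 r = f r := fun r hr => by
    rw [Function.update_of_ne (by omega), hf₁ r (by omega), hFr r hr]
  refine ⟨_, ⟨he.of_frame (K := 13) hfr, ?_, ?_, ?_, hk.le, h.reduced.incr_diag _ _, hm₁, ?_⟩⟩
  · rw [hfr _ (by norm_num)]
    exact h.phase_lt
  · rw [hfr _ (by norm_num), h.exponent]
  · rw [Function.update_of_ne (by norm_num), hf₁ _ (by norm_num), hF17]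
  · rw [h.value, avg_phase_flip k hk, hfr 1 (by norm_num), hfr 2 (by norm_num)]

lemma wp_flips (hn : n ≤ N) (hD : n + 2 ≤ D) (hinp : ∀ q : Fin n, inp (2 + q) = (x q).val)
    (h : FlipState A x inp N D n f m w M) :
    Wp (n * (4 * N + 24) + 1) (forDown 17 flipBody) f m fun f' m' =>
      ∃ M', ElimState A inp D w M' f' m' := by
  refine Wp.mono (Wp.forDown (T := 4 * N + 22) (fun k f' m' => ∃ M',
    FlipState A x inp N D k f' m' w M') ?_ ?_ n f m ⟨M, h⟩) le_rfl ?_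
  · rintro k f' m' ⟨M', h'⟩
    exact ⟨h'.counter, h'.env.one⟩
  · rintro k f' m' ⟨M', h'⟩
    exact wp_flipBody hn hD hinp h'
  · rintro f' m' ⟨M', h'⟩
    refine ⟨M', h'.env, h'.phase_lt, h'.reduced, ⟨_, h'.mem⟩, ?_⟩
    have := h'.value
    simp only [not_lt_zero, Finset.filter_false, Finset.prod_empty, mul_one] at this
    rw [this, h'.exponent, pow_zero, mul_one]

/-- The empty circuit leaves the sign (-1)^{x·z} on the carriers, here written as a product over all
qubits. -/
lemma GateState.flipState (h : GateState A x inp N D [] f m w M) :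
    FlipState A x inp N D n (Function.update f 17 n) m w M where
  env := h.env.update
  phase_lt := h.phase_lt
  exponent := h.exponent
  counter := by simp
  le := le_rfl
  reduced := h.reduced
  mem := h.mem
  value := by
    have := h.value
    simp only [xAmp_nil, dotProduct, Function.comp_apply, sgn_sum] at this
    simpa using this

lemma length_flatMap_encode (C : Circuit n) : (C.flatMap Gate.encode).length = 3 * C.length := by
  induction C with
  | nil => rfl
  | cons g C ih =>
    rw [List.flatMap_cons, List.length_append, ih, List.length_cons]
    cases g <;> simp [Gate.encode] <;> ring

section input

variable (C : Circuit n) (x)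

lemma encodeInput_bits (q : Fin n) : (encodeInput C x).getD (2 + q) 0 = (x q).val := by
  rw [encodeInput, add_comm, List.cons_append, List.cons_append, List.getD_cons_succ,
    List.getD_cons_succ, List.getD_append _ _ _ _ (by simp), List.getD_eq_getElem _ _ (by simp)]
  simp

lemma encodeInput_gates (j : ℕ) :
    (encodeInput C x).getD (2 + n + j) 0 = (C.flatMap Gate.encode).getD j 0 := by
  rw [encodeInput, show 2 + n + j = n + j + 2 by ring, List.cons_append, List.cons_append,
    List.getD_cons_succ, List.getD_cons_succ, List.getD_append_right _ _ _ _ (by simp)]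
  simp

lemma encodeInput_of_le (a : ℕ) (h : 2 + n + 3 * C.length ≤ a) :
    (encodeInput C x).getD a 0 = 0 := by
  apply List.getD_eq_default
  rw [encodeInput, List.length_append, length_flatMap_encode]
  simp
  omega

/-- Beyond the input the memory is zero, so the buffer and the matrix need no initialisation; only
the carriers are written. The zero matrix has phase 1, and the amplitude is an average over the
larger set of N variables. -/
lemma wp_initProg (hN : n + C.length = N) :
    Wp (n * 5 + 18) initProg (fun _ => 0) (fun a => (encodeInput C x).getD a 0) fun f' m' =>
      ∃ w M, GateState (cliffordAmplitude C x) x (fun a => (encodeInput C x).getD a 0) N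
        (2 + n + 3 * C.length) C f' m' w M := by
  have h0 : (fun a => (encodeInput C x).getD a 0) 0 = n := rfl
  have h1 : (fun a => (encodeInput C x).getD a 0) 1 = C.length := rfl
  have hgates := encodeInput_gates x C
  have hzero := encodeInput_of_le x C
  change ∀ j, (fun a => (encodeInput C x).getD a 0) (2 + n + j) = _ at hgates
  change ∀ a, _ → (fun a => (encodeInput C x).getD a 0) a = _ at hzero
  generalize (fun a => (encodeInput C x).getD a 0) = m₀ at *
  have hN' : n ≤ N := by omega
  apply Wp.const
  apply Wp.const
  apply Wp.load
  apply Wp.load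
  apply Wp.add
  apply Wp.const
  apply Wp.add
  apply Wp.add
  apply Wp.add
  apply Wp.add
  apply Wp.add
  apply Wp.add
  apply Wp.add
  apply Wp.add
  apply Wp.const
  apply Wp.add
  generalize hF : Function.update _ 17 _ = F
  have hF17 : F 17 = n := by rw [← hF]; simp [h0]
  have heF : Env n N (2 + n + 3 * C.length) F := by
    refine ⟨?_, ?_, ?_, ?_, ?_, ?_, ?_⟩ <;> rw [← hF] <;> simp [h0, h1] <;> omega
  have hF1 : F 1 = 0 := by rw [← hF]; simp
  have hF2 : F 2 = 0 := by rw [← hF]; simp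
  have hF10 : F 10 = 0 := by rw [← hF]; simp
  have hF11 : F 11 = C.length := by rw [← hF]; simp [h1]
  have hF12 : F 12 = 2 + n := by rw [← hF]; simp [h0]
  clear hF
  refine Wp.cons (Wp.forDown (T := 3) (fun k f' m' => k ≤ n ∧ f' 17 = k ∧
    (∀ r < 13, f' r = F r) ∧ m' = fun a => if 2 + n + 3 * C.length + k ≤ a ∧
      a < 2 + n + 3 * C.length + n then a - (2 + n + 3 * C.length) else
        m₀ a) ?_ ?_ n _ _ ?_) (T₂ := 1) ?_ (by omega)
  · rintro k f' m' ⟨_, h17, hf', _⟩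
    exact ⟨h17, by rw [hf' _ (by norm_num), heF.one]⟩
  · rintro k f' m' ⟨hk, h17, hf', hm'⟩
    have h6 : f' 6 = 2 + n + 3 * C.length := by rw [hf' _ (by norm_num), heF.carriers]
    apply Wp.add
    apply Wp.store
    apply Wp.nil
    refine ⟨by omega, by simp, fun r hr => ?_, ?_⟩
    · simp [show r ≠ 39 by omega, show r ≠ 13 by omega, show r ≠ 17 by omega, hf' r hr]
    · rw [hm']
      ext a
      simp only [Function.update_apply, h6]
      norm_num
      split_ifs <;> first | rfl | omega
  · refine ⟨le_rfl, hF17, fun _ _ => rfl, ?_⟩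
    ext a
    rw [if_neg (by omega)]
  · rintro f' m' ⟨-, -, hf', hm'⟩
    apply Wp.nil
    have hfr : ∀ r < 13, Function.update f' 39 0 r = F r := fun r hr => by
      rw [Function.update_of_ne (by omega), hf' r hr]
    refine ⟨Fin.castLE hN', fun _ _ => 0, ⟨heF.of_frame (K := 13) hfr, ?_, ?_, ?_, ?_, ?_,
      ⟨fun _ _ => rfl, fun _ _ => by norm_num⟩, ⟨?_, ?_, ?_, ?_⟩, Fin.castLE_injective hN', ?_,
      fun _ _ _ _ => rfl, hN.le, ?_⟩⟩
    · rw [hfr _ (by norm_num), hF2]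
      norm_num
    · rw [hfr _ (by norm_num), hF10]
    · rw [hfr _ (by norm_num), hF11]
    · rw [hfr _ (by norm_num), hF12]
    · intro j
      rw [hfr _ (by norm_num), hF12]
      exact hgates j
    · intro a ha
      rw [hm']
      exact if_neg (by omega)
    · intro q
      rw [hm']
      have := q.isLt
      simp
    · intro j
      rw [hm']
      exact (if_neg (by omega)).trans (hzero _ (by omega))
    · intro i j
      rw [hm']
      exact (if_neg (by omega)).trans (hzero _ (by omega))
    · intro q
      exact Or.inl q.isLt
    · rw [hfr 1 (by norm_num), hfr 2 (by norm_num), hF1, hF2, cliffordAmplitude,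
        op_apply_zero_eq_avg C x (Fin.castLE hN') (Fin.castLE_injective hN')]
      simp [phase_zero]

/-- Both the number of qubits and the number of gates are at most `N`, so all bounds are in `N`
alone. The elimination dominates: O(N²) steps of cubic cost, a polynomial of degree five. -/
lemma wp_amplitudeProg (hN : n + C.length = N) :
    Wp (N * 5 + (N * (16 * N + 93) + (N * (4 * N + 24) +
      (N * (pivotTime N + N * (2 * pivotTime N + 5) + 6) + (N * (4 * N + 13) + 30)))))
      amplitudeProg (fun _ => 0) (fun a => (encodeInput C x).getD a 0) fun f' m' =>
        RAMState.value ⟨f', m'⟩ = cliffordAmplitude C x ∧ f' 2 < 8 := by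
  have h1 : C.length * (16 * N + 93) ≤ N * (16 * N + 93) := Nat.mul_le_mul_right _ (by omega)
  have h2 : n * (4 * N + 24) ≤ N * (4 * N + 24) := Nat.mul_le_mul_right _ (by omega)
  refine Wp.cons (wp_initProg x C hN) (T₂ := N * (16 * N + 93) + (N * (4 * N + 24) +
      (N * (pivotTime N + N * (2 * pivotTime N + 5) + 6) + (N * (4 * N + 13) + 12)))) ?_ (by omega)
  intro f₁ m₁ hs₁
  refine Wp.cons (wp_gates C f₁ m₁ hs₁) (T₂ := N * (4 * N + 24) +
      (N * (pivotTime N + N * (2 * pivotTime N + 5) + 6) + (N * (4 * N + 13) + 11))) ?_ (by omega)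
  rintro f₂ m₂ ⟨w₂, M₂, hs₂⟩
  refine Wp.mono (Wp.add (T := N * (4 * N + 24) +
      (N * (pivotTime N + N * (2 * pivotTime N + 5) + 6) + (N * (4 * N + 13) + 10))) ?_)
      (by omega) fun _ _ h => h
  rw [hs₂.env.qubits, hs₂.env.zero, add_zero]
  refine Wp.cons (wp_flips (by omega) (by omega) (encodeInput_bits x C) hs₂.flipState)
    (T₂ := N * (pivotTime N + N * (2 * pivotTime N + 5) + 6) + (N * (4 * N + 13) + 9)) ?_ (by omega)
  rintro f₃ m₃ ⟨M₃, hs₃⟩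
  refine Wp.cons (wp_elimProg hs₃ (by omega)) (T₂ := N * (4 * N + 13) + 6) ?_ (by omega)
  rintro f₄ m₄ ⟨M₄, hs₄, hz⟩
  refine Wp.cons (wp_finishProg hs₄ hz (norm_circuit_op_apply_le C x 0)) (T₂ := 1) ?_ (by omega)
  rintro f₅ m₅ ⟨hval, h2⟩
  apply Wp.nil
  refine ⟨?_, by simpa using h2⟩
  rw [← hval]
  simp [RAMState.value]

end input

/-- The amplitudes of Clifford circuits are computed in polynomial time. -/
theorem exists_amplitude_program : ∃ (M : RAM) (p : Polynomial ℕ), ∀ (n : ℕ) (C : Circuit n)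
    (x : Fin n → ZMod 2), ∃ t s, RAM.Exec M (RAMState.init (encodeInput C x)) t s ∧
      t ≤ p.eval (n + C.length) ∧ s.value = cliffordAmplitude C x ∧ s.reg 2 < 8 := by
  let P : Polynomial ℕ := 4 * Polynomial.X ^ 3 + 28 * Polynomial.X ^ 2 + 30 * Polynomial.X + 36
  let X : Polynomial ℕ := Polynomial.X
  refine ⟨amplitudeProg, X * 5 + (X * (16 * X + 93) + (X * (4 * X + 24) +
    (X * (P + X * (2 * P + 5) + 6) + (X * (4 * X + 13) + 30)))), fun n C x => ?_⟩
  obtain ⟨t, s, he, ht, hv, h2⟩ := wp_amplitudeProg x C rfl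
  refine ⟨t, s, he, ?_, hv, h2⟩
  simpa [P, X, pivotTime] using ht

end mainProgram

theorem mainTheorem3 :
    (∀ (n : ℕ) (C : Circuit n) (x : Fin n → ZMod 2),
      let P := circuitProgram C x
      let G := P.augmented
      let V := G.space
      (BicycleCondition V →
        IsLeast (brownSet V) (brownInvariant V) ∧
        cliffordAmplitude C x =
          (Real.sqrt 2 : ℂ) ^
              ((hadamardCount C : ℤ) + (bicycleDim V : ℤ) - (G.matroid.eRank.toNat : ℤ)) *
            Complex.exp (Complex.I * (Real.pi / 4 : ℝ) *
              (((hadamardCount C : ℤ) + (Nat.card P.AugEdge : ℤ) - (brownInvariant V : ℤ)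
                - 2 * (hammingNorm x : ℤ) : ℤ) : ℂ))) ∧
      (¬ BicycleCondition V → cliffordAmplitude C x = 0)) ∧
    (∃ (M : RAM) (p : Polynomial ℕ), ∀ (n : ℕ) (C : Circuit n) (x : Fin n → ZMod 2),
      ∃ t s, RAM.Exec M (RAMState.init (encodeInput C x)) t s ∧
        t ≤ p.eval (n + C.length) ∧
        s.value = cliffordAmplitude C x ∧ s.reg 2 < 8) := by
  refine ⟨fun n C x => ⟨fun h => ⟨isLeast_brownInvariant _ h, amplitude_eq_brown C x h⟩,
    amplitude_eq_zero C x⟩, exists_amplitude_program⟩
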